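/- **Conventions.** $n$ is the security parameter; $\varepsilon(n)$ is negligible if it decays faster than the inverse of every polynomial. All lengths below ($\ell, d, m, \dots$) are functions of $n$. A classical algorithm is efficient if it is computed by Boolean circuits of polynomial size; a probabilistic algorithm is a deterministic function of its input and of uniform coins. A polynomial-time quantum algorithm is a sequence (indexed by $n$) of circuits with polynomially many qubits, Hadamard, phase, $\pi/8$ and CNOT gates, and oracle queries. A quantum query to $O$ applies $|x,y\rangle\mapsto|x,y\oplus O(x)\rangle$; in a classical query the register $x$ is measured first. **PRFs.** An efficient keyed function $F_n:\{0,1\}^{\kappa(n)}\times\{0,1\}^{a(n)}\to\{0,1\}^{b(n)}$ is a quantum-accessible (resp. classical-access) PRF if every polynomial-time quantum distinguisher with quantum (resp. classical) oracle access distinguishes $F_n(k,\cdot)$, $k$ uniform, from a uniformly random function with only negligible advantage. *Quantum-accessible PRFs exist* means that there is one with $a(n)\ge n$ and $b(n)\ge 1$ for all $n$. **PSF.** Let $D_n\subseteq\{0,1\}^{d(n)}$ and $R_n\subseteq\{0,1\}^{m(n)}$, with membership in $D_n$ efficiently decidable. A PSF is a tuple $\mathcal F=(G,\mathrm{Sample},f,f^{-1})$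 of efficient algorithms such that, for all key pairs $(sk,pk)$ output by $G(1^n)$ and for negligible functions $\varepsilon_{sample},\varepsilon_{pre},\varepsilon_{prob}$ of $n$: * $f(pk,\cdot)$ maps $D_n$ to $R_n$, and $\mathrm{Sample}(pk)\in D_n$; * the distribution of $f(pk,\mathrm{Sample}(pk))$ is within variational distance $\varepsilon_{sample}$ of uniform on $R_n$; * for every $y\in R_n$, $f^{-1}(sk,y)$ always returns some $x\in D_n$ with $f(pk,x)=y$; and, if $y$ is attained by $f(pk,\mathrm{Sample}(pk))$ with positive probability, the distribution of $f^{-1}(sk,y)$ is within $\varepsilon_{pre}$ of the distribution of $x\gets\mathrm{Sample}(pk)$ conditioned on $f(pk,x)=y$, and every element has probability at most $\varepsilon_{prob}$ in that conditional distribution. $\mathcal F$ is secure against quantum adversaries if every polynomial-time quantum adversary has negligible success probability in each of two games: given $pk$ and a uniform $y\in R_n$, find $x\in D_n$ with $f(pk,x)=y$; given $pk$, find distinct $x_1,x_2\in D_n$ with $f(pk,x_1)=f(pk,x_2)$. **FDH-PSF.** Let $H:\{0,1\}^{\ell(n)}\to R_n$ be the random oracle and let $P$ be a classical-access PRF from $\{0,1\}^{\ell(n)}$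 to strings of coins of $f^{-1}$, used to derandomize signing. Key generation runs $G(1^n)$ and picks a uniform key $k$ for $P$; the secret key is $(sk,k)$ and the public key is $pk$. The signature of $M\in\{0,1\}^{\ell(n)}$ is $f^{-1}(sk,H(M);P_n(k,M))$, and $\sigma$ is a valid signature of $M$ iff $\sigma\in D_n$ and $f(pk,\sigma)=H(M)$. **Corollary.** If quantum-accessible PRFs exist, $\mathcal F$ is a PSF that is secure against quantum adversaries, and $P$ is any classical-access PRF as above, then FDH-PSF is correct (honest signatures always verify) and is secure in the quantum-accessible random oracle model: every polynomial-time quantum adversary which is given $pk$, quantum access to $H$ and classical access to the signing oracle, outputs with only negligible probability a pair $(M,\sigma)$ such that $\sigma$ is a valid signature of $M$ and $M$ was never asked to the signing oracle. -/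

import Mathlib

open scoped BigOperators

/-! ### Bit strings, negligible functions, probabilities -/

/-- Bit strings of length `k`. -/
abbrev Bits (k : ℕ) : Type := Fin k → Bool

/-- `ε` is negligible: it decays faster than the inverse of every polynomial in `n`. -/
def Negligible (ε : ℕ → ℝ) : Prop :=
  Asymptotics.SuperpolynomialDecay Filter.atTop (fun n : ℕ => (n : ℝ)) ε

open scoped Classical in
/-- The probability that `X r = a` when the coins `r` are uniform. -/
noncomputable def prEq {c : ℕ} {α : Type} (X : Bits c → α) (a : α) : ℝ :=
  𝔼 r : Bits c, if X r = a then (1 : ℝ) else 0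

open scoped Classical in
/-- The probability that `X r = x` conditioned on `g (X r) = y`, for uniform coins `r`
(only used when the conditioning event has positive probability). -/
noncomputable def condPr {c : ℕ} {α β : Type} (X : Bits c → α) (g : α → β) (y : β) (x : α) : ℝ :=
  (if g x = y then prEq X x else 0) / prEq (fun r => g (X r)) y

/-! ### Efficient classical algorithms -/

/-- A Boolean circuit with `a` input bits and `b` output bits. Wires `0, …, a - 1` carry the input,
and the `t`-th gate `(i, j)` puts the NAND of wires `i` and `j` on the new wire `a + t`
(a wire that does not exist yet reads as `false`). -/
structure BoolCircuit (a b : ℕ) where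
  gates : List (ℕ × ℕ)
  out : Fin b → ℕ

/-- The values of all wires. -/
def BoolCircuit.wires {a b : ℕ} (C : BoolCircuit a b) (x : Bits a) : List Bool :=
  C.gates.foldl (fun w g => w ++ [!(w.getD g.1 false && w.getD g.2 false)]) (List.ofFn x)

/-- The function computed by a circuit. -/
def BoolCircuit.eval {a b : ℕ} (C : BoolCircuit a b) (x : Bits a) : Bits b :=
  fun j => (C.wires x).getD (C.out j) false

/-- The size of a circuit: number of inputs, outputs and gates. -/
def BoolCircuit.size {a b : ℕ} (C : BoolCircuit a b) : ℕ := a + b + C.gates.length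

/-- The functions `f n : {0,1}^(a n) → {0,1}^(b n)` are computed by circuits of polynomial size.
A probabilistic algorithm is treated as a deterministic function of its input and its coins. -/
def Efficient {a b : ℕ → ℕ} (f : ∀ n, Bits (a n) → Bits (b n)) : Prop :=
  ∃ p : Polynomial ℕ, ∀ n, ∃ C : BoolCircuit (a n) (b n),
    C.size ≤ p.eval n ∧ ∀ x, C.eval x = f n x

/-- `Efficient` for functions of two arguments: the circuit reads their concatenation. -/
def Efficient₂ {a b c : ℕ → ℕ} (f : ∀ n, Bits (a n) → Bits (b n) → Bits (c n)) : Prop :=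
  Efficient (a := fun n => a n + b n) (b := c)
    (fun n z => f n (fun i => z (Fin.castAdd (b n) i)) (fun i => z (Fin.natAdd (a n) i)))

/-- `Efficient` for functions of three arguments. -/
def Efficient₃ {a b c d : ℕ → ℕ} (f : ∀ n, Bits (a n) → Bits (b n) → Bits (c n) → Bits (d n)) :
    Prop :=
  Efficient₂ (a := fun n => a n + b n) (b := c) (c := d)
    (fun n z => f n (fun i => z (Fin.castAdd (b n) i)) (fun i => z (Fin.natAdd (a n) i)))

/-! ### Quantum algorithms with oracles -/

/-- State vectors of `k` qubits, by their amplitudes in the computational basis. -/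
abbrev QState (k : ℕ) : Type := Bits k → ℂ

/-- The elementary gates: Hadamard, phase, `π/8` and CNOT. -/
inductive QGate (k : ℕ) : Type
  | hadamard (i : Fin k)
  | phase (i : Fin k)
  | piEighth (i : Fin k)
  | cnot (control target : Fin k) (h : control ≠ target)

/-- The unitary transformation of a gate. -/
noncomputable def QGate.apply {k : ℕ} : QGate k → QState k → QState k
  | .hadamard i, ψ => fun z =>
      ((1 / Real.sqrt 2 : ℝ) : ℂ) * (ψ (Function.update z i false) +
        (if z i then -1 else 1) * ψ (Function.update z i true))
  | .phase i, ψ => fun z => (if z i then Complex.I else 1) * ψ z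
  | .piEighth i, ψ => fun z => (if z i then Complex.exp (Complex.I * Real.pi / 4) else 1) * ψ z
  | .cnot c t _, ψ => fun z => ψ (Function.update z t (xor (z t) (z c)))

/-- The oracles that an algorithm may use: their input and output lengths, and whether the access
is classical (the query register is measured first) or quantum. -/
structure OracleSpec where
  ι : Type
  inLen : ι → ℕ
  outLen : ι → ℕ
  classical : ι → Bool

/-- The functions that answer the oracle queries. -/
def OracleSpec.Impl (𝒪 : OracleSpec) : Type :=
  ∀ i : 𝒪.ι, Bits (𝒪.inLen i) → Bits (𝒪.outLen i)

/-- Lists of measured classical queries (latest first). -/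
abbrev OracleSpec.Transcript (𝒪 : OracleSpec) : Type :=
  List (Σ i : 𝒪.ι, Bits (𝒪.inLen i))

/-- One step of an algorithm on `k` qubits: a gate, or a query to oracle `i` with
query and answer registers placed on the distinct wires given by `w`. -/
inductive QOp (𝒪 : OracleSpec) (k : ℕ) : Type
  | gate (g : QGate k)
  | query (i : 𝒪.ι) (w : Fin (𝒪.inLen i) ⊕ Fin (𝒪.outLen i) ↪ Fin k)

/-- The basis map `|x, y⟩ ↦ |x, y ⊕ f x⟩` (identity on the other wires). -/
def xorQuery {k a b : ℕ} (f : Bits a → Bits b) (w : Fin a ⊕ Fin b ↪ Fin k) (z : Bits k) : Bits k :=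
  fun j => xor (z j) (decide (∃ t, w (Sum.inr t) = j ∧ f (fun s => z (w (Sum.inl s))) t = true))

/-- The unitary of an oracle query; `xorQuery f w` is an involution. -/
def queryApply {k a b : ℕ} (f : Bits a → Bits b) (w : Fin a ⊕ Fin b ↪ Fin k) (ψ : QState k) :
    QState k :=
  fun z => ψ (xorQuery f w z)

/-- Projection on the outcome `q` of a measurement of the query register (not normalized). -/
def projectQuery {k a b : ℕ} (w : Fin a ⊕ Fin b ↪ Fin k) (q : Bits a) (ψ : QState k) : QState k :=
  fun z => if (fun s => z (w (Sum.inl s))) = q then ψ z else 0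

open scoped Classical in
/-- The probability that running the given steps from the (possibly unnormalized) state `ψ`, with
the classical queries `tr` already made, and then measuring all qubits leads to a transcript and an
outcome that satisfy `E`. A classical query branches over the measured string; keeping the branch
states unnormalized makes the weights of the branches their probabilities. -/
noncomputable def runProb {𝒪 : OracleSpec} {k : ℕ} (O : 𝒪.Impl)
    (E : 𝒪.Transcript → Bits k → Prop) :
    List (QOp 𝒪 k) → 𝒪.Transcript → QState k → ℝ
  | [], tr, ψ => ∑ z : Bits k, if E tr z then ‖ψ z‖ ^ 2 else 0
  | .gate g :: ops, tr, ψ => runProb O E ops tr (g.apply ψ)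
  | .query i w :: ops, tr, ψ =>
      if 𝒪.classical i then
        ∑ q : Bits (𝒪.inLen i),
          runProb O E ops (⟨i, q⟩ :: tr) (queryApply (O i) w (projectQuery w q ψ))
      else runProb O E ops tr (queryApply (O i) w ψ)

/-- A quantum oracle circuit with a classical input of `a` bits and a classical output of `b` bits.
The input is written on the wires `inp`, all other qubits start in `|0⟩`, and at the end all
qubits are measured and the output is read from the wires `out`. -/
structure QCircuit (𝒪 : OracleSpec) (a b : ℕ) where
  width : ℕ
  ops : List (QOp 𝒪 width)
  inp : Fin a ↪ Fin width
  out : Fin b → Fin width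

/-- The size of a quantum circuit: number of qubits plus number of gates and queries. -/
def QCircuit.size {𝒪 : OracleSpec} {a b : ℕ} (C : QCircuit 𝒪 a b) : ℕ := C.width + C.ops.length

open scoped Classical in
/-- The initial basis state on input `x`. -/
noncomputable def QCircuit.init {𝒪 : OracleSpec} {a b : ℕ} (C : QCircuit 𝒪 a b) (x : Bits a) :
    QState C.width :=
  fun z => if z = (fun j => decide (∃ i, C.inp i = j ∧ x i = true)) then 1 else 0

/-- The probability that `C`, with oracles `O` and input `x`, makes classical queries and gives an
output that together satisfy `E`. -/
noncomputable def QCircuit.prob {𝒪 : OracleSpec} {a b : ℕ} (C : QCircuit 𝒪 a b) (O : 𝒪.Impl)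
    (x : Bits a) (E : 𝒪.Transcript → Bits b → Prop) : ℝ :=
  runProb O (fun tr z => E tr (fun j => z (C.out j))) C.ops [] (C.init x)

/-- A polynomial-time quantum algorithm: a sequence of circuits, one for each security
parameter, of polynomial size. -/
def PolySize {𝒪 : ℕ → OracleSpec} {a b : ℕ → ℕ} (A : ∀ n, QCircuit (𝒪 n) (a n) (b n)) : Prop :=
  ∃ p : Polynomial ℕ, ∀ n, (A n).size ≤ p.eval n

/-- No oracle at all. -/
def OracleSpec.none : OracleSpec where
  ι := Empty
  inLen := fun i => i.elim
  outLen := fun i => i.elim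
  classical := fun i => i.elim

/-- The answers of no oracle. -/
def OracleSpec.noneImpl : OracleSpec.none.Impl := fun i => Empty.elim i

/-- A single oracle `{0,1}^a → {0,1}^b`. -/
def OracleSpec.single (a b : ℕ) (cl : Bool) : OracleSpec where
  ι := Unit
  inLen := fun _ => a
  outLen := fun _ => b
  classical := fun _ => cl

/-! ### Hard problems -/

/-- A problem `(Game, α)`: the interface offered to the adversary, and the probability `winProb`
that the challenger outputs `1` when it plays the game against a given adversary. -/
structure Problem where
  oracles : ℕ → OracleSpec
  inLen : ℕ → ℕ
  outLen : ℕ → ℕ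
  winProb : ∀ n, QCircuit (oracles n) (inLen n) (outLen n) → ℝ
  α : ℝ

/-- The advantage `|Pr[A wins] - α|`. -/
noncomputable def Problem.advantage (P : Problem) (n : ℕ)
    (A : QCircuit (P.oracles n) (P.inLen n) (P.outLen n)) : ℝ :=
  |P.winProb n A - P.α|

/-- Every polynomial-time quantum adversary has negligible advantage. -/
def Problem.Hard (P : Problem) : Prop :=
  ∀ A : ∀ n, QCircuit (P.oracles n) (P.inLen n) (P.outLen n),
    PolySize A → Negligible (fun n => P.advantage n (A n))

/-! ### Pseudorandom functions -/

/-- Keyed functions `{0,1}^(a n) → {0,1}^(b n)` with keys of length `keyLen n`. -/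
structure KeyedFamily (a b : ℕ → ℕ) where
  keyLen : ℕ → ℕ
  eval : ∀ n, Bits (keyLen n) → Bits (a n) → Bits (b n)

/-- The difference between the probabilities that `D` outputs `1` with the oracle `F(k, ·)` for a
uniform key `k`, and with a uniformly random function as its oracle. -/
noncomputable def KeyedFamily.advantage {a b : ℕ → ℕ} (F : KeyedFamily a b) (cl : Bool) (n : ℕ)
    (D : QCircuit (OracleSpec.single (a n) (b n) cl) 0 1) : ℝ :=
  |(𝔼 k : Bits (F.keyLen n), D.prob (fun _ => F.eval n k) Fin.elim0 (fun _ y => y 0 = true)) -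
    (𝔼 O : Bits (a n) → Bits (b n), D.prob (fun _ => O) Fin.elim0 (fun _ y => y 0 = true))|

/-- `F` is efficiently computable and no polynomial-time quantum distinguisher with
classical (`cl = true`) or quantum (`cl = false`) access tells it from a random function. -/
def KeyedFamily.IsPRF {a b : ℕ → ℕ} (F : KeyedFamily a b) (cl : Bool) : Prop :=
  Efficient₂ F.eval ∧
    ∀ D : ∀ n, QCircuit (OracleSpec.single (a n) (b n) cl) 0 1,
      PolySize D → Negligible (fun n => F.advantage cl n (D n))

/-- A pseudorandom function against quantum distinguishers with quantum oracle access. -/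
def KeyedFamily.IsQuantumAccessiblePRF {a b : ℕ → ℕ} (F : KeyedFamily a b) : Prop := F.IsPRF false

/-- A pseudorandom function against quantum distinguishers with classical oracle access. -/
def KeyedFamily.IsClassicalAccessPRF {a b : ℕ → ℕ} (F : KeyedFamily a b) : Prop := F.IsPRF true

/-- Quantum-accessible pseudorandom functions exist: there is one with at least `n` input bits and
at least one output bit (on a domain of polynomial size such functions exist trivially). -/
def QuantumAccessiblePRFsExist : Prop :=
  ∃ (a b : ℕ → ℕ) (F : KeyedFamily a b),
    (∀ n, n ≤ a n) ∧ (∀ n, 0 < b n) ∧ F.IsQuantumAccessiblePRF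

/-! ### Preimage sampleable trapdoor functions -/

/-- The data `(G, Sample, f, f⁻¹)` of a family of trapdoor functions with preimage sampling, with
domain `D n ⊆ {0,1}^(domLen n)` and range `R n ⊆ {0,1}^(ranLen n)`. The last argument of the
probabilistic algorithms is their string of coins. -/
structure PSFData where
  skLen : ℕ → ℕ
  pkLen : ℕ → ℕ
  domLen : ℕ → ℕ
  ranLen : ℕ → ℕ
  genCoins : ℕ → ℕ
  sampleCoins : ℕ → ℕ
  invCoins : ℕ → ℕ
  D : ∀ n, Finset (Bits (domLen n))
  R : ∀ n, Finset (Bits (ranLen n))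
  gen : ∀ n, Bits (genCoins n) → Bits (skLen n) × Bits (pkLen n)
  sample : ∀ n, Bits (pkLen n) → Bits (sampleCoins n) → Bits (domLen n)
  f : ∀ n, Bits (pkLen n) → Bits (domLen n) → Bits (ranLen n)
  finv : ∀ n, Bits (skLen n) → Bits (ranLen n) → Bits (invCoins n) → Bits (domLen n)

/-- `𝓕` is a preimage sampleable trapdoor function (PSF). All conditions concern key pairs
`(sk, pk) = gen n r` that the generator outputs. -/
structure PSFData.IsPSF (𝓕 : PSFData) : Prop where
  gen_efficient : Efficient (b := fun n => 𝓕.skLen n + 𝓕.pkLen n)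
    (fun n r => Fin.append (𝓕.gen n r).1 (𝓕.gen n r).2)
  sample_efficient : Efficient₂ 𝓕.sample
  f_efficient : Efficient₂ 𝓕.f
  finv_efficient : Efficient₃ 𝓕.finv
  D_efficient : Efficient (b := fun _ => 1) (fun n x _ => decide (x ∈ 𝓕.D n))
  f_mem : ∀ n r, ∀ x ∈ 𝓕.D n, 𝓕.f n (𝓕.gen n r).2 x ∈ 𝓕.R n
  sample_mem : ∀ n r c, 𝓕.sample n (𝓕.gen n r).2 c ∈ 𝓕.D n
  /-- The image of a sample is statistically close to uniform on the range. -/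
  sample_uniform : ∃ ε : ℕ → ℝ, Negligible ε ∧ ∀ n r,
    ∑ y ∈ 𝓕.R n, |prEq (fun c => 𝓕.f n (𝓕.gen n r).2 (𝓕.sample n (𝓕.gen n r).2 c)) y
      - 1 / ((𝓕.R n).card : ℝ)| ≤ ε n
  /-- The trapdoor produces preimages. -/
  finv_correct : ∀ n r, ∀ y ∈ 𝓕.R n, ∀ c,
    𝓕.finv n (𝓕.gen n r).1 y c ∈ 𝓕.D n ∧
      𝓕.f n (𝓕.gen n r).2 (𝓕.finv n (𝓕.gen n r).1 y c) = y
  /-- The trapdoor's preimage is distributed almost as a sample conditioned on its image. -/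
  finv_dist : ∃ ε : ℕ → ℝ, Negligible ε ∧ ∀ n r, ∀ y ∈ 𝓕.R n,
    0 < prEq (fun c => 𝓕.f n (𝓕.gen n r).2 (𝓕.sample n (𝓕.gen n r).2 c)) y →
      ∑ x : Bits (𝓕.domLen n), |prEq (𝓕.finv n (𝓕.gen n r).1 y) x
        - condPr (𝓕.sample n (𝓕.gen n r).2) (𝓕.f n (𝓕.gen n r).2) y x| ≤ ε n
  /-- Preimage min-entropy. -/
  min_entropy : ∃ ε : ℕ → ℝ, Negligible ε ∧ ∀ n r, ∀ y ∈ 𝓕.R n,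
    0 < prEq (fun c => 𝓕.f n (𝓕.gen n r).2 (𝓕.sample n (𝓕.gen n r).2 c)) y →
      ∀ x, condPr (𝓕.sample n (𝓕.gen n r).2) (𝓕.f n (𝓕.gen n r).2) y x ≤ ε n

/-- `Inv(𝓕)`: given `pk` and a uniform `y` in the range, find a preimage of `y`. -/
noncomputable def PSFData.invProblem (𝓕 : PSFData) : Problem where
  oracles := fun _ => OracleSpec.none
  inLen := fun n => 𝓕.pkLen n + 𝓕.ranLen n
  outLen := fun n => 𝓕.domLen n
  winProb := fun n A =>
    𝔼 r : Bits (𝓕.genCoins n), 𝔼 y : 𝓕.R n,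
      A.prob OracleSpec.noneImpl (Fin.append (𝓕.gen n r).2 y.1)
        (fun _ x => x ∈ 𝓕.D n ∧ 𝓕.f n (𝓕.gen n r).2 x = y.1)
  α := 0

/-- `Col(𝓕)`: given `pk`, find two distinct points of the domain with the same image. -/
noncomputable def PSFData.colProblem (𝓕 : PSFData) : Problem where
  oracles := fun _ => OracleSpec.none
  inLen := fun n => 𝓕.pkLen n
  outLen := fun n => 𝓕.domLen n + 𝓕.domLen n
  winProb := fun n A =>
    𝔼 r : Bits (𝓕.genCoins n),
      A.prob OracleSpec.noneImpl (𝓕.gen n r).2 (fun _ z =>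
        let x₁ : Bits (𝓕.domLen n) := fun i => z (Fin.castAdd _ i)
        let x₂ : Bits (𝓕.domLen n) := fun i => z (Fin.natAdd _ i)
        x₁ ∈ 𝓕.D n ∧ x₂ ∈ 𝓕.D n ∧ x₁ ≠ x₂ ∧
          𝓕.f n (𝓕.gen n r).2 x₁ = 𝓕.f n (𝓕.gen n r).2 x₂)
  α := 0

/-- Security of a PSF against quantum adversaries. -/
def PSFData.SecureAgainstQuantum (𝓕 : PSFData) : Prop :=
  𝓕.invProblem.Hard ∧ 𝓕.colProblem.Hard

/-! ### Signature schemes in the random oracle model -/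

/-- A random oracle signature scheme `(G, S^H, V^H)` with deterministic signing. The random oracle
maps messages to elements of `hashRange n ⊆ {0,1}^(hashLen n)`. -/
structure ROSignature where
  SK : ℕ → Type
  pkLen : ℕ → ℕ
  msgLen : ℕ → ℕ
  sigLen : ℕ → ℕ
  hashLen : ℕ → ℕ
  genCoins : ℕ → ℕ
  hashRange : ∀ n, Finset (Bits (hashLen n))
  gen : ∀ n, Bits (genCoins n) → SK n × Bits (pkLen n)
  sign : ∀ n, (Bits (msgLen n) → Bits (hashLen n)) → SK n → Bits (msgLen n) → Bits (sigLen n)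
  verify : ∀ n, (Bits (msgLen n) → Bits (hashLen n)) → Bits (pkLen n) → Bits (msgLen n) →
    Bits (sigLen n) → Prop

/-- Honest signatures verify. -/
def ROSignature.IsCorrect (S : ROSignature) : Prop :=
  ∀ n r (H : Bits (S.msgLen n) → S.hashRange n) (m : Bits (S.msgLen n)),
    S.verify n (fun m' => (H m').1) (S.gen n r).2 m
      (S.sign n (fun m' => (H m').1) (S.gen n r).1 m)

/-- The two oracles of a signature forger. -/
inductive ForgerOracle : Type
  | hash
  | sign

/-- A forger has quantum access to the random oracle and classical access to the signer. -/
def forgerSpec (msgLen hashLen sigLen : ℕ) : OracleSpec where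
  ι := ForgerOracle
  inLen := fun _ => msgLen
  outLen := fun i => match i with
    | .hash => hashLen
    | .sign => sigLen
  classical := fun i => match i with
    | .hash => false
    | .sign => true

/-- The answers to a forger's queries. -/
def forgerImpl {msgLen hashLen sigLen : ℕ} (H : Bits msgLen → Bits hashLen)
    (sign : Bits msgLen → Bits sigLen) : (forgerSpec msgLen hashLen sigLen).Impl
  | .hash => H
  | .sign => sign

/-- `Sig-Forge(S)`: existential forgery under an adaptive chosen message attack, with quantum
access to the random oracle. -/
noncomputable def ROSignature.sigForge (S : ROSignature) : Problem where
  oracles := fun n => forgerSpec (S.msgLen n) (S.hashLen n) (S.sigLen n)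
  inLen := fun n => S.pkLen n
  outLen := fun n => S.msgLen n + S.sigLen n
  winProb := fun n A =>
    𝔼 r : Bits (S.genCoins n), 𝔼 H : Bits (S.msgLen n) → S.hashRange n,
      A.prob (forgerImpl (fun m => (H m).1) (S.sign n (fun m => (H m).1) (S.gen n r).1))
        (S.gen n r).2 (fun tr z =>
          let m : Bits (S.msgLen n) := fun i => z (Fin.castAdd _ i)
          let σ : Bits (S.sigLen n) := fun i => z (Fin.natAdd _ i)
          (⟨ForgerOracle.sign, m⟩ : Σ _ : ForgerOracle, Bits (S.msgLen n)) ∉ tr ∧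
            S.verify n (fun m' => (H m').1) (S.gen n r).2 m σ)
  α := 0

/-- Security of a signature scheme in the quantum-accessible random oracle model. -/
def ROSignature.Secure (S : ROSignature) : Prop := S.sigForge.Hard

/-- The scheme FDH-PSF: full domain hash with a PSF `𝓕`, for messages of `msgLen n` bits, where the
coins of the preimage sampler are derived from the message by the keyed function `P`, whose key is
part of the secret key. -/
def fdhPSF (𝓕 : PSFData) {msgLen : ℕ → ℕ} (P : KeyedFamily msgLen 𝓕.invCoins) : ROSignature where
  SK := fun n => Bits (𝓕.skLen n) × Bits (P.keyLen n)
  pkLen := 𝓕.pkLen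
  msgLen := msgLen
  sigLen := 𝓕.domLen
  hashLen := 𝓕.ranLen
  genCoins := fun n => 𝓕.genCoins n + P.keyLen n
  hashRange := 𝓕.R
  gen := fun n r =>
    let kp := 𝓕.gen n (fun i => r (Fin.castAdd (P.keyLen n) i))
    ((kp.1, fun i => r (Fin.natAdd (𝓕.genCoins n) i)), kp.2)
  sign := fun n H sk m => 𝓕.finv n sk.1 (H m) (P.eval n sk.2 m)
  verify := fun n H pk m σ => σ ∈ 𝓕.D n ∧ 𝓕.f n pk σ = H m

/-!
The proof never inverts `f`: a forgery is either a collision or a guess of a value with high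
min-entropy. Fix a key pair and a forger with `N` steps.

*Lazy hashing.* Replace the random oracle by `H m = f (Sample (c m))` with independent coins `c m`.
Each value of the oracle changes by a statistical distance `ε`, but there are exponentially many
values in superposition. Two close laws are both mixtures of their common part and of a rare
exception; the set of exceptional messages is independent of the run on the common part, so this run
rarely touches it, and a hybrid argument over the queries bounds the change of the success
probability by `O(N √ε)` (`abs_piE_sub_le`). The hybrid argument works with unnormalized branches,
and uses the weighted inequality `‖a + b‖² ≤ (1 + s) ‖a‖² + (1 + 1/s) ‖b‖²` in place of the triangle
inequality for norms (`runProb_add_le`).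

*Efficient coins.* A success probability is a combination of functions of at most `2 N + 1` values of
`c` (`runProb_mem_juntas`), so `c` can be replaced exactly by a `2 N + 1`-wise independent function, a
random polynomial over a field with `2 ^ m` elements (`expect_runProb_polyHash`), for which there are
explicit circuits. Hence no pseudorandomness is needed to simulate the random oracle.

*Signatures as samples.* The pseudorandom coins of the signer are replaced by random ones, which the
PRF permits because a circuit with classical access to the coins runs the forger
(`exists_distinguisher`). Now the pair of the hash value and the signature of `m` is
`(f x, f⁻¹ (f x))` for a sample `x`, with fresh coins for `f⁻¹`; its law is close to that of
`(f x, x)`, and `abs_piE_sub_le` applies again.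

*Extraction.* If signatures are the samples `x = Sample (c m)`, then a valid forgery on an unsigned
message is either `x` itself, which is unlikely since given `f x` the sample has min-entropy and the
run in question does not depend on it otherwise (`piE_guess_le`), or it collides with `x` under `f`.
The last event is produced by a circuit that gets only `pk` (`exists_collisionFinder`).

Both circuits come from `exists_simulator`. Classical circuits are compiled to Toffoli gates, with
scratch qubits that are uncomputed (`Comp.exists_gates`). The measurement of a signing query is
replaced by copying the message to a record on fresh wires, so that each component of the simulated
state with a given record carries the amplitudes of a branch of the original run. Keys of the
polynomial hash, and the key pair for the distinguisher, are hard-wired at their best values, which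
is possible because adversaries are sequences of circuits.
-/

/-! ### Gates and runs as linear and quadratic maps -/

/-- Apply a list of gates, first gate first. -/
noncomputable def applyGates {k : ℕ} : List (QGate k) → QState k → QState k
  | [], ψ => ψ
  | g :: L, ψ => applyGates L (g.apply ψ)

theorem applyGates_append {k : ℕ} (L₁ L₂ : List (QGate k)) (ψ : QState k) :
    applyGates (L₁ ++ L₂) ψ = applyGates L₂ (applyGates L₁ ψ) := by
  induction L₁ generalizing ψ with
  | nil => rfl
  | cons g L ih => exact ih _

theorem runProb_gates_append {𝒪 : OracleSpec} {k : ℕ} (O : 𝒪.Impl)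
    (E : 𝒪.Transcript → Bits k → Prop) (L : List (QGate k)) (rest : List (QOp 𝒪 k))
    (tr : 𝒪.Transcript) (ψ : QState k) :
    runProb O E (L.map QOp.gate ++ rest) tr ψ = runProb O E rest tr (applyGates L ψ) := by
  induction L generalizing ψ with
  | nil => rfl
  | cons g L ih => exact ih _

theorem QGate.apply_add {k : ℕ} (g : QGate k) (ψ φ : QState k) :
    g.apply (ψ + φ) = g.apply ψ + g.apply φ := by
  cases g <;> funext z <;> simp only [QGate.apply, Pi.add_apply] <;> ring

theorem QGate.apply_zero {k : ℕ} (g : QGate k) : g.apply (0 : QState k) = 0 := by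
  cases g <;> funext z <;> simp [QGate.apply]

/-- The involution of basis states that negates wire `i`. -/
def flipBit {k : ℕ} (i : Fin k) (z : Bits k) : Bits k := Function.update z i (!z i)

theorem flipBit_involutive {k : ℕ} (i : Fin k) : Function.Involutive (flipBit i) := by
  intro z; simp [flipBit]

theorem update_eq_flipBit {k : ℕ} (i : Fin k) (z : Bits k) (b : Bool) :
    Function.update z i b = if z i = b then z else flipBit i z := by
  split_ifs with h
  · rw [← h, Function.update_eq_self]
  · have : b = !z i := by cases b <;> cases h' : z i <;> simp_all
    rw [this]; rfl

/-- The basis map of a CNOT gate. -/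
def cnotMap {k : ℕ} (c t : Fin k) (z : Bits k) : Bits k := Function.update z t (xor (z t) (z c))

theorem cnotMap_involutive {k : ℕ} {c t : Fin k} (h : c ≠ t) :
    Function.Involutive (cnotMap c t) := by
  intro z; simp [cnotMap, Function.update_of_ne h]

/-- The squared norm of a state vector. -/
noncomputable def normSq {k : ℕ} (ψ : QState k) : ℝ := ∑ z, ‖ψ z‖ ^ 2

theorem normSq_nonneg {k : ℕ} (ψ : QState k) : 0 ≤ normSq ψ :=
  Finset.sum_nonneg fun _ _ => by positivity

theorem normSq_comp {k : ℕ} {π : Bits k → Bits k} (hπ : Function.Involutive π) (ψ : QState k) :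
    normSq (fun z => ψ (π z)) = normSq ψ :=
  Equiv.sum_comp hπ.toPerm (fun z => ‖ψ z‖ ^ 2)

/-- The Hadamard gate preserves the norm of a pair of amplitudes. -/
theorem norm_parallelogram (a b : ℂ) :
    ‖((1 / Real.sqrt 2 : ℝ) : ℂ) * (a + b)‖ ^ 2 + ‖((1 / Real.sqrt 2 : ℝ) : ℂ) * (a + -1 * b)‖ ^ 2
      = ‖a‖ ^ 2 + ‖b‖ ^ 2 := by
  have h := parallelogram_law_with_norm ℝ a b
  have hs : ‖((1 / Real.sqrt 2 : ℝ) : ℂ)‖ ^ 2 = 1 / 2 := by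
    rw [Complex.norm_real, Real.norm_eq_abs, sq_abs, div_pow, Real.sq_sqrt] <;> norm_num
  rw [norm_mul, norm_mul, mul_pow, mul_pow, hs, neg_one_mul, ← sub_eq_add_neg]
  nlinarith

theorem QGate.normSq_apply {k : ℕ} (g : QGate k) (ψ : QState k) :
    normSq (g.apply ψ) = normSq ψ := by
  cases g with
  | hadamard i =>
    -- group the basis states into pairs that differ on wire `i` only
    have key : ∀ φ : QState k, 2 * normSq φ = ∑ z, (‖φ z‖ ^ 2 + ‖φ (flipBit i z)‖ ^ 2) := by
      intro φ
      rw [Finset.sum_add_distrib]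
      have := normSq_comp (flipBit_involutive i) φ
      unfold normSq at this ⊢
      linarith
    have : 2 * normSq ((QGate.hadamard i).apply ψ) = 2 * normSq ψ := by
      rw [key, key]
      refine Finset.sum_congr rfl fun z _ => ?_
      have h1 : (flipBit i z) i = !z i := by simp [flipBit]
      simp only [QGate.apply, update_eq_flipBit, h1, flipBit_involutive i z]
      cases hz : z i
      · simpa using norm_parallelogram (ψ z) (ψ (flipBit i z))
      · have := norm_parallelogram (ψ (flipBit i z)) (ψ z)
        simp at this ⊢
        linarith
    linarith
  | phase i =>
    refine Finset.sum_congr rfl fun z _ => ?_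
    simp only [QGate.apply, norm_mul]
    split_ifs <;> simp
  | piEighth i =>
    refine Finset.sum_congr rfl fun z _ => ?_
    simp only [QGate.apply, norm_mul]
    have : ‖Complex.exp (Complex.I * Real.pi / 4)‖ = 1 := by
      rw [show Complex.I * Real.pi / 4 = ((Real.pi / 4 : ℝ) : ℂ) * Complex.I by push_cast; ring]
      exact Complex.norm_exp_ofReal_mul_I _
    split_ifs <;> simp [this]
  | cnot c t h => exact normSq_comp (cnotMap_involutive h) ψ

/-! ### Queries -/

/-- The map `|x, y⟩ ↦ |x, y ⊕ g x⟩` on bit strings indexed by an arbitrary type of wires. -/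
noncomputable def xorFn {W α β : Type} (g : (α → Bool) → β → Bool) (w : α ⊕ β ↪ W) (z : W → Bool) :
    W → Bool :=
  open scoped Classical in
  fun j => xor (z j) (decide (∃ t, w (Sum.inr t) = j ∧ g (fun s => z (w (Sum.inl s))) t = true))

theorem xorQuery_eq_xorFn {k a b : ℕ} (f : Bits a → Bits b) (w : Fin a ⊕ Fin b ↪ Fin k) :
    xorQuery f w = xorFn f w := by
  funext z j; simp [xorQuery, xorFn]

section
variable {W α β : Type} (g : (α → Bool) → β → Bool) (w : α ⊕ β ↪ W)

theorem xorFn_inl (z : W → Bool) (s : α) : xorFn g w z (w (Sum.inl s)) = z (w (Sum.inl s)) := by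
  simp [xorFn]

theorem xorFn_inr (z : W → Bool) (t : β) :
    xorFn g w z (w (Sum.inr t)) = xor (z (w (Sum.inr t))) (g (fun s => z (w (Sum.inl s))) t) := by
  simp [xorFn]

theorem xorFn_of_ne (z : W → Bool) {j : W} (hj : ∀ t, w (Sum.inr t) ≠ j) :
    xorFn g w z j = z j := by
  simp [xorFn, hj]

theorem xorFn_involutive : Function.Involutive (xorFn g w) := by
  intro z
  funext j
  by_cases hj : ∃ t, w (Sum.inr t) = j
  · obtain ⟨t, rfl⟩ := hj
    simp [xorFn_inr, xorFn_inl]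
  · push Not at hj
    rw [xorFn_of_ne _ _ _ hj, xorFn_of_ne _ _ _ hj]

end

theorem xorQuery_involutive {k a b : ℕ} (f : Bits a → Bits b) (w : Fin a ⊕ Fin b ↪ Fin k) :
    Function.Involutive (xorQuery f w) := by
  rw [xorQuery_eq_xorFn]; exact xorFn_involutive f w

theorem xorQuery_inl {k a b : ℕ} (f : Bits a → Bits b) (w : Fin a ⊕ Fin b ↪ Fin k) (z : Bits k)
    (s : Fin a) : xorQuery f w z (w (Sum.inl s)) = z (w (Sum.inl s)) := by
  rw [xorQuery_eq_xorFn]; exact xorFn_inl f w z s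

theorem normSq_queryApply {k a b : ℕ} (f : Bits a → Bits b) (w : Fin a ⊕ Fin b ↪ Fin k)
    (ψ : QState k) : normSq (queryApply f w ψ) = normSq ψ :=
  normSq_comp (xorQuery_involutive f w) ψ

theorem sum_normSq_projectQuery {k a b : ℕ} (w : Fin a ⊕ Fin b ↪ Fin k) (ψ : QState k) :
    ∑ q, normSq (projectQuery w q ψ) = normSq ψ := by
  unfold normSq
  rw [Finset.sum_comm]
  refine Finset.sum_congr rfl fun z _ => ?_
  simp [projectQuery, apply_ite norm, ite_pow]

theorem queryApply_add {k a b : ℕ} (f : Bits a → Bits b) (w : Fin a ⊕ Fin b ↪ Fin k)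
    (ψ φ : QState k) : queryApply f w (ψ + φ) = queryApply f w ψ + queryApply f w φ := rfl

theorem projectQuery_add {k a b : ℕ} (w : Fin a ⊕ Fin b ↪ Fin k) (q : Bits a)
    (ψ φ : QState k) : projectQuery w q (ψ + φ) = projectQuery w q ψ + projectQuery w q φ := by
  funext z; simp only [projectQuery, Pi.add_apply]; split_ifs <;> simp

theorem projectQuery_zero {k a b : ℕ} (w : Fin a ⊕ Fin b ↪ Fin k) (q : Bits a) :
    projectQuery w q (0 : QState k) = 0 := by
  funext z; simp [projectQuery]

/-! ### Runs -/

section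
variable {𝒪 : OracleSpec} {k : ℕ} (O : 𝒪.Impl)

theorem runProb_nonneg (E : 𝒪.Transcript → Bits k → Prop) (ops : List (QOp 𝒪 k))
    (tr : 𝒪.Transcript) (ψ : QState k) : 0 ≤ runProb O E ops tr ψ := by
  induction ops generalizing tr ψ with
  | nil => exact Finset.sum_nonneg fun z _ => by split_ifs <;> positivity
  | cons op ops ih =>
    cases op with
    | gate g => exact ih _ _
    | query i w =>
      simp only [runProb]
      split_ifs
      · exact Finset.sum_nonneg fun q _ => ih _ _
      · exact ih _ _

theorem runProb_zero (E : 𝒪.Transcript → Bits k → Prop) (ops : List (QOp 𝒪 k))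
    (tr : 𝒪.Transcript) : runProb O E ops tr 0 = 0 := by
  induction ops generalizing tr with
  | nil => simp [runProb]
  | cons op ops ih =>
    cases op with
    | gate g => simp only [runProb, QGate.apply_zero, ih]
    | query i w =>
      have h0 : queryApply (O i) w (0 : QState k) = 0 := rfl
      simp only [runProb, projectQuery_zero, h0, ih]
      simp

/-- Branches are not normalized, so a run loses no more than the mass it starts with. -/
theorem runProb_le (E : 𝒪.Transcript → Bits k → Prop) (ops : List (QOp 𝒪 k))
    (tr : 𝒪.Transcript) (ψ : QState k) : runProb O E ops tr ψ ≤ normSq ψ := by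
  induction ops generalizing tr ψ with
  | nil => exact Finset.sum_le_sum fun z _ => by split_ifs <;> simp
  | cons op ops ih =>
    cases op with
    | gate g => exact (ih _ _).trans_eq (g.normSq_apply ψ)
    | query i w =>
      simp only [runProb]
      split_ifs
      · rw [← sum_normSq_projectQuery w ψ]
        exact Finset.sum_le_sum fun q _ => (ih _ _).trans_eq (normSq_queryApply _ _ _)
      · exact (ih _ _).trans_eq (normSq_queryApply _ _ _)

theorem norm_add_sq_le_weighted (a b : ℂ) {s : ℝ} (hs : 0 < s) :
    ‖a + b‖ ^ 2 ≤ (1 + s) * ‖a‖ ^ 2 + (1 + s⁻¹) * ‖b‖ ^ 2 := by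
  have h1 : ‖a + b‖ ^ 2 ≤ (‖a‖ + ‖b‖) ^ 2 := by gcongr; exact norm_add_le a b
  have h2 : 0 ≤ s⁻¹ * (s * ‖a‖ - ‖b‖) ^ 2 := by positivity
  have h3 : s⁻¹ * (s * ‖a‖ - ‖b‖) ^ 2 = s * ‖a‖ ^ 2 - 2 * ‖a‖ * ‖b‖ + s⁻¹ * ‖b‖ ^ 2 := by
    field_simp
    ring
  nlinarith

/-- The acceptance probability is a nonnegative quadratic form of the initial state; this is the
form of the triangle inequality for its square root that avoids square roots. -/
theorem runProb_add_le (E : 𝒪.Transcript → Bits k → Prop) (ops : List (QOp 𝒪 k))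
    (tr : 𝒪.Transcript) (ψ φ : QState k) {s : ℝ} (hs : 0 < s) :
    runProb O E ops tr (ψ + φ) ≤
      (1 + s) * runProb O E ops tr ψ + (1 + s⁻¹) * runProb O E ops tr φ := by
  induction ops generalizing tr ψ φ with
  | nil =>
    simp only [runProb, Finset.mul_sum, ← Finset.sum_add_distrib]
    refine Finset.sum_le_sum fun z _ => ?_
    split_ifs
    · exact norm_add_sq_le_weighted _ _ hs
    · simp
  | cons op ops ih =>
    cases op with
    | gate g => simp only [runProb, QGate.apply_add]; exact ih _ _ _
    | query i w =>
      simp only [runProb, projectQuery_add, queryApply_add]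
      split_ifs
      · simp only [Finset.mul_sum, ← Finset.sum_add_distrib]
        exact Finset.sum_le_sum fun q _ => ih _ _ _
      · exact ih _ _ _

/-- Additivity of the measure given by a run, over a finite family of events that
partitions the event `E`. -/
theorem runProb_sum {ι : Type} [Fintype ι] {E : 𝒪.Transcript → Bits k → Prop}
    {E' : ι → 𝒪.Transcript → Bits k → Prop} (h : ∀ tr z, E tr z → ∃! i, E' i tr z)
    (h' : ∀ i tr z, E' i tr z → E tr z)
    (ops : List (QOp 𝒪 k)) (tr : 𝒪.Transcript) (ψ : QState k) :
    runProb O E ops tr ψ = ∑ i, runProb O (E' i) ops tr ψ := by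
  classical
  induction ops generalizing tr ψ with
  | nil =>
    simp only [runProb]
    rw [Finset.sum_comm]
    refine Finset.sum_congr rfl fun z _ => ?_
    by_cases h1 : E tr z
    · obtain ⟨i, hi, hu⟩ := h _ _ h1
      rw [Finset.sum_eq_single i]
      · simp [h1, hi]
      · intro j _ hj
        rw [if_neg]; exact fun hE => hj (hu j hE)
      · simp
    · rw [if_neg h1, Finset.sum_eq_zero]
      intro i _
      rw [if_neg]; exact fun hE => h1 (h' i _ _ hE)
  | cons op ops ih =>
    cases op with
    | gate g => exact ih _ _
    | query i w =>
      simp only [runProb]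
      split_ifs
      · rw [Finset.sum_comm]
        exact Finset.sum_congr rfl fun q _ => ih _ _
      · exact ih _ _

theorem runProb_false (ops : List (QOp 𝒪 k)) (tr : 𝒪.Transcript) (ψ : QState k) :
    runProb O (fun _ _ => False) ops tr ψ = 0 := by
  rw [runProb_sum (ι := Empty) O (E' := fun i => i.elim) (fun _ _ h => h.elim) (fun i => i.elim)]
  simp

theorem runProb_or_le {E E₁ E₂ : 𝒪.Transcript → Bits k → Prop}
    (h : ∀ tr z, E tr z → E₁ tr z ∨ E₂ tr z)
    (ops : List (QOp 𝒪 k)) (tr : 𝒪.Transcript) (ψ : QState k) :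
    runProb O E ops tr ψ ≤ runProb O E₁ ops tr ψ + runProb O E₂ ops tr ψ := by
  classical
  induction ops generalizing tr ψ with
  | nil =>
    simp only [runProb, ← Finset.sum_add_distrib]
    refine Finset.sum_le_sum fun z _ => ?_
    have := h tr z
    have h0 : 0 ≤ ‖ψ z‖ ^ 2 := by positivity
    split_ifs <;> first | linarith | tauto
  | cons op ops ih =>
    cases op with
    | gate g => exact ih _ _
    | query i w =>
      simp only [runProb]
      split_ifs
      · rw [← Finset.sum_add_distrib]
        exact Finset.sum_le_sum fun q _ => ih _ _
      · exact ih _ _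

end

theorem QCircuit.normSq_init {𝒪 : OracleSpec} {a b : ℕ} (C : QCircuit 𝒪 a b) (x : Bits a) :
    normSq (C.init x) = 1 := by
  simp [normSq, QCircuit.init, apply_ite norm, ite_pow]

/-! ### Classical gates from Clifford and `π/8` gates -/

/-- The NOT gate, as `H Z H`. -/
def notGates {k : ℕ} (i : Fin k) : List (QGate k) :=
  [.hadamard i, .phase i, .phase i, .hadamard i]

theorem inv_sqrt_two_mul_self : ((1 / Real.sqrt 2 : ℝ) : ℂ) * ((1 / Real.sqrt 2 : ℝ) : ℂ) = 1 / 2 := by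
  rw [← Complex.ofReal_mul, div_mul_div_comm, Real.mul_self_sqrt (by norm_num)]; norm_num

theorem hadamard_apply_eq {k : ℕ} (i : Fin k) (ψ : QState k) (z : Bits k) :
    (QGate.hadamard i).apply ψ z = ((1 / Real.sqrt 2 : ℝ) : ℂ) *
      ((if z i then -1 else 1) * ψ z + ψ (flipBit i z)) := by
  simp only [QGate.apply, update_eq_flipBit]
  cases hz : z i <;> simp
  ring

theorem phase_apply_eq {k : ℕ} (i : Fin k) (ψ : QState k) (z : Bits k) :
    (QGate.phase i).apply ψ z = (if z i then Complex.I else 1) * ψ z := rfl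

theorem applyGates_notGates {k : ℕ} (i : Fin k) (ψ : QState k) :
    applyGates (notGates i) ψ = fun z => ψ (flipBit i z) := by
  funext z
  have h1 : (flipBit i z) i = !z i := by simp [flipBit]
  have h := inv_sqrt_two_mul_self
  simp only [notGates, applyGates, hadamard_apply_eq, phase_apply_eq, h1, flipBit_involutive i z]
  set c := ((1 / Real.sqrt 2 : ℝ) : ℂ)
  have hI := Complex.I_mul_I
  cases hz : z i
  · simp
    linear_combination 2 * ψ (flipBit i z) * h + (c*c) * (ψ z - ψ (flipBit i z)) * hI
  · simp
    linear_combination 2 * ψ (flipBit i z) * h + (c*c) * (-ψ (flipBit i z) + ψ z) * hI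

/-- The gate list `L` multiplies each basis state by a factor. -/
def IsDiag {k : ℕ} (L : List (QGate k)) (d : Bits k → ℂ) : Prop :=
  ∀ ψ z, applyGates L ψ z = d z * ψ z

theorem IsDiag.append {k : ℕ} {L₁ L₂ : List (QGate k)} {d₁ d₂ : Bits k → ℂ}
    (h₁ : IsDiag L₁ d₁) (h₂ : IsDiag L₂ d₂) : IsDiag (L₁ ++ L₂) (fun z => d₁ z * d₂ z) := by
  intro ψ z
  rw [applyGates_append, h₂, h₁]; ring

theorem IsDiag.conj_cnot {k : ℕ} {L : List (QGate k)} {d : Bits k → ℂ} (hL : IsDiag L d)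
    {c t : Fin k} (h : c ≠ t) :
    IsDiag ([QGate.cnot c t h] ++ L ++ [QGate.cnot c t h]) (fun z => d (cnotMap c t z)) := by
  intro ψ z
  rw [applyGates_append, applyGates_append]
  change applyGates L _ (cnotMap c t z) = _
  rw [hL]
  change _ * ψ (cnotMap c t (cnotMap c t z)) = _
  rw [cnotMap_involutive h]

/-- The primitive eighth root of unity in the `π/8` gate. -/
noncomputable def omega8 : ℂ := Complex.exp (Complex.I * Real.pi / 4)

theorem omega8_pow_four : omega8 ^ 4 = -1 := by
  rw [omega8, ← Complex.exp_nat_mul, ← Complex.exp_pi_mul_I]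
  congr 1; push_cast; ring

theorem isDiag_piEighth {k : ℕ} (i : Fin k) :
    IsDiag [QGate.piEighth i] (fun z => if z i then omega8 else 1) := fun _ _ => rfl

/-- The inverse of the `π/8` gate, as its seventh power. -/
def piEighthInv {k : ℕ} (i : Fin k) : List (QGate k) := List.replicate 7 (.piEighth i)

theorem isDiag_piEighthInv {k : ℕ} (i : Fin k) :
    IsDiag (piEighthInv i) (fun z => if z i then omega8 ^ 7 else 1) := by
  intro ψ z
  simp only [piEighthInv, List.replicate, applyGates, QGate.apply, omega8]
  split_ifs <;> ring

/-- The doubly controlled phase flip, by its phase polynomial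
`4xyz = x + y + z - (x ⊕ y) - (x ⊕ z) - (y ⊕ z) + (x ⊕ y ⊕ z)`. -/
def cczGates {k : ℕ} {x y t : Fin k} (hxy : x ≠ y) (hxt : x ≠ t) (hyt : y ≠ t) : List (QGate k) :=
  [.piEighth x] ++ [.piEighth y] ++ [.piEighth t]
    ++ ([.cnot x y hxy] ++ piEighthInv y ++ [.cnot x y hxy])
    ++ ([.cnot x t hxt] ++ piEighthInv t ++ [.cnot x t hxt])
    ++ ([.cnot y t hyt] ++ piEighthInv t ++ [.cnot y t hyt])
    ++ ([.cnot x t hxt] ++ ([.cnot y t hyt] ++ [.piEighth t] ++ [.cnot y t hyt])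
      ++ [.cnot x t hxt])

theorem isDiag_cczGates {k : ℕ} {x y t : Fin k} (hxy : x ≠ y) (hxt : x ≠ t) (hyt : y ≠ t) :
    IsDiag (cczGates hxy hxt hyt) (fun z => if z x && z y && z t then -1 else 1) := by
  have h := (((((((isDiag_piEighth x).append (isDiag_piEighth y)).append
    (isDiag_piEighth t)).append ((isDiag_piEighthInv y).conj_cnot hxy)).append
    ((isDiag_piEighthInv t).conj_cnot hxt)).append ((isDiag_piEighthInv t).conj_cnot hyt)).append
    (((isDiag_piEighth t).conj_cnot hyt).conj_cnot hxt))
  intro ψ z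
  refine (h ψ z).trans ?_
  congr 1
  have h4 := omega8_pow_four
  simp only [cnotMap, Function.update_self, Function.update_of_ne hyt]
  have h16 : omega8 ^ 16 = 1 := by
    rw [show omega8 ^ 16 = (omega8 ^ 4) ^ 4 by ring, h4]; norm_num
  cases z x <;> cases z y <;> cases z t <;> simp <;> ring_nf <;> simp [h4, h16]

/-- The Toffoli gate: the doubly controlled phase flip, conjugated by Hadamard gates on the
target. -/
def toffoliGates {k : ℕ} {x y t : Fin k} (hxy : x ≠ y) (hxt : x ≠ t) (hyt : y ≠ t) :
    List (QGate k) :=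
  [.hadamard t] ++ cczGates hxy hxt hyt ++ [.hadamard t]

theorem applyGates_toffoliGates {k : ℕ} {x y t : Fin k} (hxy : x ≠ y) (hxt : x ≠ t) (hyt : y ≠ t)
    (ψ : QState k) :
    applyGates (toffoliGates hxy hxt hyt) ψ =
      fun z => if z x && z y then ψ (flipBit t z) else ψ z := by
  funext z
  have h1 : (flipBit t z) t = !z t := by simp [flipBit]
  have hx : (flipBit t z) x = z x := by simp [flipBit, hxt]
  have hy : (flipBit t z) y = z y := by simp [flipBit, hyt]
  have h := inv_sqrt_two_mul_self
  rw [toffoliGates, applyGates_append, applyGates_append]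
  simp only [applyGates, hadamard_apply_eq]
  rw [isDiag_cczGates, isDiag_cczGates]
  simp only [hadamard_apply_eq, h1, hx, hy, flipBit_involutive t z]
  set c := ((1 / Real.sqrt 2 : ℝ) : ℂ)
  cases z x <;> cases z y <;> cases z t <;> simp
  all_goals first
    | linear_combination 2 * ψ (flipBit t z) * h
    | linear_combination 2 * ψ z * h

theorem length_toffoliGates {k : ℕ} {x y t : Fin k} (hxy : x ≠ y) (hxt : x ≠ t) (hyt : y ≠ t) :
    (toffoliGates hxy hxt hyt).length = 37 := by
  simp [toffoliGates, cczGates, piEighthInv]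

/-! ### Circuit complexity of Boolean functions -/

/-- The Boolean function `f` can be read off for free once the functions in `L` are computed: it is
one of them, an input bit, or constantly false. -/
def Avail {α : Type} (L : List ((α → Bool) → Bool)) (f : (α → Bool) → Bool) : Prop :=
  f ∈ L ∨ (∃ a, f = fun x => x a) ∨ f = fun _ => false

/-- `L` lists the functions computed by the successive gates of a NAND circuit. -/
inductive Derives {α : Type} : List ((α → Bool) → Bool) → Prop
  | nil : Derives []
  | nand {L : List ((α → Bool) → Bool)} {f g : (α → Bool) → Bool} (hL : Derives L)
      (hf : Avail L f) (hg : Avail L g) : Derives (L ++ [fun x => !(f x && g x)])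

/-- `F` is computed by a NAND circuit with at most `s` gates. Inputs and outputs are indexed by
arbitrary types, so that rearranging wires costs nothing. -/
def Comp {α β : Type} (s : ℕ) (F : (α → Bool) → β → Bool) : Prop :=
  ∃ L : List ((α → Bool) → Bool), Derives L ∧ L.length ≤ s ∧ ∀ b, Avail L (fun x => F x b)

section
variable {α β γ : Type}

theorem Avail.mono {L L' : List ((α → Bool) → Bool)} {f : (α → Bool) → Bool} (h : Avail L f)
    (hL : L ⊆ L') : Avail L' f := by
  rcases h with h | h | h
  · exact .inl (hL h)
  · exact .inr (.inl h)
  · exact .inr (.inr h)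

theorem Avail.congr_fun {L : List ((α → Bool) → Bool)} {f g : (α → Bool) → Bool} (h : Avail L f)
    (e : ∀ x, g x = f x) : Avail L g := by
  rwa [show g = f from funext e]

theorem Avail.subst {L : List ((β → Bool) → Bool)} {L₁ : List ((α → Bool) → Bool)}
    {F : (α → Bool) → β → Bool} (hF : ∀ b, Avail L₁ (fun x => F x b)) {f : (β → Bool) → Bool}
    (h : Avail L f) : Avail (L₁ ++ L.map (fun f x => f (F x))) (fun x => f (F x)) := by
  rcases h with h | ⟨b, rfl⟩ | rfl
  · exact .inl (List.mem_append_right _ (List.mem_map_of_mem h))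
  · exact (hF b).mono (List.subset_append_left _ _)
  · exact .inr (.inr rfl)

theorem Derives.subst {L : List ((β → Bool) → Bool)} {L₁ : List ((α → Bool) → Bool)}
    {F : (α → Bool) → β → Bool} (hF : ∀ b, Avail L₁ (fun x => F x b)) (h₁ : Derives L₁)
    (h : Derives L) : Derives (L₁ ++ L.map (fun f x => f (F x))) := by
  induction h with
  | nil => simpa using h₁
  | nand hL hf hg ih =>
    rw [List.map_append, ← List.append_assoc]
    exact ih.nand (hf.subst hF) (hg.subst hF)

theorem Derives.append {L₁ L₂ : List ((α → Bool) → Bool)} (h₁ : Derives L₁) (h₂ : Derives L₂) :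
    Derives (L₁ ++ L₂) := by
  simpa using Derives.subst (F := fun x => x) (fun b => .inr (.inl ⟨b, rfl⟩)) h₁ h₂

theorem Comp.mono {s t : ℕ} {F : (α → Bool) → β → Bool} (h : Comp s F) (hst : s ≤ t) :
    Comp t F := by
  obtain ⟨L, h1, h2, h3⟩ := h
  exact ⟨L, h1, h2.trans hst, h3⟩

theorem Comp.comp {s t : ℕ} {G : (β → Bool) → γ → Bool} {F : (α → Bool) → β → Bool}
    (hG : Comp t G) (hF : Comp s F) : Comp (s + t) (fun x => G (F x)) := by
  obtain ⟨L₁, h1, h2, h3⟩ := hF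
  obtain ⟨L, k1, k2, k3⟩ := hG
  exact ⟨_, Derives.subst h3 h1 k1, by simp; omega, fun c => (k3 c).subst h3⟩

theorem Comp.wires (σ : β → α) : Comp 0 (fun (x : α → Bool) b => x (σ b)) :=
  ⟨[], .nil, le_rfl, fun b => .inr (.inl ⟨σ b, rfl⟩)⟩

theorem Comp.reindex {s : ℕ} {F : (α → Bool) → β → Bool} (h : Comp s F) (σ : γ → β) :
    Comp s (fun x c => F x (σ c)) :=
  ((Comp.wires σ).comp h).mono (by omega)

theorem Comp.elim {δ : Type} {s t : ℕ} {F : (α → Bool) → β → Bool} {G : (α → Bool) → δ → Bool}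
    (hF : Comp s F) (hG : Comp t G) : Comp (s + t) (fun x => Sum.elim (F x) (G x)) := by
  obtain ⟨L₁, h1, h2, h3⟩ := hF
  obtain ⟨L, k1, k2, k3⟩ := hG
  refine ⟨L₁ ++ L, h1.append k1, by simp; omega, ?_⟩
  rintro (b | b)
  · exact (h3 b).mono (List.subset_append_left _ _)
  · exact (k3 b).mono (List.subset_append_right _ _)

/-- Several functions of the same input are computed one after the other. -/
theorem Comp.pi {ι : Type} [Fintype ι] {s : ι → ℕ} {F : ι → (α → Bool) → β → Bool}
    (h : ∀ i, Comp (s i) (F i)) : Comp (∑ i, s i) (fun x (p : ι × β) => F p.1 x p.2) := by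
  classical
  choose L h1 h2 h3 using h
  have key : ∀ l : List ι, ∃ L' : List ((α → Bool) → Bool), Derives L' ∧
      L'.length ≤ (l.map s).sum ∧ ∀ i ∈ l, L i ⊆ L' := by
    intro l
    induction l with
    | nil => exact ⟨[], .nil, by simp, by simp⟩
    | cons i l ih =>
      obtain ⟨L', k1, k2, k3⟩ := ih
      refine ⟨L i ++ L', (h1 i).append k1, ?_, ?_⟩
      · have := h2 i
        simp; omega
      · intro j hj
        rcases List.mem_cons.1 hj with rfl | hj
        · exact List.subset_append_left _ _
        · exact List.Subset.trans (k3 j hj) (List.subset_append_right _ _)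
  obtain ⟨L', k1, k2, k3⟩ := key Finset.univ.toList
  refine ⟨L', k1, ?_, fun p => (h3 p.1 p.2).mono (k3 p.1 (by simp))⟩
  simpa [Finset.sum_map_toList] using k2

theorem Comp.congr {s : ℕ} {F G : (α → Bool) → β → Bool} (h : Comp s F)
    (e : ∀ x b, F x b = G x b) : Comp s G := by
  have : F = G := by funext x b; exact e x b
  exact this ▸ h

theorem Comp.nand {s t : ℕ} {f g : (α → Bool) → Bool} (hf : Comp s (fun x (_ : Unit) => f x))
    (hg : Comp t (fun x (_ : Unit) => g x)) :
    Comp (s + t + 1) (fun x (_ : Unit) => !(f x && g x)) := by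
  obtain ⟨L₁, h1, h2, h3⟩ := hf
  obtain ⟨L₂, k1, k2, k3⟩ := hg
  refine ⟨_, (h1.append k1).nand ((h3 ()).mono (List.subset_append_left _ _))
    ((k3 ()).mono (List.subset_append_right _ _)), by simp; omega, ?_⟩
  intro b
  exact .inl (by simp)

theorem Comp.constFalse : Comp 0 (fun (_ : α → Bool) (_ : β) => false) :=
  ⟨[], .nil, le_rfl, fun _ => .inr (.inr rfl)⟩

theorem Comp.const (c : β → Bool) : Comp 1 (fun (_ : α → Bool) => c) := by
  have h : Comp 1 (fun (_ : α → Bool) (_ : Unit) => true) := by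
    simpa using (Comp.constFalse (α := α) (β := Unit)).nand Comp.constFalse
  have h2 := (h.elim (Comp.constFalse (α := α) (β := Unit))).reindex
    (fun b => if c b then Sum.inl () else Sum.inr ())
  convert h2 using 3 with x b
  cases c b <;> simp

/-- Post-composition with an operation on two bits. -/
theorem Comp.op₂ {u : ℕ} {h : Bool → Bool → Bool}
    (hh : Comp u (fun (x : Bool → Bool) (_ : Unit) => h (x true) (x false)))
    {s t : ℕ} {f g : (α → Bool) → Bool} (hf : Comp s (fun x (_ : Unit) => f x))
    (hg : Comp t (fun x (_ : Unit) => g x)) :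
    Comp (s + t + u) (fun x (_ : Unit) => h (f x) (g x)) := by
  have := hh.comp ((hf.elim hg).reindex (fun b => if b then Sum.inl () else Sum.inr ()))
  simpa using this

theorem Comp.bit (a : α) : Comp 0 (fun (x : α → Bool) (_ : Unit) => x a) := Comp.wires _

theorem Comp.and {s t : ℕ} {f g : (α → Bool) → Bool} (hf : Comp s (fun x (_ : Unit) => f x))
    (hg : Comp t (fun x (_ : Unit) => g x)) :
    Comp (s + t + 5) (fun x (_ : Unit) => f x && g x) := by
  refine Comp.op₂ (h := fun a b => a && b) ?_ hf hg
  have h : Comp 1 _ := (Comp.bit true).nand (Comp.bit false)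
  exact ((h.nand h).mono (by omega : _ ≤ 5)).congr (by simp)

theorem Comp.xor {s t : ℕ} {f g : (α → Bool) → Bool} (hf : Comp s (fun x (_ : Unit) => f x))
    (hg : Comp t (fun x (_ : Unit) => g x)) :
    Comp (s + t + 5) (fun x (_ : Unit) => Bool.xor (f x) (g x)) := by
  refine Comp.op₂ (h := fun a b => Bool.xor a b) ?_ hf hg
  have h : Comp 1 _ := (Comp.bit true).nand (Comp.bit false)
  refine ((((Comp.bit true).nand h).nand ((Comp.bit false).nand h)).mono
    (by omega : _ ≤ 5)).congr ?_
  intro x _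
  cases x true <;> cases x false <;> rfl

theorem Comp.not {s : ℕ} {f : (α → Bool) → Bool} (hf : Comp s (fun x (_ : Unit) => f x)) :
    Comp (s + 6) (fun x (_ : Unit) => !f x) := by
  refine ((hf.xor (Comp.const fun _ => true)).mono (by omega : _ ≤ s + 6)).congr (by simp)

/-- A conjunction of bits, as a chain of AND gates. -/
theorem Comp.forall {ι : Type} [Fintype ι] {s : ι → ℕ} {f : ι → (α → Bool) → Bool}
    (h : ∀ i, Comp (s i) (fun x (_ : Unit) => f i x)) :
    Comp (∑ i, (s i + 5) + 1) (fun x (_ : Unit) => decide (∀ i, f i x = true)) := by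
  classical
  suffices H : ∀ S : Finset ι, Comp (∑ i ∈ S, (s i + 5) + 1)
      (fun x (_ : Unit) => decide (∀ i ∈ S, f i x = true)) by
    simpa using H Finset.univ
  intro S
  induction S using Finset.induction_on with
  | empty => simpa using Comp.const (α := α) (fun _ : Unit => true)
  | insert i S hi ih =>
    rw [Finset.sum_insert hi]
    refine (((h i).and ih).mono (by omega)).congr fun x _ => ?_
    simp [Bool.decide_and]

theorem Comp.eq {ι : Type} [Fintype ι] {s t : ℕ} {F G : (α → Bool) → ι → Bool}
    (hF : Comp s F) (hG : Comp t G) :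
    Comp (s + t + (16 * Fintype.card ι + 1)) (fun x (_ : Unit) => decide (F x = G x)) := by
  have h : Comp (16 * Fintype.card ι + 1) (fun (y : ι ⊕ ι → Bool) (_ : Unit) =>
      decide (∀ i, (!Bool.xor (y (.inl i)) (y (.inr i))) = true)) := by
    refine (Comp.forall fun i =>
      ((Comp.bit (Sum.inl i : ι ⊕ ι)).xor (Comp.bit (Sum.inr i))).not).mono ?_
    simp [mul_comm]
  refine (h.comp (hF.elim hG)).congr fun x _ => ?_
  simp [funext_iff]

/-- A bit as an element of `ℤ/2`. -/
def toZ2 (b : Bool) : ZMod 2 := if b then 1 else 0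

/-- The bit that represents an element of `ℤ/2`. -/
def ofZ2 (z : ZMod 2) : Bool := decide (z = 1)

theorem ofZ2_toZ2 (b : Bool) : ofZ2 (toZ2 b) = b := by cases b <;> decide

theorem toZ2_ofZ2 (z : ZMod 2) : toZ2 (ofZ2 z) = z := by revert z; decide

theorem toZ2_and (a b : Bool) : toZ2 (a && b) = toZ2 a * toZ2 b := by cases a <;> cases b <;> decide

theorem ofZ2_toZ2_add (a : Bool) (z : ZMod 2) : ofZ2 (toZ2 a + z) = Bool.xor a (ofZ2 z) := by
  revert z; cases a <;> decide

/-- The parity of several bits. -/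
theorem Comp.sumZ2 {ι : Type} [Fintype ι] {s : ι → ℕ} {f : ι → (α → Bool) → Bool}
    (h : ∀ i, Comp (s i) (fun x (_ : Unit) => f i x)) :
    Comp (∑ i, (s i + 5)) (fun x (_ : Unit) => ofZ2 (∑ i, toZ2 (f i x))) := by
  classical
  suffices H : ∀ S : Finset ι, Comp (∑ i ∈ S, (s i + 5))
      (fun x (_ : Unit) => ofZ2 (∑ i ∈ S, toZ2 (f i x))) from H Finset.univ
  intro S
  induction S using Finset.induction_on with
  | empty => exact Comp.constFalse.congr fun _ _ => by simp [ofZ2]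
  | insert i S hi ih =>
    rw [Finset.sum_insert hi]
    refine (((h i).xor ih).mono (by omega)).congr fun x _ => ?_
    rw [Finset.sum_insert hi, ofZ2_toZ2_add]

end

/-- The gates of a Boolean circuit are processed in order; a wire that does not exist yet reads as
`false`, which is available for free. -/
theorem BoolCircuit.comp_eval {a b : ℕ} (C : BoolCircuit a b) : Comp C.gates.length C.eval := by
  have key : ∀ (gs : List (ℕ × ℕ)) (ws : Bits a → List Bool) (L : List (Bits a → Bool)),
      Derives L → (∀ i, Avail L (fun x => (ws x).getD i false)) →
      (∀ x y, (ws x).length = (ws y).length) →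
      ∃ L', Derives L' ∧ L'.length ≤ L.length + gs.length ∧ ∀ i, Avail L' (fun x =>
        (gs.foldl (fun w g => w ++ [!(w.getD g.1 false && w.getD g.2 false)]) (ws x)).getD i
          false) := by
    intro gs
    induction gs with
    | nil => exact fun ws L h1 h2 _ => ⟨L, h1, by simp, h2⟩
    | cons g gs ih =>
      intro ws L h1 h2 h3
      have h2' : ∀ i, Avail (L ++ [fun x => !((ws x).getD g.1 false && (ws x).getD g.2 false)])
          (fun x => (ws x ++ [!((ws x).getD g.1 false && (ws x).getD g.2 false)]).getD i
            false) := by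
        intro i
        have x₀ : Bits a := fun _ => false
        rcases lt_trichotomy i (ws x₀).length with hi | hi | hi
        · refine ((h2 i).mono (List.subset_append_left _ _)).congr_fun ?_
          intro x
          rw [List.getD_append _ _ _ _ (by rw [h3 x x₀]; exact hi)]
        · refine .inl (List.mem_append_right _ ?_)
          rw [List.mem_singleton]
          funext x
          rw [List.getD_append_right _ _ _ _ (by rw [h3 x x₀]; omega), h3 x x₀, hi]
          simp
        · refine .inr (.inr ?_)
          funext x
          rw [List.getD_eq_default]
          rw [List.length_append, h3 x x₀]; simpa using hi
      obtain ⟨L', k1, k2, k3⟩ := ih _ _ (h1.nand (h2 g.1) (h2 g.2)) h2'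
        (fun x y => by simp [h3 x y])
      exact ⟨L', k1, by simp at k2 ⊢; omega, k3⟩
  have h0 : ∀ i, Avail [] (fun x : Bits a => (List.ofFn x).getD i false) := by
    intro i
    by_cases hi : i < a
    · refine .inr (.inl ⟨⟨i, hi⟩, ?_⟩)
      funext x
      simp [List.getD_eq_getElem?_getD, hi]
    · refine .inr (.inr ?_)
      funext x
      rw [List.getD_eq_default]; simpa using hi
  obtain ⟨L', k1, k2, k3⟩ := key C.gates (fun x => List.ofFn x) [] .nil h0 (by simp)
  exact ⟨L', k1, by simpa using k2, fun j => k3 _⟩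

/-! ### Classical circuits as quantum circuits -/

/-- The value on wire `p`, where the absent wire carries `false`. -/
def wireVal {W : Type} (p : Option W) (z : W → Bool) : Bool := p.elim false z

/-- The NAND of two wires is added to a third one, by NOT and Toffoli gates. The two wires may
coincide or be absent. -/
theorem exists_nandGates {W : ℕ} (p q : Option (Fin W)) (T : Fin W) (hp : p ≠ some T)
    (hq : q ≠ some T) : ∃ G : List (QGate W), G.length ≤ 41 ∧ ∀ ψ, applyGates G ψ =
      fun z => ψ (Function.update z T (Bool.xor (z T) (!(wireVal p z && wireVal q z)))) := by
  have hflip : ∀ {G : List (QGate W)} {b : Bits W → Bool} (hb : ∀ z, b (flipBit T z) = b z),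
      (∀ ψ, applyGates G ψ = fun z => ψ (Function.update z T (Bool.xor (z T) (b z)))) →
      ∀ ψ, applyGates (notGates T ++ G) ψ =
        fun z => ψ (Function.update z T (Bool.xor (z T) (!b z))) := by
    intro G b hb hG ψ
    rw [applyGates_append, applyGates_notGates, hG]
    funext z
    simp [flipBit]
  have hlen : (notGates T).length = 4 := rfl
  have hconst : ∃ G : List (QGate W), G.length ≤ 41 ∧ ∀ ψ, applyGates G ψ =
      fun z => ψ (Function.update z T (Bool.xor (z T) (!false))) :=
    ⟨notGates T ++ [], by simp [hlen], hflip (b := fun _ => false) (fun _ => rfl)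
      (fun ψ => by simp [applyGates])⟩
  cases p with
  | none => simpa [wireVal] using hconst
  | some x =>
    cases q with
    | none => simpa [wireVal] using hconst
    | some y =>
      have hx : x ≠ T := fun h => hp (by rw [h])
      have hy : y ≠ T := fun h => hq (by rw [h])
      have hb : ∀ z, ((flipBit T z) x && (flipBit T z) y) = (z x && z y) := by
        intro z; simp [flipBit, hx, hy]
      by_cases hxy : x = y
      · subst hxy
        refine ⟨notGates T ++ [.cnot x T hx], by simp [hlen], ?_⟩
        refine hflip (b := fun z => z x && z x) hb fun ψ => ?_
        funext z
        simp [applyGates, QGate.apply]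
      · refine ⟨notGates T ++ toffoliGates hxy hx hy, by simp [hlen, length_toffoliGates], ?_⟩
        refine hflip (b := fun z => z x && z y) hb fun ψ => ?_
        rw [applyGates_toffoliGates]
        funext z
        cases z x <;> cases z y <;> simp [flipBit]

section
variable {α β : Type} {s W : ℕ}

theorem Avail.exists_wire {L : List ((α → Bool) → Bool)} {f : (α → Bool) → Bool}
    (h : Avail L f) (hL : L.length ≤ s) (w : α ⊕ β ↪ Fin W) (sc : Fin s ↪ Fin W) :
    ∃ p : Option (Fin W), (∀ j ∈ p, (∃ a, j = w (.inl a)) ∨ ∃ i, i.1 < L.length ∧ j = sc i) ∧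
      ∀ (z : Bits W) (x : α → Bool), (∀ a, z (w (.inl a)) = x a) →
        (∀ i, z (sc i) = (L.map fun f => f x).getD i false) → wireVal p z = f x := by
  rcases h with h | ⟨a, rfl⟩ | rfl
  · obtain ⟨i, hi, rfl⟩ := List.getElem_of_mem h
    refine ⟨some (sc ⟨i, hi.trans_le hL⟩), ?_, ?_⟩
    · intro j hj
      cases hj
      exact .inr ⟨⟨i, hi.trans_le hL⟩, hi, rfl⟩
    · intro z x _ h2
      simp [wireVal, h2, List.getD_eq_getElem?_getD, hi]
  · refine ⟨some (w (.inl a)), ?_, fun z x h1 _ => h1 a⟩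
    intro j hj
    cases hj
    exact .inl ⟨a, rfl⟩
  · exact ⟨none, by simp, fun _ _ _ _ => rfl⟩

/-- A NAND circuit can be evaluated reversibly onto the scratch wires `sc`. The basis map `U` of the
evaluation has the inverse `V`; both change the scratch wires only, and do not look at wires other
than the inputs and the scratch. -/
theorem exists_computeGates {L : List ((α → Bool) → Bool)} (hL : Derives L) (hs : L.length ≤ s)
    (w : α ⊕ β ↪ Fin W) (sc : Fin s ↪ Fin W) (hdisj : ∀ i x, sc i ≠ w x) :
    ∃ (A B : List (QGate W)) (V U : Bits W → Bits W),
      A.length ≤ 41 * L.length ∧ B.length ≤ 41 * L.length ∧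
      (∀ ψ, applyGates A ψ = fun z => ψ (V z)) ∧ (∀ ψ, applyGates B ψ = fun z => ψ (U z)) ∧
      (∀ z, V (U z) = z) ∧
      (∀ z j, (∀ i, sc i ≠ j) → U z j = z j ∧ V z j = z j) ∧
      (∀ z z' : Bits W, (∀ i, z (sc i) = z' (sc i)) → (∀ a, z (w (.inl a)) = z' (w (.inl a))) →
        ∀ i, V z (sc i) = V z' (sc i)) ∧
      ∀ z, (∀ i, z (sc i) = false) → ∀ i,
        U z (sc i) = (L.map fun f => f (fun a => z (w (.inl a)))).getD i false := by
  induction hL with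
  | nil =>
    exact ⟨[], [], id, id, by simp, by simp, fun _ => rfl, fun _ => rfl, fun _ => rfl,
      fun _ _ _ => ⟨rfl, rfl⟩, fun z z' h _ i => h i, fun z h i => by simpa using h i⟩
  | @nand L f g hL hf hg ih =>
    have hlt : L.length < s := by simpa using hs
    obtain ⟨A, B, V, U, hA, hB, hV, hU, hVU, hoff, hloc, hval⟩ := ih hlt.le
    obtain ⟨p, hp, hpv⟩ := hf.exists_wire hlt.le w sc
    obtain ⟨q, hq, hqv⟩ := hg.exists_wire hlt.le w sc
    set T : Fin W := sc ⟨L.length, hlt⟩ with hT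
    have hne : ∀ {p : Option (Fin W)}, (∀ j ∈ p, (∃ a, j = w (.inl a)) ∨
        ∃ i : Fin s, i.1 < L.length ∧ j = sc i) → p ≠ some T := by
      rintro p hp rfl
      rcases hp T rfl with ⟨a, ha⟩ | ⟨i, hi, h⟩
      · exact hdisj _ _ ha
      · have := sc.injective h
        rw [← this] at hi
        exact lt_irrefl _ hi
    obtain ⟨G, hG, hGa⟩ := exists_nandGates p q T (hne hp) (hne hq)
    set π : Bits W → Bits W := fun z =>
      Function.update z T (Bool.xor (z T) (!(wireVal p z && wireVal q z))) with hπ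
    have hwv : ∀ {p : Option (Fin W)}, p ≠ some T → ∀ z b,
        wireVal p (Function.update z T b) = wireVal p z := by
      intro p hp z b
      cases p with
      | none => rfl
      | some j => exact Function.update_of_ne (fun h => hp (by rw [h])) _ _
    have hπinv : ∀ z, π (π z) = z := by
      intro z
      simp [hπ, hwv (hne hp), hwv (hne hq)]
    have hπoff : ∀ z j, j ≠ T → π z j = z j := fun z j hj => Function.update_of_ne hj _ _
    refine ⟨A ++ G, G ++ B, fun z => V (π z), fun z => π (U z), ?_, ?_, ?_, ?_, ?_, ?_, ?_, ?_⟩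
    · simp; omega
    · simp; omega
    · intro ψ; rw [applyGates_append, hV, hGa]
    · intro ψ; rw [applyGates_append, hGa, hU]
    · intro z; simp only [hπinv, hVU]
    · intro z j hj
      have : j ≠ T := fun h => hj _ h.symm
      simp only [hπoff _ _ this, hoff _ _ hj, and_self]
    · intro z z' h1 h2
      have hag : ∀ {p : Option (Fin W)}, (∀ j ∈ p, (∃ a, j = w (.inl a)) ∨
          ∃ i : Fin s, i.1 < L.length ∧ j = sc i) → wireVal p z = wireVal p z' := by
        intro p hp
        cases p with
        | none => rfl
        | some j =>
          rcases hp j rfl with ⟨a, rfl⟩ | ⟨i, -, rfl⟩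
          · exact h2 a
          · exact h1 i
      refine hloc _ _ (fun i => ?_) (fun a => ?_)
      · by_cases hi : sc i = T
        · simp only [hπ, hi, Function.update_self]
          rw [hag hp, hag hq, hT, h1]
        · simp only [hπoff _ _ hi, h1]
      · have : w (.inl a) ≠ T := fun h => hdisj _ _ h.symm
        simp only [hπoff _ _ this, h2]
    · intro z hz i
      have hin : ∀ a, U z (w (.inl a)) = z (w (.inl a)) :=
        fun a => (hoff z _ fun i => hdisj _ _).1
      by_cases hi : i.1 = L.length
      · have hi' : sc i = T := by rw [hT]; congr 1; exact Fin.ext hi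
        simp only [hπ, hi', Function.update_self]
        rw [hpv (U z) _ hin (hval z hz), hqv (U z) _ hin (hval z hz), hT, hval z hz]
        simp [List.getD_eq_getElem?_getD, hi]
      · have hi' : sc i ≠ T := fun h => hi (by rw [sc.injective h])
        simp only [hπoff _ _ hi', hval z hz, List.map_append]
        rcases lt_or_gt_of_ne hi with hi | hi
        · rw [List.getD_append]; simpa using hi
        · rw [List.getD_eq_default, List.getD_eq_default] <;> simp <;> omega

/-- Copying the wires `p b` onto the output wires. -/
theorem exists_copyGates (w : α ⊕ β ↪ Fin W) (p : β → Option (Fin W))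
    (hp : ∀ b b', p b ≠ some (w (.inr b'))) (l : List β) (hl : l.Nodup) :
    ∃ (G : List (QGate W)) (C : Bits W → Bits W), G.length ≤ l.length ∧
      (∀ ψ, applyGates G ψ = fun z => ψ (C z)) ∧
      (∀ z b, b ∈ l → C z (w (.inr b)) = Bool.xor (z (w (.inr b))) (wireVal (p b) z)) ∧
      (∀ z j, (∀ b ∈ l, w (.inr b) ≠ j) → C z j = z j) := by
  induction l with
  | nil => exact ⟨[], id, by simp, fun _ => rfl, by simp, fun _ _ _ => rfl⟩
  | cons b l ih =>
    rw [List.nodup_cons] at hl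
    obtain ⟨G, C, h1, h2, h3, h4⟩ := ih hl.2
    have hCp : ∀ z b', wireVal (p b') (C z) = wireVal (p b') z := by
      intro z b'
      cases hb : p b' with
      | none => rfl
      | some j => exact h4 z j fun b'' _ h => hp b' b'' (by rw [hb, h])
    have hCb : ∀ z, C z (w (.inr b)) = z (w (.inr b)) :=
      fun z => h4 z _ fun b' hb' h => hl.1 (by
        have := w.injective h; rw [Sum.inr.injEq] at this; exact this ▸ hb')
    obtain ⟨g, hg1, hg2⟩ : ∃ g : List (QGate W), g.length ≤ 1 ∧ ∀ ψ, applyGates g ψ = fun z =>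
        ψ (Function.update z (w (.inr b)) (Bool.xor (z (w (.inr b))) (wireVal (p b) z))) := by
      cases hb : p b with
      | none => exact ⟨[], by simp, fun ψ => by simp [applyGates, wireVal]⟩
      | some j =>
        refine ⟨[.cnot j (w (.inr b)) fun h => hp b b (by rw [hb, h])], by simp, fun ψ => rfl⟩
    refine ⟨g ++ G, fun z => Function.update (C z) (w (.inr b))
      (Bool.xor (C z (w (.inr b))) (wireVal (p b) (C z))), by simp; omega, ?_, ?_, ?_⟩
    · intro ψ; rw [applyGates_append, hg2, h2]
    · intro z b' hb'
      by_cases h : b' = b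
      · subst h
        simp [hCb, hCp]
      · have hne : w (.inr b') ≠ w (.inr b) := fun e => h (Sum.inr_injective (w.injective e))
        beta_reduce
        rw [Function.update_of_ne hne]
        exact h3 z b' ((List.mem_cons.1 hb').resolve_left h)
    · intro z j hj
      beta_reduce
      rw [Function.update_of_ne (hj b (by simp)).symm]
      exact h4 z j fun b' hb' => hj b' (by simp [hb'])

/-- A function with a NAND circuit of `s` gates can be queried in superposition with the help of `s`
scratch wires that are `0` before and after: compute, copy the result, uncompute. -/
theorem Comp.exists_gates [Fintype β] {F : (α → Bool) → β → Bool} (hF : Comp s F)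
    (w : α ⊕ β ↪ Fin W) (sc : Fin s ↪ Fin W) (hdisj : ∀ i x, sc i ≠ w x) :
    ∃ G : List (QGate W), G.length ≤ 82 * s + Fintype.card β ∧ ∀ ψ : QState W,
      (∀ z, ψ z ≠ 0 → ∀ i, z (sc i) = false) → applyGates G ψ = fun z => ψ (xorFn F w z) := by
  obtain ⟨L, hL, hs, hav⟩ := hF
  obtain ⟨A, B, V, U, hA, hB, hV, hU, hVU, hoff, hloc, hval⟩ :=
    exists_computeGates hL hs w sc hdisj
  choose p hp hpv using fun b => (hav b).exists_wire hs w sc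
  obtain ⟨G, C, hG, hC, hC1, hC2⟩ := exists_copyGates w p (by
    intro b b' h
    rcases hp b _ h with ⟨a, ha⟩ | ⟨i, -, hi⟩
    · simpa using w.injective ha
    · exact hdisj _ _ hi.symm) Finset.univ.toList (Finset.nodup_toList _)
  have hCoff : ∀ z j, (∀ b, w (.inr b) ≠ j) → C z j = z j := fun z j h => hC2 z j fun b _ => h b
  refine ⟨A ++ G ++ B, by simp at hG ⊢; omega, fun ψ hψ => ?_⟩
  rw [applyGates_append, applyGates_append, hV, hC, hU]
  funext z
  have hsc : ∀ i, V (C (U z)) (sc i) = z (sc i) := by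
    intro i
    rw [hloc (C (U z)) (U z) (fun i => hCoff _ _ fun b => (hdisj _ _).symm)
      (fun a => hCoff _ _ fun b h => by simpa using w.injective h) i, hVU]
  have hsc' : ∀ i, xorFn F w z (sc i) = z (sc i) := fun i =>
    xorFn_of_ne _ _ _ fun b => (hdisj _ _).symm
  by_cases hz : ∀ i, z (sc i) = false
  · congr 1
    funext j
    by_cases hj : ∃ i, sc i = j
    · obtain ⟨i, rfl⟩ := hj
      rw [hsc, hsc']
    · push Not at hj
      rw [(hoff _ j hj).2]
      by_cases hb : ∃ b, w (.inr b) = j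
      · obtain ⟨b, rfl⟩ := hb
        rw [hC1 _ _ (by simp), (hoff _ _ hj).1, xorFn_inr,
          hpv b (U z) _ (fun a => (hoff z _ fun i => hdisj _ _).1) (hval z hz)]
      · push Not at hb
        rw [hCoff _ _ hb, (hoff _ j hj).1, xorFn_of_ne _ _ _ hb]
  · have h0 : ∀ z', (∀ i, z' (sc i) = z (sc i)) → ψ z' = 0 := by
      intro z' h
      by_contra hne
      exact hz fun i => by rw [← h]; exact hψ z' hne i
    rw [h0 _ hsc, h0 _ hsc']

end

/-! ### An efficient family of `d`-wise independent functions -/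

/-- A surjective homomorphism maps the uniform distribution to the uniform distribution. -/
theorem expect_comp_surjective {A B : Type} [AddCommGroup A] [AddCommGroup B] [Fintype A]
    [Fintype B] (f : A →+ B) (hf : Function.Surjective f) (g : B → ℂ) :
    𝔼 a, g (f a) = 𝔼 b, g b := by
  obtain ⟨σ, hσ⟩ := hf.hasRightInverse
  have h1 : ∀ b, 𝔼 a, g (f (a + σ b)) = 𝔼 a, g (f a) := fun b =>
    Fintype.expect_equiv (Equiv.addRight (σ b)) _ _ fun a => rfl
  have h2 : ∀ a, 𝔼 b, g (f a + b) = 𝔼 b, g b := fun a =>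
    Fintype.expect_equiv (Equiv.addLeft (f a)) _ _ fun a => rfl
  calc 𝔼 a, g (f a) = 𝔼 b : B, 𝔼 a, g (f (a + σ b)) := by
        simp only [h1]; rw [Finset.expect_const Finset.univ_nonempty]
    _ = 𝔼 a : A, 𝔼 b, g (f a + b) := by
        rw [Finset.expect_comm]; simp only [map_add, hσ _]
    _ = 𝔼 b, g b := by
        simp only [h2]; rw [Finset.expect_const Finset.univ_nonempty]

section
variable {m : ℕ} (hm : m ≠ 0)

noncomputable instance : Fintype (GaloisField 2 m) := Fintype.ofFinite _

/-- A basis of the field with `2 ^ m` elements over its prime field. -/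
noncomputable def gfBasis : Module.Basis (Fin m) (ZMod 2) (GaloisField 2 m) :=
  Module.finBasisOfFinrankEq _ _ (GaloisField.finrank 2 hm)

/-- The field element with the given coordinates. -/
noncomputable def gfEnc (x : Bits m) : GaloisField 2 m :=
  (gfBasis hm).equivFun.symm (fun i => toZ2 (x i))

/-- The coordinates of a field element. -/
noncomputable def gfDec (k : GaloisField 2 m) : Bits m :=
  fun i => ofZ2 ((gfBasis hm).equivFun k i)

theorem gfEnc_gfDec (k : GaloisField 2 m) : gfEnc hm (gfDec hm k) = k := by
  simp only [gfEnc, gfDec, toZ2_ofZ2]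
  exact (gfBasis hm).equivFun.symm_apply_apply k

theorem gfDec_gfEnc (x : Bits m) : gfDec hm (gfEnc hm x) = x := by
  funext i
  rw [gfEnc, gfDec, LinearEquiv.apply_symm_apply, ofZ2_toZ2]

theorem gfEnc_injective : Function.Injective (gfEnc hm) := fun x y h => by
  rw [← gfDec_gfEnc hm x, h, gfDec_gfEnc]

theorem gfDec_add (a b : GaloisField 2 m) (i : Fin m) :
    gfDec hm (a + b) i = Bool.xor (gfDec hm a i) (gfDec hm b i) := by
  rw [gfDec, map_add, Pi.add_apply, ← toZ2_ofZ2 ((gfBasis hm).equivFun a i), ofZ2_toZ2_add]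
  rfl

/-- Field multiplication is bilinear in the coordinates, so it has cubic circuits into which the
structure constants are hardwired. -/
theorem comp_gfMul : Comp (m * (m * m * 16)) (fun (z : Fin m ⊕ Fin m → Bool) =>
    gfDec hm (gfEnc hm (fun i => z (.inl i)) * gfEnc hm (fun i => z (.inr i)))) := by
  let T : Fin m → Fin m → Fin m → Bool := fun i j k =>
    ofZ2 ((gfBasis hm).equivFun (gfBasis hm i * gfBasis hm j) k)
  have h1 : ∀ k : Fin m, Comp (m * m * 16) (fun (z : Fin m ⊕ Fin m → Bool) (_ : Unit) =>
      ofZ2 (∑ p : Fin m × Fin m, toZ2 (z (.inl p.1) && z (.inr p.2) && T p.1 p.2 k))) := by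
    intro k
    refine (Comp.sumZ2 fun p : Fin m × Fin m =>
      ((Comp.bit (Sum.inl p.1 : Fin m ⊕ Fin m)).and (Comp.bit (Sum.inr p.2))).and
        (Comp.const fun _ => T p.1 p.2 k)).mono ?_
    simp
  refine (((Comp.pi h1).reindex fun k => (k, ())).mono (by simp)).congr fun z k => ?_
  simp only [gfDec, gfEnc, Module.Basis.equivFun_symm_apply]
  congr 1
  rw [Finset.sum_mul_sum, ← Finset.sum_product', map_sum, Finset.sum_apply]
  refine Finset.sum_congr (by simp) fun p _ => ?_
  rw [smul_mul_smul_comm, map_smul, Pi.smul_apply, smul_eq_mul, toZ2_and, toZ2_and, toZ2_ofZ2]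

variable {a b d : ℕ}

/-- Extension of a string to length `m` by zeros. -/
def padBits (m : ℕ) {a : ℕ} (x : Bits a) : Bits m := fun i => if h : i.1 < a then x ⟨i, h⟩ else false

theorem padBits_injective (ha : a ≤ m) : Function.Injective (padBits m (a := a)) := by
  intro x y h
  funext i
  have := congrFun h (Fin.castLE ha i)
  simpa [padBits] using this

theorem comp_padBits : Comp 0 (padBits m (a := a)) := by
  refine ⟨[], .nil, le_rfl, fun i => ?_⟩
  by_cases h : i.1 < a
  · exact .inr (.inl ⟨⟨i, h⟩, by simp [padBits, h]⟩)
  · exact .inr (.inr (by simp [padBits, h]))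

/-- The evaluation of the polynomial with coefficients `κ`. -/
noncomputable def gfPoly (κ : Fin d → GaloisField 2 m) (x : GaloisField 2 m) : GaloisField 2 m :=
  ∑ j, κ j * x ^ (j : ℕ)

/-- The member with index `κ` of a `d`-wise independent family of functions: a random polynomial of
degree less than `d` over a field that contains the domain, with its values cut to `b` bits. -/
noncomputable def polyHash (hb : b ≤ m) (κ : Fin d → GaloisField 2 m) (x : Bits a) : Bits b :=
  fun i => gfDec hm (gfPoly κ (gfEnc hm (padBits m x))) (Fin.castLE hb i)

theorem comp_gfPoly (κ : Fin d → GaloisField 2 m) :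
    Comp (d * (m * (m * m * 16) + m * 6)) (fun x => gfDec hm (gfPoly κ (gfEnc hm x))) := by
  induction d with
  | zero =>
    refine (Comp.constFalse.mono (by omega)).congr fun x i => ?_
    simp [gfPoly, gfDec, ofZ2]
  | succ d ih =>
    have hmul := (comp_gfMul hm).comp ((Comp.wires (fun i : Fin m => i)).elim
      (ih fun j => κ j.succ))
    have hadd : ∀ i : Fin m, Comp 6 (fun (y : Bits m) (_ : Unit) =>
        Bool.xor (gfDec hm (κ 0) i) (y i)) := fun i =>
      ((Comp.const fun _ => gfDec hm (κ 0) i).xor (Comp.bit i)).mono (by omega)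
    have hadd' := ((Comp.pi hadd).reindex fun k => (k, ())).comp hmul
    refine (hadd'.mono ?_).congr fun x i => ?_
    · simp; ring_nf; omega
    · simp only [Sum.elim_inl, Sum.elim_inr, gfEnc_gfDec]
      rw [← gfDec_add]
      congr 1
      simp only [gfPoly, Fin.sum_univ_succ, Finset.mul_sum, Fin.val_zero, pow_zero, mul_one,
        Fin.val_succ, pow_succ]
      congr 1
      exact Finset.sum_congr rfl fun j _ => by ring

theorem comp_polyHash (hb : b ≤ m) (κ : Fin d → GaloisField 2 m) :
    Comp (d * (m * (m * m * 16) + m * 6)) (polyHash hm hb κ (a := a)) :=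
  ((comp_gfPoly hm κ).comp comp_padBits).reindex _ |>.mono (by omega)

/-- A polynomial of degree less than `d` has prescribed values at up to `d` points. -/
theorem gfPoly_surjective {S : Finset (GaloisField 2 m)} (hS : S.card ≤ d)
    (r : GaloisField 2 m → GaloisField 2 m) :
    ∃ κ : Fin d → GaloisField 2 m, ∀ x ∈ S, gfPoly κ x = r x := by
  classical
  set p := Lagrange.interpolate S id r
  have hdeg : p.degree < d := (Lagrange.degree_interpolate_lt r (Set.injOn_id _)).trans_le
    (by exact_mod_cast hS)
  refine ⟨fun j => p.coeff j, fun x hx => ?_⟩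
  rw [gfPoly, Fin.sum_univ_eq_sum_range (fun j => p.coeff j * x ^ j) d,
    ← Polynomial.eval_eq_sum_range' (by
      rcases eq_or_ne p 0 with h | h
      · have : 0 < d := lt_of_lt_of_le (Finset.card_pos.2 ⟨x, hx⟩) hS
        simpa [h] using this
      · exact (Polynomial.natDegree_lt_iff_degree_lt h).2 hdeg)]
  exact Lagrange.eval_interpolate_at_node r (Set.injOn_id _) hx

/-- Bits as elements of `ℤ/2`. -/
def bitsZ2 : Bool ≃ ZMod 2 := ⟨toZ2, ofZ2, ofZ2_toZ2, toZ2_ofZ2⟩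

/-- The family `polyHash` is `d`-wise independent: its values at up to `d` points are the image of
the coefficients under a homomorphism, which is surjective by interpolation. -/
theorem expect_polyHash (ha : a ≤ m) (hb : b ≤ m) {S : Finset (Bits a)} (hS : S.card ≤ d)
    {Φ : (Bits a → Bits b) → ℂ} (hΦ : DependsOn Φ (S : Set (Bits a))) :
    𝔼 κ : Fin d → GaloisField 2 m, Φ (polyHash hm hb κ) = 𝔼 c : Bits a → Bits b, Φ c := by
  classical
  let dec : ((Bits a → Fin b → ZMod 2)) → (Bits a → Bits b) := fun t x i => ofZ2 (t x i)
  let ext : (S → Fin b → ZMod 2) → (Bits a → Fin b → ZMod 2) :=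
    fun t x => if h : x ∈ S then t ⟨x, h⟩ else 0
  let Λ : (Fin d → GaloisField 2 m) →+ (S → Fin b → ZMod 2) :=
    { toFun := fun κ x i => (gfBasis hm).equivFun (gfPoly κ (gfEnc hm (padBits m x.1)))
        (Fin.castLE hb i)
      map_zero' := by funext x i; simp [gfPoly]
      map_add' := by
        intro κ κ'
        funext x i
        simp [gfPoly, add_mul, Finset.sum_add_distrib] }
  let ρ : (Bits a → Fin b → ZMod 2) →+ (S → Fin b → ZMod 2) :=
    { toFun := fun t x => t x.1
      map_zero' := rfl
      map_add' := fun _ _ => rfl }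
  have hΛ : Function.Surjective Λ := by
    intro t
    let e : Bits a → GaloisField 2 m := fun x => gfEnc hm (padBits m x)
    have he : Function.Injective e := (gfEnc_injective hm).comp (padBits_injective ha)
    obtain ⟨κ, hκ⟩ := gfPoly_surjective (d := d) (S := S.image e)
      (Finset.card_image_le.trans hS) (fun y => (gfBasis hm).equivFun.symm (fun i =>
        if h : i.1 < b then ext t (Function.invFun e y) ⟨i, h⟩ else 0))
    refine ⟨κ, ?_⟩
    funext x i
    change (gfBasis hm).equivFun (gfPoly κ (e x.1)) (Fin.castLE hb i) = _
    rw [hκ _ (Finset.mem_image_of_mem _ x.2), LinearEquiv.apply_symm_apply,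
      Function.leftInverse_invFun he]
    simp [ext]
  have hρ : Function.Surjective ρ := by
    intro t
    refine ⟨ext t, ?_⟩
    funext x
    simp [ρ, ext]
  calc 𝔼 κ : Fin d → GaloisField 2 m, Φ (polyHash hm hb κ)
      = 𝔼 κ, Φ (dec (ext (Λ κ))) := by
        refine Finset.expect_congr rfl fun κ _ => hΦ fun x hx => ?_
        have hx' : x ∈ S := hx
        funext i
        simp [dec, ext, hx', Λ, polyHash, gfDec]
    _ = 𝔼 t, Φ (dec (ext t)) := expect_comp_surjective Λ hΛ fun t => Φ (dec (ext t))
    _ = 𝔼 t, Φ (dec (ext (ρ t))) :=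
        (expect_comp_surjective ρ hρ fun t => Φ (dec (ext t))).symm
    _ = 𝔼 t, Φ (dec t) := by
        refine Finset.expect_congr rfl fun t _ => hΦ fun x hx => ?_
        have hx' : x ∈ S := hx
        funext i
        simp [dec, ext, hx', ρ]
    _ = 𝔼 c : Bits a → Bits b, Φ c :=
        Fintype.expect_equiv (Equiv.piCongrRight fun _ => Equiv.piCongrRight fun _ =>
          bitsZ2.symm) _ _ fun t => rfl

end

/-! ### Random oracles and hash-and-sign oracles -/

/-- The forger's oracles when both answers on a message `m` are read off from one value `v m`. -/
def valueImpl {msg ran dom : ℕ} {V : Type} (h : Bits msg → V → Bits ran)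
    (s : Bits msg → V → Bits dom) (v : Bits msg → V) : (forgerSpec msg ran dom).Impl :=
  forgerImpl (fun m => h m (v m)) (fun m => s m (v m))

theorem xorQuery_congr {k a b : ℕ} {f f' : Bits a → Bits b} (w : Fin a ⊕ Fin b ↪ Fin k) (z : Bits k)
    (h : f (fun s => z (w (.inl s))) = f' (fun s => z (w (.inl s)))) :
    xorQuery f w z = xorQuery f' w z := by
  funext j
  unfold xorQuery
  rw [h]

theorem valueImpl_congr {msg ran dom : ℕ} {V : Type} {h : Bits msg → V → Bits ran}
    {s : Bits msg → V → Bits dom} {v v' : Bits msg → V} (i : ForgerOracle) {m : Bits msg}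
    (hv : v m = v' m) : valueImpl h s v i m = valueImpl h s v' i m := by
  cases i <;> simp only [valueImpl, forgerImpl] <;> rw [hv]

/-! ### Success probabilities as functions of few oracle values -/

section
variable {M Y : Type}

/-- The span of the functions of an oracle `c : M → Y` that depend on at most `t` of its values. -/
def juntas (M Y : Type) (t : ℕ) : Submodule ℂ ((M → Y) → ℂ) :=
  Submodule.span ℂ {Φ | ∃ S : Finset M, S.card ≤ t ∧ DependsOn Φ (S : Set M)}

theorem juntas_mono {s t : ℕ} (h : s ≤ t) : juntas M Y s ≤ juntas M Y t :=
  Submodule.span_mono fun _ ⟨S, hS, hΦ⟩ => ⟨S, hS.trans h, hΦ⟩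

theorem mul_mem_juntas [DecidableEq M] {s t : ℕ} {Φ Ψ : (M → Y) → ℂ} (hΦ : Φ ∈ juntas M Y s)
    (hΨ : Ψ ∈ juntas M Y t) : Φ * Ψ ∈ juntas M Y (s + t) := by
  have h := Submodule.mul_mem_mul hΦ hΨ
  rw [juntas, juntas, Submodule.span_mul_span] at h
  refine Submodule.span_mono ?_ h
  rintro _ ⟨Φ, ⟨S, hS, hΦ⟩, Ψ, ⟨T, hT, hΨ⟩, rfl⟩
  refine ⟨S ∪ T, (Finset.card_union_le _ _).trans (by omega), fun c c' hc => ?_⟩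
  change Φ c * Ψ c = Φ c' * Ψ c'
  rw [hΦ fun x hx => hc x (by simp_all), hΨ fun x hx => hc x (by simp_all)]

theorem star_mem_juntas {t : ℕ} {Φ : (M → Y) → ℂ} (hΦ : Φ ∈ juntas M Y t) :
    star Φ ∈ juntas M Y t := by
  induction hΦ using Submodule.span_induction with
  | mem Φ h =>
    obtain ⟨S, hS, hΦ⟩ := h
    refine Submodule.subset_span ⟨S, hS, fun c c' hc => ?_⟩
    simp [hΦ hc]
  | zero => simp
  | add Φ Ψ _ _ h1 h2 => rw [star_add]; exact add_mem h1 h2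
  | smul a Φ _ h => rw [star_smul]; exact Submodule.smul_mem _ _ h

theorem coordinate_mem_juntas (m : M) (g : Y → ℂ) : (fun c : M → Y => g (c m)) ∈ juntas M Y 1 :=
  Submodule.subset_span ⟨{m}, by simp, fun c c' hc => congrArg g (hc m (by simp))⟩

theorem const_mem_juntas (t : ℕ) (a : ℂ) : (fun _ : M → Y => a) ∈ juntas M Y t :=
  Submodule.subset_span ⟨∅, by simp, fun c c' hc => rfl⟩

theorem smul_mem_juntas {t : ℕ} (a : ℂ) {Φ : (M → Y) → ℂ} (h : Φ ∈ juntas M Y t) :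
    (fun c => a * Φ c) ∈ juntas M Y t := Submodule.smul_mem _ a h

theorem gate_mem_juntas {t k : ℕ} (g : QGate k) {ψ : (M → Y) → QState k}
    (h : ∀ z, (fun c => ψ c z) ∈ juntas M Y t) (z : Bits k) :
    (fun c => g.apply (ψ c) z) ∈ juntas M Y t := by
  cases g with
  | hadamard i => exact smul_mem_juntas _ (add_mem (h _) (smul_mem_juntas _ (h _)))
  | phase i => exact smul_mem_juntas _ (h _)
  | piEighth i => exact smul_mem_juntas _ (h _)
  | cnot c t _ => exact h _

end

section
variable {msg ran dom k : ℕ} {Y : Type} [Fintype Y] {h : Bits msg → Y → Bits ran}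
  {s : Bits msg → Y → Bits dom}

/-- A query reads one value of the oracle for each basis state; a sum over the possible values makes
this a product with an indicator function. -/
theorem query_mem_juntas {t : ℕ} {i : ForgerOracle} {w : Fin msg ⊕ _ ↪ Fin k}
    {ψ : (Bits msg → Y) → QState k}
    (hψ : ∀ z, (fun c => ψ c z) ∈ juntas (Bits msg) Y t) (z : Bits k) :
    (fun c => queryApply (valueImpl h s c i) w (ψ c) z) ∈ juntas (Bits msg) Y (t + 1) := by
  classical
  set m : Bits msg := fun s => z (w (.inl s))
  have e : (fun c => queryApply (valueImpl h s c i) w (ψ c) z) = ∑ y : Y,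
      (fun c : Bits msg → Y => if c m = y then (1 : ℂ) else 0) *
        (fun c => ψ c (xorQuery (valueImpl h s (fun _ => y) i) w z)) := by
    funext c
    simp only [Finset.sum_apply, Pi.mul_apply, ite_mul, one_mul, zero_mul, Finset.sum_ite_eq,
      Finset.mem_univ, if_true, queryApply]
    congr 1
    exact xorQuery_congr w z (valueImpl_congr i rfl)
  rw [e]
  refine Submodule.sum_mem _ fun y _ => ?_
  rw [add_comm]
  exact mul_mem_juntas (coordinate_mem_juntas m fun y' => if y' = y then 1 else 0) (hψ _)

/-- After `q` queries each amplitude is a combination of functions of at most `q` oracle values, so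
each probability is one of functions of at most `2 * q`. The event may look at one more value. -/
theorem runProb_mem_juntas (μ : Bits k → Bits msg)
    (E : Y → (forgerSpec msg ran dom).Transcript → Bits k → Prop)
    (ops : List (QOp (forgerSpec msg ran dom) k)) :
    ∀ (t : ℕ) (tr : (forgerSpec msg ran dom).Transcript) (ψ : (Bits msg → Y) → QState k),
      (∀ z, (fun c => ψ c z) ∈ juntas (Bits msg) Y t) →
      (fun c => ((runProb (valueImpl h s c) (fun tr z => E (c (μ z)) tr z) ops tr (ψ c) : ℝ) : ℂ))
        ∈ juntas (Bits msg) Y (2 * (t + ops.length) + 1) := by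
  classical
  induction ops with
  | nil =>
    intro t tr ψ hψ
    have e : (fun c => ((runProb (valueImpl h s c) (fun tr z => E (c (μ z)) tr z) [] tr (ψ c) : ℝ) :
        ℂ)) = ∑ z, ((fun c => ψ c z) * star (fun c => ψ c z)) *
          (fun c : Bits msg → Y => if E (c (μ z)) tr z then (1 : ℂ) else 0) := by
      funext c
      simp only [runProb, Finset.sum_apply, Pi.mul_apply, Pi.star_apply, Complex.ofReal_sum,
        RCLike.star_def, Complex.mul_conj']
      refine Finset.sum_congr rfl fun z _ => ?_
      split_ifs <;> simp
    rw [e]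
    refine Submodule.sum_mem _ fun z _ => ?_
    have := mul_mem_juntas (mul_mem_juntas (hψ z) (star_mem_juntas (hψ z)))
      (coordinate_mem_juntas (μ z) fun y => if E y tr z then 1 else 0)
    exact juntas_mono (by simp [two_mul]) this
  | cons op ops ih =>
    intro t tr ψ hψ
    cases op with
    | gate g =>
      exact juntas_mono (by simp only [List.length_cons]; omega) (ih t tr _ (gate_mem_juntas g hψ))
    | query i w =>
      simp only [runProb]
      split_ifs
      · simp only [Complex.ofReal_sum]
        have : ∀ q : Bits msg, (fun c => ((runProb (valueImpl h s c)
            (fun tr z => E (c (μ z)) tr z) ops (⟨i, q⟩ :: tr)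
              (queryApply (valueImpl h s c i) w (projectQuery w q (ψ c))) : ℝ) : ℂ))
            ∈ juntas (Bits msg) Y (2 * (t + 1 + ops.length) + 1) := by
          intro q
          refine ih (t + 1) _ _ (query_mem_juntas fun z => ?_)
          by_cases hz : (fun s => z (w (Sum.inl s))) = q
          · simpa only [projectQuery, if_pos hz] using hψ z
          · simpa only [projectQuery, if_neg hz] using const_mem_juntas t 0
        have h2 := Submodule.sum_mem _ fun q (_ : q ∈ Finset.univ) => this q
        refine juntas_mono (s := 2 * (t + 1 + ops.length) + 1) (by simp only [List.length_cons]; omega) ?_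
        convert h2 using 1
        funext c
        rw [Finset.sum_apply]
        rfl
      · exact juntas_mono (by simp only [List.length_cons]; omega) (ih (t + 1) tr _ (query_mem_juntas hψ))

end

/-- A circuit cannot distinguish a random function from a `d`-wise independent one when `d` exceeds
twice the number of its queries. -/
theorem expect_runProb_polyHash {msg ran dom k b m : ℕ} (hm : m ≠ 0) (ha : msg ≤ m) (hb : b ≤ m)
    {h : Bits msg → Bits b → Bits ran} {s : Bits msg → Bits b → Bits dom} (μ : Bits k → Bits msg)
    (E : Bits b → (forgerSpec msg ran dom).Transcript → Bits k → Prop)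
    (ops : List (QOp (forgerSpec msg ran dom) k)) (ψ : QState k) :
    (𝔼 κ : Fin (2 * ops.length + 1) → GaloisField 2 m,
      runProb (valueImpl h s (polyHash hm hb κ)) (fun tr z => E (polyHash hm hb κ (μ z)) tr z)
        ops [] ψ) =
    𝔼 c : Bits msg → Bits b,
      runProb (valueImpl h s c) (fun tr z => E (c (μ z)) tr z) ops [] ψ := by
  have key := runProb_mem_juntas (h := h) (s := s) μ E ops 0 [] (fun _ => ψ)
    (fun z => const_mem_juntas 0 _)
  rw [zero_add] at key
  have H : ∀ Φ ∈ juntas (Bits msg) (Bits b) (2 * ops.length + 1),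
      𝔼 κ : Fin (2 * ops.length + 1) → GaloisField 2 m, Φ (polyHash hm hb κ) =
        𝔼 c : Bits msg → Bits b, Φ c := by
    intro Φ hΦ
    induction hΦ using Submodule.span_induction with
    | mem Φ hΦ =>
      obtain ⟨S, hS, hΦ⟩ := hΦ
      exact expect_polyHash hm ha hb hS hΦ
    | zero => simp
    | add Φ Ψ _ _ h1 h2 => simp only [Pi.add_apply, Finset.expect_add_distrib, h1, h2]
    | smul a Φ _ h => simp only [Pi.smul_apply, ← Finset.smul_expect, h]
  have := H _ key
  apply Complex.ofReal_injective
  simpa only [Finset.expect, NNRat.smul_def, Complex.ofReal_mul, Complex.ofReal_sum,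
    Complex.ofReal_nnratCast] using this

/-! ### Changing an oracle at few places -/

/-- The expected value of `χ` at the outcome of a measurement of the query register. -/
noncomputable def queryWeight {k a b : ℕ} (χ : Bits a → ℝ) (w : Fin a ⊕ Fin b ↪ Fin k)
    (ψ : QState k) : ℝ := ∑ z, χ (fun s => z (w (.inl s))) * ‖ψ z‖ ^ 2

section
variable {msg ran dom k : ℕ} (O : (forgerSpec msg ran dom).Impl) (χ : Bits msg → ℝ)
  (μ : Bits k → Bits msg)

/-- The sum of the expected values of `χ` at the queries of a run, each measured at the moment when
it is made, and at the point `μ z` given by the final measurement. -/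
noncomputable def totalWeight : List (QOp (forgerSpec msg ran dom) k) → QState k → ℝ
  | [], ψ => ∑ z, χ (μ z) * ‖ψ z‖ ^ 2
  | .gate g :: ops, ψ => totalWeight ops (g.apply ψ)
  | .query i w :: ops, ψ => queryWeight χ w ψ +
      if (forgerSpec msg ran dom).classical i then
        ∑ q, totalWeight ops (queryApply (O i) w (projectQuery w q ψ))
      else totalWeight ops (queryApply (O i) w ψ)

theorem totalWeight_const_le {η : ℝ} (hη : 0 ≤ η) (ops : List (QOp (forgerSpec msg ran dom) k))
    (ψ : QState k) :
    totalWeight O (fun _ => η) μ ops ψ ≤ η * (ops.length + 1) * normSq ψ := by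
  induction ops generalizing ψ with
  | nil => simp [totalWeight, ← Finset.mul_sum, normSq]
  | cons op ops ih =>
    cases op with
    | gate g =>
      refine (ih _).trans ?_
      have := mul_nonneg hη (normSq_nonneg ψ)
      rw [g.normSq_apply]
      push_cast [List.length_cons]
      nlinarith
    | query i w =>
      have h1 : queryWeight (fun _ => η) w ψ = η * normSq ψ := by
        simp [queryWeight, normSq, Finset.mul_sum]
      have h2 : (if (forgerSpec msg ran dom).classical i then
          ∑ q, totalWeight O (fun _ => η) μ ops (queryApply (O i) w (projectQuery w q ψ))
          else totalWeight O (fun _ => η) μ ops (queryApply (O i) w ψ))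
          ≤ η * (ops.length + 1) * normSq ψ := by
        split_ifs
        · rw [← sum_normSq_projectQuery w ψ, Finset.mul_sum]
          exact Finset.sum_le_sum fun q _ => (ih _).trans_eq (by rw [normSq_queryApply])
        · exact (ih _).trans_eq (by rw [normSq_queryApply])
      refine (add_le_add h1.le h2).trans_eq ?_
      push_cast [List.length_cons]
      ring

/-- The total weight is linear in `χ`. -/
theorem totalWeight_sum {Ω : Type} [Fintype Ω] (p : Ω → ℝ) (χ : Ω → Bits msg → ℝ)
    (ops : List (QOp (forgerSpec msg ran dom) k)) (ψ : QState k) :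
    ∑ ω, p ω * totalWeight O (χ ω) μ ops ψ =
      totalWeight O (fun m => ∑ ω, p ω * χ ω m) μ ops ψ := by
  have hsum : ∀ f : Bits k → Bits msg, ∀ ψ : QState k,
      ∑ ω, p ω * ∑ z, χ ω (f z) * ‖ψ z‖ ^ 2 = ∑ z, (∑ ω, p ω * χ ω (f z)) * ‖ψ z‖ ^ 2 := by
    intro f ψ
    simp only [Finset.mul_sum, Finset.sum_mul]
    rw [Finset.sum_comm]
    simp only [mul_assoc]
  induction ops generalizing ψ with
  | nil => exact hsum _ _
  | cons op ops ih =>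
    cases op with
    | gate g => exact ih _
    | query i w =>
      simp only [totalWeight, mul_add, Finset.sum_add_distrib]
      congr 1
      · exact hsum _ _
      · split_ifs
        · simp only [Finset.mul_sum]
          rw [Finset.sum_comm]
          exact Finset.sum_congr rfl fun q _ => ih _
        · exact ih _

end

section
variable {msg ran dom k : ℕ} {V : Type} {h : Bits msg → V → Bits ran} {s : Bits msg → V → Bits dom}

/-- One query answered by `f` instead of `f'` moves the state only by its part that queries a message
on which they differ. -/
theorem normSq_query_sub_le {a b : ℕ} {f f' : Bits a → Bits b} {χ : Bits a → ℝ} (hχ0 : ∀ m, 0 ≤ χ m)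
    (hχ : ∀ m, f m ≠ f' m → 1 ≤ χ m) (w : Fin a ⊕ Fin b ↪ Fin k) (φ : QState k) :
    normSq (queryApply f w φ - queryApply f' w φ) ≤ 4 * queryWeight χ w φ := by
  have hr : ∀ f : Bits a → Bits b, ∑ z, χ (fun s => z (w (.inl s))) * ‖φ (xorQuery f w z)‖ ^ 2 =
      queryWeight χ w φ := by
    intro f
    have hi : ∀ z, xorQuery f w (xorQuery f w z) = z := xorQuery_involutive f w
    rw [queryWeight, ← Equiv.sum_comp (xorQuery_involutive f w).toPerm]
    simp [xorQuery_inl, hi]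
  have : 4 * queryWeight χ w φ = ∑ z, χ (fun s => z (w (.inl s))) *
      (2 * ‖φ (xorQuery f w z)‖ ^ 2 + 2 * ‖φ (xorQuery f' w z)‖ ^ 2) := by
    simp only [mul_add, Finset.sum_add_distrib, mul_left_comm _ (2 : ℝ), ← Finset.mul_sum, hr]
    ring
  rw [this]
  refine Finset.sum_le_sum fun z _ => ?_
  simp only [Pi.sub_apply, queryApply]
  by_cases hz : f (fun s => z (w (.inl s))) = f' (fun s => z (w (.inl s)))
  · rw [xorQuery_congr w z hz, sub_self, norm_zero]
    exact le_trans (by norm_num) (mul_nonneg (hχ0 _) (by positivity))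
  · have h1 := hχ _ hz
    have h2 := norm_add_sq_le_weighted (φ (xorQuery f w z)) (-φ (xorQuery f' w z)) one_pos
    rw [← sub_eq_add_neg, norm_neg] at h2
    have h3 : 0 ≤ ‖φ (xorQuery f w z)‖ ^ 2 := by positivity
    have h4 : 0 ≤ ‖φ (xorQuery f' w z)‖ ^ 2 := by positivity
    norm_num at h2
    nlinarith

/-- Continuity of acceptance probabilities in the initial state. The parameter `c` is optimized only
at the end of the hybrid argument. -/
theorem abs_runProb_sub_le {𝒪 : OracleSpec} (O : 𝒪.Impl) (E : 𝒪.Transcript → Bits k → Prop)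
    (ops : List (QOp 𝒪 k)) (tr : 𝒪.Transcript) (u u' : QState k) {N d c : ℝ} (hu : normSq u = N)
    (hu' : normSq u' = N) (hd : normSq (u - u') ≤ d) (hc : 0 < c) :
    |runProb O E ops tr u - runProb O E ops tr u'| ≤ c * N + (1 + c⁻¹) * d := by
  have hc' : 0 < 1 + c⁻¹ := by positivity
  have hd' : normSq (u' - u) ≤ d := by
    refine le_trans (le_of_eq ?_) hd
    exact Finset.sum_congr rfl fun z _ => by rw [Pi.sub_apply, Pi.sub_apply, norm_sub_rev]
  have key : ∀ v v' : QState k, normSq v' = N → normSq (v - v') ≤ d →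
      runProb O E ops tr v - runProb O E ops tr v' ≤ c * N + (1 + c⁻¹) * d := by
    intro v v' hv' hd
    have h1 := runProb_add_le O E ops tr v' (v - v') hc
    rw [add_sub_cancel] at h1
    have h2 := runProb_le O E ops tr v'
    have h3 := (runProb_le O E ops tr (v - v')).trans hd
    rw [hv'] at h2
    nlinarith
  rw [abs_le]
  constructor
  · have := key u' u hu hd'; linarith
  · exact key u u' hu' hd

/-- If the oracles given by `v` and `b` differ on few messages, then so do the probabilities of
their runs, as long as the run with `b` rarely queries these messages. -/
theorem abs_runProb_valueImpl_sub_le (v b : Bits msg → V) {χ : Bits msg → ℝ} (hχ0 : ∀ m, 0 ≤ χ m)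
    (hχ : ∀ m, v m ≠ b m → 1 ≤ χ m) (μ : Bits k → Bits msg)
    (E : V → (forgerSpec msg ran dom).Transcript → Bits k → Prop) {c : ℝ} (hc : 0 < c)
    (ops : List (QOp (forgerSpec msg ran dom) k)) (tr : (forgerSpec msg ran dom).Transcript)
    (ψ : QState k) :
    |runProb (valueImpl h s v) (fun tr z => E (v (μ z)) tr z) ops tr ψ -
      runProb (valueImpl h s b) (fun tr z => E (b (μ z)) tr z) ops tr ψ| ≤
      c * ops.length * normSq ψ + (1 + c⁻¹) * (4 * totalWeight (valueImpl h s b) χ μ ops ψ) := by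
  classical
  have hc' : 0 < c⁻¹ := by positivity
  induction ops generalizing tr ψ with
  | nil =>
    have h0 : 0 ≤ totalWeight (valueImpl h s b) χ μ [] ψ :=
      Finset.sum_nonneg fun z _ => mul_nonneg (hχ0 _) (by positivity)
    have h1 : |runProb (valueImpl h s v) (fun tr z => E (v (μ z)) tr z) [] tr ψ -
        runProb (valueImpl h s b) (fun tr z => E (b (μ z)) tr z) [] tr ψ| ≤
        totalWeight (valueImpl h s b) χ μ [] ψ := by
      simp only [runProb, totalWeight, ← Finset.sum_sub_distrib]
      refine (Finset.abs_sum_le_sum_abs _ _).trans (Finset.sum_le_sum fun z _ => ?_)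
      have h2 : 0 ≤ ‖ψ z‖ ^ 2 := by positivity
      by_cases hz : v (μ z) = b (μ z)
      · simp only [hz, sub_self, abs_zero]
        exact mul_nonneg (hχ0 _) h2
      · have := hχ _ hz
        refine le_trans ?_ (le_mul_of_one_le_left h2 this)
        rw [abs_le]
        split_ifs <;> constructor <;> linarith
    simp only [List.length_nil, Nat.cast_zero, mul_zero, zero_mul, zero_add]
    nlinarith
  | cons op ops ih =>
    cases op with
    | gate g =>
      refine (ih tr (g.apply ψ)).trans ?_
      have h1 := mul_nonneg hc.le (normSq_nonneg ψ)
      rw [g.normSq_apply]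
      simp only [totalWeight]
      push_cast [List.length_cons]
      nlinarith
    | query i w =>
      have step : ∀ tr' φ,
          |runProb (valueImpl h s v) (fun tr z => E (v (μ z)) tr z) ops tr'
              (queryApply (valueImpl h s v i) w φ) -
            runProb (valueImpl h s b) (fun tr z => E (b (μ z)) tr z) ops tr'
              (queryApply (valueImpl h s b i) w φ)| ≤
          c * (ops.length + 1) * normSq φ + (1 + c⁻¹) * (4 * (queryWeight χ w φ +
            totalWeight (valueImpl h s b) χ μ ops (queryApply (valueImpl h s b i) w φ))) := by
        intro tr' φ
        have h1 := abs_runProb_sub_le (valueImpl h s v) (fun tr z => E (v (μ z)) tr z) ops tr'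
          _ _ (normSq_queryApply (valueImpl h s v i) w φ) (normSq_queryApply (valueImpl h s b i) w φ)
          (normSq_query_sub_le hχ0 (fun m hm => hχ m fun e => hm (valueImpl_congr i e)) w φ) hc
        have h2 := ih tr' (queryApply (valueImpl h s b i) w φ)
        rw [normSq_queryApply] at h2
        refine (abs_sub_le _ _ _).trans ((add_le_add h1 h2).trans_eq ?_)
        ring
      simp only [runProb, totalWeight]
      push_cast [List.length_cons]
      split_ifs
      · rw [← Finset.sum_sub_distrib]
        refine (Finset.abs_sum_le_sum_abs _ _).trans
          ((Finset.sum_le_sum fun q _ => step _ (projectQuery w q ψ)).trans_eq ?_)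
        have hq : ∑ q, queryWeight χ w (projectQuery w q ψ) = queryWeight χ w ψ := by
          unfold queryWeight
          rw [Finset.sum_comm]
          refine Finset.sum_congr rfl fun z _ => ?_
          simp [projectQuery, apply_ite norm, ite_pow]
        rw [Finset.sum_add_distrib, ← Finset.mul_sum, ← Finset.mul_sum, ← Finset.mul_sum,
          Finset.sum_add_distrib, hq, sum_normSq_projectQuery w ψ]
      · exact step _ _

end

/-! ### Random functions with independent values -/

section
variable {M V Ω : Type} [Fintype M] [DecidableEq M] [Fintype V] [Fintype Ω]

/-- The expected value of `Φ v` when the values `v m` are independent with laws `D m`. -/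
noncomputable def piE (D : M → V → ℝ) (Φ : (M → V) → ℝ) : ℝ := ∑ v, (∏ m, D m (v m)) * Φ v

/-- `D m` is a probability mass function for each `m`. -/
structure IsLaw (D : M → V → ℝ) : Prop where
  nonneg : ∀ m v, 0 ≤ D m v
  sum_eq_one : ∀ m, ∑ v, D m v = 1

theorem piE_mono {D : M → V → ℝ} (hD : IsLaw D) {Φ Ψ : (M → V) → ℝ} (h : ∀ v, Φ v ≤ Ψ v) :
    piE D Φ ≤ piE D Ψ :=
  Finset.sum_le_sum fun v _ =>
    mul_le_mul_of_nonneg_left (h v) (Finset.prod_nonneg fun m _ => hD.nonneg m _)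

theorem piE_const {D : M → V → ℝ} (hD : IsLaw D) (c : ℝ) : piE D (fun _ => c) = c := by
  have : ∑ v : M → V, ∏ m, D m (v m) = 1 := by
    have h := Finset.prod_univ_sum (fun _ => Finset.univ) D
    simpa [hD.sum_eq_one] using h.symm
  rw [piE, ← Finset.sum_mul, this, one_mul]

theorem piE_sub (D : M → V → ℝ) (Φ Ψ : (M → V) → ℝ) :
    piE D (fun v => Φ v - Ψ v) = piE D Φ - piE D Ψ := by
  simp [piE, mul_sub]

theorem piE_add (D : M → V → ℝ) (Φ Ψ : (M → V) → ℝ) :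
    piE D (fun v => Φ v + Ψ v) = piE D Φ + piE D Ψ := by
  simp [piE, mul_add, Finset.sum_add_distrib]

theorem piE_sum {ι : Type} [Fintype ι] (D : M → V → ℝ) (Φ : ι → (M → V) → ℝ) :
    piE D (fun v => ∑ i, Φ i v) = ∑ i, piE D (Φ i) := by
  simp only [piE, Finset.mul_sum]
  exact Finset.sum_comm

theorem piE_mul_left (D : M → V → ℝ) (c : ℝ) (Φ : (M → V) → ℝ) :
    piE D (fun v => c * Φ v) = c * piE D Φ := by
  simp only [piE, Finset.mul_sum]
  exact Finset.sum_congr rfl fun v _ => by ring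

theorem abs_piE_le {D : M → V → ℝ} (hD : IsLaw D) (Φ : (M → V) → ℝ) :
    |piE D Φ| ≤ piE D (fun v => |Φ v|) := by
  refine (Finset.abs_sum_le_sum_abs _ _).trans (Finset.sum_le_sum fun v _ => ?_)
  rw [abs_mul, abs_of_nonneg (Finset.prod_nonneg fun m _ => hD.nonneg m _)]

/-- Independent values of a random function can be generated from independent seeds. -/
theorem piE_pushforward [DecidableEq V] (P : M → Ω → ℝ) (X : M → Ω → V) (Φ : (M → V) → ℝ) :
    piE P (fun ω => Φ fun m => X m (ω m)) =
      piE (fun m v => ∑ ω, if X m ω = v then P m ω else 0) Φ := by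
  unfold piE
  have : ∀ v : M → V, ∏ m, (∑ ω, if X m ω = v m then P m ω else 0) =
      ∑ ω : M → Ω, if (fun m => X m (ω m)) = v then ∏ m, P m (ω m) else 0 := by
    intro v
    rw [Finset.prod_univ_sum]
    simp only [Fintype.piFinset_univ]
    refine Finset.sum_congr rfl fun ω _ => ?_
    split_ifs with h
    · exact Finset.prod_congr rfl fun m _ => if_pos (congrFun h m)
    · obtain ⟨m, hm⟩ := Function.ne_iff.1 h
      exact Finset.prod_eq_zero (Finset.mem_univ m) (if_neg hm)
  simp only [this, Finset.sum_mul]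
  rw [Finset.sum_comm]
  refine Finset.sum_congr rfl fun ω _ => ?_
  simp [ite_mul]

theorem piE_uniform [Nonempty Ω] (Φ : (M → Ω) → ℝ) :
    piE (fun _ _ => 1 / (Fintype.card Ω : ℝ)) Φ = 𝔼 ω, Φ ω := by
  rw [piE, Fintype.expect_eq_sum_div_card, Finset.sum_div]
  refine Finset.sum_congr rfl fun ω _ => ?_
  simp
  ring

/-- The law of `X m ω` for uniform `ω`. -/
noncomputable def lawOf [DecidableEq V] (X : M → Ω → V) (m : M) (v : V) : ℝ :=
  𝔼 ω, if X m ω = v then (1 : ℝ) else 0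

theorem isLaw_lawOf {M V Ω : Type} [Fintype V] [Fintype Ω] [DecidableEq V] [Nonempty Ω]
    (X : M → Ω → V) : IsLaw (lawOf X) where
  nonneg m v := Finset.expect_nonneg fun ω _ => by split_ifs <;> norm_num
  sum_eq_one m := by
    simp only [lawOf]
    rw [← Finset.expect_sum_comm]
    simp

theorem expect_eq_piE_lawOf [DecidableEq V] [Nonempty Ω] (X : M → Ω → V) (Φ : (M → V) → ℝ) :
    𝔼 ω : M → Ω, Φ (fun m => X m (ω m)) = piE (lawOf X) Φ := by
  rw [← piE_uniform, piE_pushforward]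
  congr 1
  funext m v
  rw [lawOf, Fintype.expect_eq_sum_div_card, Finset.sum_div]
  exact Finset.sum_congr rfl fun ω _ => by split_ifs <;> simp

/-- Independent pairs with independent components can be drawn in two rounds. -/
theorem piE_prod {U : Type} [Fintype U] (P : M → V → ℝ) (Q : M → U → ℝ) (Φ : (M → V × U) → ℝ) :
    piE (fun m x => P m x.1 * Q m x.2) Φ =
      piE Q (fun u => piE P (fun v => Φ fun m => (v m, u m))) := by
  unfold piE
  rw [← Equiv.sum_comp (Equiv.arrowProdEquivProdArrow M (fun _ => V) (fun _ => U)).symm,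
    Fintype.sum_prod_type_right]
  refine Finset.sum_congr rfl fun u _ => ?_
  rw [Finset.mul_sum]
  refine Finset.sum_congr rfl fun v _ => ?_
  simp only [Equiv.arrowProdEquivProdArrow, Equiv.coe_fn_symm_mk, Finset.prod_mul_distrib]
  ring

/-- One of the values can be drawn afresh. -/
theorem piE_resample {D : M → V → ℝ} (hD : IsLaw D) (m : M) (Φ : (M → V) → ℝ) :
    piE D Φ = piE D (fun v => ∑ y, D m y * Φ (Function.update v m y)) := by
  have hprod : ∀ (v : M → V) (y : V),
      (∏ x, D x (Function.update v m y x)) * D m (v m) = (∏ x, D x (v x)) * D m y := by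
    intro v y
    rw [← Finset.mul_prod_erase _ _ (Finset.mem_univ m),
      ← Finset.mul_prod_erase _ (fun x => D x (v x)) (Finset.mem_univ m), Function.update_self]
    have : ∏ x ∈ Finset.univ.erase m, D x (Function.update v m y x) =
        ∏ x ∈ Finset.univ.erase m, D x (v x) :=
      Finset.prod_congr rfl fun x hx => by rw [Function.update_of_ne (Finset.ne_of_mem_erase hx)]
    rw [this]; ring
  -- exchanging the value at `m` with the fresh one is an involution of pairs
  let swap : (M → V) × V → (M → V) × V := fun p => (Function.update p.1 m p.2, p.1 m)
  have hswap : Function.Involutive swap := by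
    intro p; simp [swap]
  calc piE D Φ = ∑ v : M → V, ∑ y, ((∏ x, D x (v x)) * D m y) * Φ v := by
        refine Finset.sum_congr rfl fun v _ => ?_
        rw [← Finset.sum_mul, ← Finset.mul_sum, hD.sum_eq_one, mul_one]
    _ = ∑ p : (M → V) × V, ((∏ x, D x (p.1 x)) * D m p.2) * Φ p.1 := by
        rw [Fintype.sum_prod_type]
    _ = ∑ p : (M → V) × V, ((∏ x, D x ((swap p).1 x)) * D m (swap p).2) * Φ (swap p).1 :=
        (Equiv.sum_comp hswap.toPerm fun p : (M → V) × V =>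
          ((∏ x, D x (p.1 x)) * D m p.2) * Φ p.1).symm
    _ = ∑ p : (M → V) × V, ((∏ x, D x (p.1 x)) * D m p.2) * Φ (Function.update p.1 m p.2) :=
        Finset.sum_congr rfl fun p _ => by simp only [swap, hprod]
    _ = _ := by
        rw [Fintype.sum_prod_type]
        refine Finset.sum_congr rfl fun v _ => ?_
        rw [Finset.mul_sum]
        exact Finset.sum_congr rfl fun y _ => by ring

theorem piE_coordinate {D : M → V → ℝ} (hD : IsLaw D) (m : M) (g : V → ℝ) :
    piE D (fun v => g (v m)) = ∑ y, D m y * g y := by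
  rw [piE_resample hD m]
  simp only [Function.update_self]
  exact piE_const hD _

end

/-! ### Replacing the law of an oracle -/

section
variable {msg ran dom k : ℕ} {V : Type} [Fintype V] [DecidableEq V]
  {h : Bits msg → V → Bits ran} {s : Bits msg → V → Bits dom}

/-- If each value of `D` is drawn from `B` except with probability `η`, then the runs with oracles
drawn from `D` and `B` are close: the set of exceptional messages is independent of the run with
oracle `B`, which therefore rarely hits it. -/
theorem abs_piE_mixture_sub_le {D A B : Bits msg → V → ℝ} (hA : IsLaw A) (hB : IsLaw B) {η : ℝ}
    (hη : 0 < η) (hη1 : η ≤ 1) (hD : ∀ m v, D m v = η * A m v + (1 - η) * B m v)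
    (μ : Bits k → Bits msg) (E : V → (forgerSpec msg ran dom).Transcript → Bits k → Prop)
    (ops : List (QOp (forgerSpec msg ran dom) k)) {ψ : QState k} (hψ : normSq ψ = 1) :
    |piE D (fun v => runProb (valueImpl h s v) (fun tr z => E (v (μ z)) tr z) ops [] ψ) -
      piE B (fun v => runProb (valueImpl h s v) (fun tr z => E (v (μ z)) tr z) ops [] ψ)| ≤
      9 * (ops.length + 1) * Real.sqrt η := by
  set Φ : (Bits msg → V) → ℝ :=
    fun v => runProb (valueImpl h s v) (fun tr z => E (v (μ z)) tr z) ops [] ψ with hΦ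
  let p : Bits msg → Bool → ℝ := fun _ e => if e then η else 1 - η
  let Q : Bits msg → V × V → ℝ := fun m x => A m x.1 * B m x.2
  have hp : IsLaw p :=
    ⟨fun m e => by cases e <;> simp [p] <;> linarith, fun m => by simp [p]⟩
  have hQ : IsLaw Q := by
    refine ⟨fun m x => mul_nonneg (hA.nonneg _ _) (hB.nonneg _ _), fun m => ?_⟩
    rw [Fintype.sum_prod_type]
    simp [Q, ← Finset.mul_sum, hB.sum_eq_one, hA.sum_eq_one]
  -- the oracles with laws `D` and `B` on one probability space: the pair `(a, b)` of values and the
  -- flag of each message are independent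
  have eD : piE D Φ = piE Q (fun u => piE p fun e => Φ fun m => if e m then (u m).1 else (u m).2) := by
    rw [← piE_prod p Q (fun ω => Φ fun m => if (ω m).1 then (ω m).2.1 else (ω m).2.2),
      piE_pushforward _ (fun m (ω : Bool × V × V) => if ω.1 then ω.2.1 else ω.2.2) Φ]
    congr 1
    funext m v
    rw [hD, Fintype.sum_prod_type]
    simp only [Fintype.sum_bool, p, Q, if_true, Bool.false_eq_true, if_false]
    rw [Fintype.sum_prod_type, Fintype.sum_prod_type_right]
    congr 1
    · rw [Finset.sum_eq_single v (fun a _ ha => by simp [ha]) (by simp)]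
      simp only [if_true]
      rw [← Finset.mul_sum, ← Finset.mul_sum, hB.sum_eq_one, mul_one]
    · rw [Finset.sum_eq_single v (fun a _ ha => by simp [ha]) (by simp)]
      simp only [if_true]
      rw [← Finset.mul_sum, ← Finset.sum_mul, hA.sum_eq_one, one_mul]
  have eB : piE B Φ = piE Q (fun u => piE p fun _ => Φ fun m => (u m).2) := by
    simp only [piE_const hp]
    rw [piE_pushforward _ (fun m (x : V × V) => x.2) Φ]
    congr 1
    funext m v
    rw [Fintype.sum_prod_type]
    simp [Q, ← Finset.sum_mul, hA.sum_eq_one]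
  have hs : 0 < Real.sqrt η := Real.sqrt_pos.2 hη
  have hs1 : Real.sqrt η ≤ 1 := Real.sqrt_le_one.2 hη1
  have hss : Real.sqrt η * Real.sqrt η = η := Real.mul_self_sqrt hη.le
  rw [eD, eB, ← piE_sub]
  refine (abs_piE_le hQ _).trans ?_
  rw [← piE_const hQ (9 * (ops.length + 1) * Real.sqrt η)]
  refine piE_mono hQ fun u => ?_
  rw [← piE_sub]
  refine (abs_piE_le hp _).trans ?_
  -- from here on the values are fixed, and only the flags are random
  set b : Bits msg → V := fun m => (u m).2
  let χ : (Bits msg → Bool) → Bits msg → ℝ := fun e m => if e m then 1 else 0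
  have h1 : ∀ e : Bits msg → Bool, |Φ (fun m => if e m then (u m).1 else (u m).2) - Φ b| ≤
      Real.sqrt η * ops.length +
        (1 + (Real.sqrt η)⁻¹) * 4 * totalWeight (valueImpl h s b) (χ e) μ ops ψ := by
    intro e
    refine (abs_runProb_valueImpl_sub_le _ b (χ := χ e) (fun m => ?_) (fun m hm => ?_) μ E hs ops []
      ψ).trans_eq ?_
    · simp only [χ]; split_ifs <;> norm_num
    · by_cases he : e m
      · simp [χ, he]
      · simp [he, b] at hm
    · rw [hψ]; ring
  refine (piE_mono hp h1).trans ?_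
  have h2 : piE p (fun e => Real.sqrt η * ops.length +
        (1 + (Real.sqrt η)⁻¹) * 4 * totalWeight (valueImpl h s b) (χ e) μ ops ψ) =
      Real.sqrt η * ops.length +
        (1 + (Real.sqrt η)⁻¹) * 4 * totalWeight (valueImpl h s b) (fun _ => η) μ ops ψ := by
    have h3 : piE p (fun e => totalWeight (valueImpl h s b) (χ e) μ ops ψ) =
        totalWeight (valueImpl h s b) (fun _ => η) μ ops ψ := by
      rw [piE, totalWeight_sum]
      congr 1
      funext m
      have := piE_coordinate hp m (fun e => if e then (1 : ℝ) else 0)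
      simpa [p, χ, piE] using this
    rw [piE_add, piE_const hp, piE_mul_left, h3]
  rw [h2]
  have h4 := totalWeight_const_le (valueImpl h s b) μ hη.le ops ψ
  rw [hψ, mul_one] at h4
  have h5 : (1 + (Real.sqrt η)⁻¹) * η = η + Real.sqrt η := by
    rw [add_mul, one_mul]; congr 1
    rw [inv_mul_eq_div, div_eq_iff hs.ne', hss]
  have h6 : η ≤ Real.sqrt η := by nlinarith
  have h7 : (0 : ℝ) ≤ ops.length := Nat.cast_nonneg _
  calc _ ≤ Real.sqrt η * ops.length + (1 + (Real.sqrt η)⁻¹) * 4 * (η * (ops.length + 1)) := by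
        gcongr
    _ = Real.sqrt η * ops.length + 4 * ((1 + (Real.sqrt η)⁻¹) * η) * (ops.length + 1) := by ring
    _ ≤ _ := by rw [h5]; nlinarith

/-- Pointwise statistically close laws of the oracle give close acceptance probabilities, however
many messages there are. -/
theorem abs_piE_sub_le {D D' : Bits msg → V → ℝ} (hD : IsLaw D) (hD' : IsLaw D') {ε : ℝ}
    (hε : ∀ m, ∑ v, |D m v - D' m v| ≤ ε)
    (μ : Bits k → Bits msg) (E : V → (forgerSpec msg ran dom).Transcript → Bits k → Prop)
    (ops : List (QOp (forgerSpec msg ran dom) k)) {ψ : QState k} (hψ : normSq ψ = 1) :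
    |piE D (fun v => runProb (valueImpl h s v) (fun tr z => E (v (μ z)) tr z) ops [] ψ) -
      piE D' (fun v => runProb (valueImpl h s v) (fun tr z => E (v (μ z)) tr z) ops [] ψ)| ≤
      18 * (ops.length + 1) * Real.sqrt ε := by
  set Φ : (Bits msg → V) → ℝ :=
    fun v => runProb (valueImpl h s v) (fun tr z => E (v (μ z)) tr z) ops [] ψ with hΦ
  have h7 : (0 : ℝ) ≤ ops.length := Nat.cast_nonneg _
  have hε0 : 0 ≤ ε := (Finset.sum_nonneg fun v _ => abs_nonneg _).trans (hε fun _ => false)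
  rcases hε0.eq_or_lt with h0 | hpos
  · have : D = D' := by
      funext m v
      have h1 := (Finset.single_le_sum (f := fun v => |D m v - D' m v|)
        (fun v _ => abs_nonneg _) (Finset.mem_univ v)).trans (hε m)
      rw [← h0] at h1
      exact sub_eq_zero.1 (abs_eq_zero.1 (le_antisymm h1 (abs_nonneg _)))
    rw [this, ← h0]
    simp
  have hΦ0 : ∀ v, 0 ≤ Φ v := fun v => runProb_nonneg _ _ _ _ _
  have hΦ1 : ∀ v, Φ v ≤ 1 := fun v => (runProb_le _ _ _ _ _).trans_eq hψ
  rcases le_or_gt 1 ε with h1 | hlt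
  · have hb : ∀ {D : Bits msg → V → ℝ}, IsLaw D → 0 ≤ piE D Φ ∧ piE D Φ ≤ 1 := by
      intro D hD
      exact ⟨(piE_const hD 0).symm.trans_le (piE_mono hD hΦ0),
        (piE_mono hD hΦ1).trans_eq (piE_const hD 1)⟩
    have h2 : 1 ≤ Real.sqrt ε := Real.one_le_sqrt.2 h1
    have := hb hD
    have := hb hD'
    rw [abs_le]
    constructor <;> nlinarith
  -- the common part of the two laws, normalized
  set c : Bits msg → ℝ := fun m => ∑ v, min (D m v) (D' m v) with hc
  have hcε : ∀ m, 1 - ε ≤ c m := by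
    intro m
    have : ∀ v, D m v - |D m v - D' m v| ≤ min (D m v) (D' m v) := by
      intro v
      refine le_min (by linarith [abs_nonneg (D m v - D' m v)]) ?_
      linarith [le_abs_self (D m v - D' m v)]
    have h2 := Finset.sum_le_sum fun v (_ : v ∈ Finset.univ) => this v
    rw [Finset.sum_sub_distrib, hD.sum_eq_one] at h2
    linarith [hε m]
  have hcpos : ∀ m, 0 < c m := fun m => by linarith [hcε m]
  have hB : IsLaw (fun m v => min (D m v) (D' m v) / c m) :=
    ⟨fun m v => div_nonneg (le_min (hD.nonneg _ _) (hD'.nonneg _ _)) (hcpos m).le,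
      fun m => by rw [← Finset.sum_div]; exact div_self (hcpos m).ne'⟩
  have key : ∀ {D₁ : Bits msg → V → ℝ}, IsLaw D₁ → (∀ m v, min (D m v) (D' m v) ≤ D₁ m v) →
      |piE D₁ Φ - piE (fun m v => min (D m v) (D' m v) / c m) Φ| ≤
        9 * (ops.length + 1) * Real.sqrt ε := by
    intro D₁ hD₁ hmin
    refine abs_piE_mixture_sub_le
      (A := fun m v => (D₁ m v - (1 - ε) * (min (D m v) (D' m v) / c m)) / ε) ?_ hB hpos hlt.le
      (fun m v => by field_simp; ring) μ E ops hψ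
    refine ⟨fun m v => div_nonneg (sub_nonneg.2 (le_trans ?_ (hmin m v))) hpos.le, fun m => ?_⟩
    · rw [← mul_div_assoc, div_le_iff₀ (hcpos m), mul_comm]
      exact mul_le_mul_of_nonneg_left (hcε m) (le_min (hD.nonneg _ _) (hD'.nonneg _ _))
    · rw [← Finset.sum_div, Finset.sum_sub_distrib, ← Finset.mul_sum, hB.sum_eq_one,
        hD₁.sum_eq_one]
      field_simp
      ring
  have k1 := key hD fun m v => min_le_left _ _
  have k2 := key hD' fun m v => min_le_right _ _
  rw [abs_sub_comm] at k2
  refine (abs_sub_le _ _ _).trans ((add_le_add k1 k2).trans_eq (by ring))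

end

/-! ### Guessing an unqueried signature -/

section
variable {msg ran dom k : ℕ}

/-- A run in which `m` is not among the classical queries to the signer does not depend on the
signature of `m`. -/
theorem runProb_congr_of_not_queried {O O' : (forgerSpec msg ran dom).Impl}
    (m : Bits msg) (hhash : O .hash = O' .hash) (hsign : ∀ q, q ≠ m → O .sign q = O' .sign q)
    (E : (forgerSpec msg ran dom).Transcript → Bits k → Prop)
    (hE : ∀ tr z, E tr z → (⟨ForgerOracle.sign, m⟩ : Σ _ : ForgerOracle, Bits msg) ∉ tr)
    (ops : List (QOp (forgerSpec msg ran dom) k)) (tr : (forgerSpec msg ran dom).Transcript)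
    (ψ : QState k) : runProb O E ops tr ψ = runProb O' E ops tr ψ := by
  classical
  have hdead : ∀ (O : (forgerSpec msg ran dom).Impl) (ops : List (QOp (forgerSpec msg ran dom) k))
      (tr : (forgerSpec msg ran dom).Transcript) (ψ : QState k),
      (⟨ForgerOracle.sign, m⟩ : Σ _ : ForgerOracle, Bits msg) ∈ tr → runProb O E ops tr ψ = 0 := by
    intro O ops
    induction ops with
    | nil =>
      intro tr ψ h
      exact Finset.sum_eq_zero fun z _ => if_neg fun hz => hE _ _ hz h
    | cons op ops ih =>
      intro tr ψ h
      cases op with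
      | gate g => exact ih _ _ h
      | query i w =>
        simp only [runProb]
        split_ifs
        · exact Finset.sum_eq_zero fun q _ => ih _ _ (List.mem_cons_of_mem _ h)
        · exact ih _ _ h
  induction ops generalizing tr ψ with
  | nil => rfl
  | cons op ops ih =>
    cases op with
    | gate g => exact ih _ _
    | query i w =>
      cases i with
      | hash =>
        simp only [runProb, hhash]
        rw [if_neg (by simp [forgerSpec]), if_neg (by simp [forgerSpec])]
        exact ih _ _
      | sign =>
        have hcl : (forgerSpec msg ran dom).classical .sign = true := rfl
        simp only [runProb, hcl, if_true]
        refine Finset.sum_congr rfl fun q _ => ?_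
        by_cases hq : q = m
        · subst hq
          exact (hdead O _ _ _ List.mem_cons_self).trans (hdead O' _ _ _ List.mem_cons_self).symm
        · rw [ih]
          congr 1
          funext z
          -- a basis state in the branch `q` has `q` in its query register
          simp only [queryApply, projectQuery, xorQuery_inl]
          split_ifs with hz
          · rw [xorQuery_congr w z (f := O .sign) (f' := O' .sign)]
            rw [hz]
            exact hsign q hq
          · rfl

/-- If, given its hash value, the signature of each message has min-entropy `log (1 / ε)`, then the
signature of a message that was not queried is found with probability at most `ε`. -/
theorem piE_guess_le {D : Bits msg → Bits ran × Bits dom → ℝ} (hD : IsLaw D) {ε : ℝ}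
    (hε : ∀ m y x, D m (y, x) ≤ ε * ∑ x', D m (y, x'))
    (μ : Bits k → Bits msg) (sg : Bits k → Bits dom)
    (ops : List (QOp (forgerSpec msg ran dom) k)) {ψ : QState k} (hψ : normSq ψ = 1) :
    piE D (fun v => runProb (valueImpl (fun _ y => y.1) (fun _ y => y.2) v)
      (fun (tr : (forgerSpec msg ran dom).Transcript) z =>
        (⟨ForgerOracle.sign, μ z⟩ : Σ _ : ForgerOracle, Bits msg) ∉ tr ∧ sg z = (v (μ z)).2) ops [] ψ) ≤ ε := by
  classical
  -- the weight of the outcomes with a given forgery, which may look at the hash value only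
  let g : Bits msg × Bits dom → (Bits msg → Bits ran × Bits dom) → ℝ := fun p v =>
    runProb (valueImpl (fun _ y => y.1) (fun _ y => y.2) v)
      (fun (tr : (forgerSpec msg ran dom).Transcript) z => (⟨ForgerOracle.sign, p.1⟩ : Σ _ : ForgerOracle, Bits msg) ∉ tr ∧
        μ z = p.1 ∧ sg z = p.2) ops [] ψ
  have hg0 : ∀ p v, 0 ≤ g p v := fun p v => runProb_nonneg _ _ _ _ _
  have hg : ∀ p v y, y.1 = (v p.1).1 → g p (Function.update v p.1 y) = g p v := by
    intro p v y hy
    refine runProb_congr_of_not_queried p.1 ?_ ?_ _ (fun tr z h => h.1) _ _ _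
    · funext (q : Bits msg)
      change (Function.update v p.1 y q).1 = (v q).1
      by_cases hq : q = p.1
      · rw [hq, Function.update_self, hy]
      · rw [Function.update_of_ne hq]
    · intro q hq
      change (Function.update v p.1 y q).2 = (v q).2
      rw [Function.update_of_ne hq]
  have h1 : ∀ v : Bits msg → Bits ran × Bits dom,
      runProb (valueImpl (fun _ y => y.1) (fun _ y => y.2) v)
        (fun (tr : (forgerSpec msg ran dom).Transcript) z => (⟨ForgerOracle.sign, μ z⟩ : Σ _ : ForgerOracle, Bits msg) ∉ tr ∧
          sg z = (v (μ z)).2) ops [] ψ = ∑ p, (if p.2 = (v p.1).2 then 1 else 0) * g p v := by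
    intro v
    rw [runProb_sum (E' := fun p : Bits msg × Bits dom => fun (tr : (forgerSpec msg ran dom).Transcript) z =>
      p.2 = (v p.1).2 ∧ (⟨ForgerOracle.sign, p.1⟩ : Σ _ : ForgerOracle, Bits msg) ∉ tr ∧
        μ z = p.1 ∧ sg z = p.2)]
    · refine Finset.sum_congr rfl fun p _ => ?_
      by_cases hp : p.2 = (v p.1).2
      · simp only [hp, true_and, if_true, one_mul, g]
      · simp only [hp, false_and, if_false, zero_mul]
        exact runProb_false _ _ _ _
    · intro tr z hz
      refine ⟨(μ z, sg z), ⟨hz.2, hz.1, rfl, rfl⟩, ?_⟩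
      rintro ⟨a, b⟩ ⟨-, -, rfl, rfl⟩
      rfl
    · rintro ⟨a, b⟩ tr z ⟨h1, h2, rfl, rfl⟩
      exact ⟨h2, h1⟩
  have h2 : ∀ p, piE D (fun v => (if p.2 = (v p.1).2 then 1 else 0) * g p v) ≤
      ε * piE D (g p) := by
    intro p
    have e1 : ∀ v : Bits msg → Bits ran × Bits dom, ∑ y, D p.1 y *
        ((if p.2 = (Function.update v p.1 y p.1).2 then 1 else 0) * g p (Function.update v p.1 y)) =
        ∑ y, D p.1 (y, p.2) * g p (Function.update v p.1 (y, p.2)) := by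
      intro v
      rw [Fintype.sum_prod_type]
      refine Finset.sum_congr rfl fun y _ => ?_
      rw [Finset.sum_eq_single p.2]
      · simp
      · intro x _ hx
        simp [Function.update_self, hx.symm]
      · simp
    have e2 : ∀ v : Bits msg → Bits ran × Bits dom, ∑ y, D p.1 y * g p (Function.update v p.1 y) =
        ∑ y, (∑ x, D p.1 (y, x)) * g p (Function.update v p.1 (y, p.2)) := by
      intro v
      rw [Fintype.sum_prod_type]
      refine Finset.sum_congr rfl fun y _ => ?_
      rw [Finset.sum_mul]
      refine Finset.sum_congr rfl fun x _ => ?_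
      congr 1
      rw [← hg p (Function.update v p.1 (y, p.2)) (y, x) (by simp)]
      simp
    rw [piE_resample hD p.1, piE_resample hD p.1 (g p), ← piE_mul_left]
    refine piE_mono hD fun v => ?_
    rw [e1, e2, Finset.mul_sum]
    refine Finset.sum_le_sum fun y _ => ?_
    rw [← mul_assoc]
    exact mul_le_mul_of_nonneg_right (hε _ _ _) (hg0 _ _)
  have h3 : ∀ v, ∑ p, g p v ≤ 1 := by
    intro v
    have := runProb_sum (valueImpl (fun _ y => y.1) (fun _ y => y.2) v)
      (E := fun (tr : (forgerSpec msg ran dom).Transcript) z => (⟨ForgerOracle.sign, μ z⟩ : Σ _ : ForgerOracle, Bits msg) ∉ tr)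
      (E' := fun p : Bits msg × Bits dom => fun (tr : (forgerSpec msg ran dom).Transcript) z =>
        (⟨ForgerOracle.sign, p.1⟩ : Σ _ : ForgerOracle, Bits msg) ∉ tr ∧ μ z = p.1 ∧ sg z = p.2)
      (fun _ z h => ⟨(μ z, sg z), ⟨h, rfl, rfl⟩, by rintro ⟨a, b⟩ ⟨-, rfl, rfl⟩; rfl⟩)
      (fun p _ z h => by rw [h.2.1]; exact h.1) ops [] ψ
    rw [← this]
    exact (runProb_le _ _ _ _ _).trans_eq hψ
  have hε0 : 0 ≤ ε := by
    have hs := hD.sum_eq_one (fun _ => false)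
    by_contra hneg
    push Not at hneg
    have : ∀ y : Bits ran × Bits dom, D (fun _ => false) y ≤ 0 := by
      rintro ⟨y, x⟩
      refine (hε _ y x).trans (mul_nonpos_of_nonpos_of_nonneg hneg.le ?_)
      exact Finset.sum_nonneg fun x' _ => hD.nonneg _ _
    have := Finset.sum_nonpos fun y (_ : y ∈ Finset.univ) => this y
    linarith
  simp only [h1, piE_sum]
  calc _ ≤ ∑ p, ε * piE D (g p) := Finset.sum_le_sum fun p _ => h2 p
    _ = ε * piE D (fun v => ∑ p, g p v) := by rw [← Finset.mul_sum, piE_sum]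
    _ ≤ ε * 1 := mul_le_mul_of_nonneg_left
        ((piE_mono hD h3).trans_eq (piE_const hD 1)) hε0
    _ = ε := mul_one _

end

/-! ### Simulating a forger -/

/-- Moving a gate to other wires. -/
def QGate.map {k W : ℕ} (φ : Fin k ↪ Fin W) : QGate k → QGate W
  | .hadamard i => .hadamard (φ i)
  | .phase i => .phase (φ i)
  | .piEighth i => .piEighth (φ i)
  | .cnot c t h => .cnot (φ c) (φ t) fun e => h (φ.injective e)

section
variable {k W : ℕ} {A : Type} (e : Fin k ⊕ A ≃ Fin W)

/-- The bit string on all wires with the given contents of the first `k` and of the other wires. -/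
def joinBits (z : Bits k) (a : A → Bool) : Bits W := fun j => Sum.elim z a (e.symm j)

@[simp] theorem joinBits_inl (z : Bits k) (a : A → Bool) (i : Fin k) :
    joinBits e z a (e (.inl i)) = z i := by simp [joinBits]

@[simp] theorem joinBits_inr (z : Bits k) (a : A → Bool) (i : A) :
    joinBits e z a (e (.inr i)) = a i := by simp [joinBits]

theorem joinBits_eq_iff {Z : Bits W} {z : Bits k} {a : A → Bool} :
    Z = joinBits e z a ↔ (∀ i, Z (e (.inl i)) = z i) ∧ ∀ i, Z (e (.inr i)) = a i := by
  constructor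
  · rintro rfl; simp
  · rintro ⟨h1, h2⟩
    funext j
    obtain ⟨x, rfl⟩ := e.surjective j
    cases x <;> simp [h1, h2]

theorem joinBits_self (Z : Bits W) :
    joinBits e (fun i => Z (e (.inl i))) (fun i => Z (e (.inr i))) = Z :=
  ((joinBits_eq_iff e).2 ⟨fun _ => rfl, fun _ => rfl⟩).symm

/-- The component of a state in which the wires outside the first `k` carry `a`. -/
def sliceAt (Ψ : QState W) (a : A → Bool) : QState k := fun z => Ψ (joinBits e z a)

/-- The inclusion of the first `k` wires. -/
def leftWires : Fin k ↪ Fin W := (Function.Embedding.inl).trans e.toEmbedding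

theorem update_joinBits (z : Bits k) (a : A → Bool) (i : Fin k) (b : Bool) :
    Function.update (joinBits e z a) (e (.inl i)) b = joinBits e (Function.update z i b) a := by
  rw [joinBits_eq_iff]
  constructor
  · intro j
    by_cases h : j = i
    · subst h; simp
    · rw [Function.update_of_ne (by simpa using h), Function.update_of_ne h, joinBits_inl]
  · intro j
    rw [Function.update_of_ne (by simp), joinBits_inr]

theorem sliceAt_map_apply (g : QGate k) (Ψ : QState W) (a : A → Bool) :
    sliceAt e ((g.map (leftWires e)).apply Ψ) a = g.apply (sliceAt e Ψ a) := by
  have hl : ∀ i, leftWires e i = e (.inl i) := fun i => rfl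
  cases g <;> funext z <;>
    simp only [sliceAt, QGate.map, QGate.apply, hl, joinBits_inl, update_joinBits]

theorem sum_joinBits [Fintype A] [DecidableEq A] (F : Bits W → ℝ) :
    ∑ Z, F Z = ∑ z, ∑ a, F (joinBits e z a) := by
  rw [← Fintype.sum_prod_type' (f := fun z a => F (joinBits e z a))]
  refine (Equiv.sum_comp ⟨fun p => joinBits e p.1 p.2,
    fun Z => (fun i => Z (e (.inl i)), fun i => Z (e (.inr i))), fun p => ?_, fun Z => ?_⟩ F).symm
  · simp
  · exact joinBits_self e Z

end

/-- The number of signing queries of a forger. -/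
def signCount {msg ran dom k : ℕ} : List (QOp (forgerSpec msg ran dom) k) → ℕ
  | [] => 0
  | .gate _ :: ops => signCount ops
  | .query .hash _ :: ops => signCount ops
  | .query .sign _ :: ops => signCount ops + 1

theorem signCount_le_length {msg ran dom k : ℕ} (ops : List (QOp (forgerSpec msg ran dom) k)) :
    signCount ops ≤ ops.length := by
  induction ops with
  | nil => exact le_rfl
  | cons op ops ih =>
    rcases op with g | ⟨_ | _, w⟩ <;> simp only [signCount, List.length_cons] <;> omega

/-- The transcript of the signing queries `g 0, g 1, …`. -/
def signTranscript (msg ran dom : ℕ) :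
    ∀ {t : ℕ}, (Fin t → Bits msg) → (forgerSpec msg ran dom).Transcript
  | 0, _ => []
  | _ + 1, g => ⟨ForgerOracle.sign, g (Fin.last _)⟩ :: signTranscript msg ran dom (Fin.init g)

theorem mem_signTranscript {msg ran dom t : ℕ} (g : Fin t → Bits msg) (m : Bits msg) :
    (⟨ForgerOracle.sign, m⟩ : Σ _ : ForgerOracle, Bits msg) ∈ signTranscript msg ran dom g ↔
      ∃ i, g i = m := by
  induction t with
  | zero => exact iff_of_false List.not_mem_nil (by simp)
  | succ t ih =>
    have h : (⟨ForgerOracle.sign, m⟩ : Σ _ : ForgerOracle, Bits msg) ∈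
        signTranscript msg ran dom g ↔ m = g (Fin.last _) ∨
        (⟨ForgerOracle.sign, m⟩ : Σ _ : ForgerOracle, Bits msg) ∈
          signTranscript msg ran dom (Fin.init g) := by
      refine (List.mem_cons (l := signTranscript msg ran dom (Fin.init g))).trans ?_
      refine or_congr_left ⟨fun h => ?_, fun h => by rw [h]; rfl⟩
      exact eq_of_heq (Sigma.mk.inj h).2
    rw [h, ih, Fin.exists_fin_succ', or_comm, eq_comm]
    rfl

/-- The additional wires of a simulator: scratch for the evaluation of classical circuits, the
simulator's input, a record of message and coins for each signing query, and the output. -/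
abbrev SimWires (s u q msg coins b : ℕ) : Type :=
  Fin s ⊕ Fin u ⊕ (Fin q × (Fin msg ⊕ Fin coins)) ⊕ Fin b

section
variable {s ul q msg coins b : ℕ}

/-- The contents of the additional wires after the signing queries `g`. -/
def simRecord (u : Bits ul) (coin : Bits msg → Bits coins) {t : ℕ} (g : Fin t → Bits msg) :
    SimWires s ul q msg coins b → Bool :=
  Sum.elim (fun _ => false) (Sum.elim u (Sum.elim (fun p =>
    if h : p.1.1 < t then Sum.elim (g ⟨p.1.1, h⟩) (coin (g ⟨p.1.1, h⟩)) p.2 else false)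
    fun _ => false))

/-- Adding the message `m` and its coins to the record number `t`. -/
def toggleRecord (coin : Bits msg → Bits coins) (t : ℕ) (m : Bits msg)
    (a : SimWires s ul q msg coins b → Bool) : SimWires s ul q msg coins b → Bool
  | .inr (.inr (.inl p)) => Bool.xor (a (.inr (.inr (.inl p))))
      (if p.1.1 = t then Sum.elim m (coin m) p.2 else false)
  | x => a x

theorem toggleRecord_involutive (coin : Bits msg → Bits coins) (t : ℕ) (m : Bits msg) :
    Function.Involutive (toggleRecord (s := s) (ul := ul) (q := q) (b := b) coin t m) := by
  intro a
  funext x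
  rcases x with x | x | x | x <;> simp [toggleRecord]

theorem toggleRecord_simRecord (u : Bits ul) (coin : Bits msg → Bits coins) {t : ℕ}
    (g : Fin t → Bits msg) (m : Bits msg) :
    toggleRecord coin t m (simRecord (s := s) (q := q) (b := b) u coin g) =
      simRecord u coin (Fin.snoc g m : Fin (t + 1) → Bits msg) := by
  funext x
  rcases x with x | x | ⟨i, x⟩ | x
  · rfl
  · rfl
  · simp only [toggleRecord, simRecord, Sum.elim_inr, Sum.elim_inl]
    rcases lt_trichotomy i.1 t with h | h | h
    · simp [h, h.ne, h.trans (Nat.lt_succ_self t), Fin.snoc]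
    · simp [h, Fin.snoc]
    · simp [h.ne', not_lt.2 h.le, not_lt.2 (Nat.succ_le_of_lt h)]
  · rfl

theorem simRecord_injective (u : Bits ul) (coin : Bits msg → Bits coins) :
    Function.Injective (simRecord (s := s) (q := q) (b := b) u coin (t := q)) := by
  intro g g' h
  funext i j
  have := congrFun h (.inr (.inr (.inl (i, .inl j))))
  simpa [simRecord] using this

/-- A record with exactly `t` messages is reached only by toggling the same message twice. -/
theorem eq_of_toggleRecord_eq {u : Bits ul} {coin : Bits msg → Bits coins} {t : ℕ} (ht : t < q)
    {g g' : Fin t → Bits msg} {m m' : Bits msg}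
    (h : toggleRecord coin t m (toggleRecord coin t m'
      (simRecord (s := s) (q := q) (b := b) u coin g)) = simRecord u coin g') : m = m' := by
  funext j
  have := congrFun h (.inr (.inr (.inl (⟨t, ht⟩, .inl j))))
  simp [simRecord, toggleRecord] at this
  exact this.symm

variable {k W : ℕ} (e : Fin k ⊕ SimWires s ul q msg coins b ≃ Fin W)

/-- In the state `Ψ` the additional wires carry the records of some `t` signing queries. -/
def IsRecorded (u : Bits ul) (coin : Bits msg → Bits coins) (t : ℕ) (Ψ : QState W) : Prop :=
  ∀ a, (∀ g : Fin t → Bits msg, a ≠ simRecord u coin g) → sliceAt e Ψ a = 0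

variable {e}

/-- Between the simulated steps the scratch wires carry `0`. -/
theorem IsRecorded.scratch {u : Bits ul} {coin : Bits msg → Bits coins} {t : ℕ} {Ψ : QState W}
    (h : IsRecorded e u coin t Ψ) {Z : Bits W} (hZ : Ψ Z ≠ 0) (i : Fin s) :
    Z (e (.inr (.inl i))) = false := by
  by_contra hne
  refine hZ ?_
  have := congrFun (h (fun x => Z (e (.inr x))) fun g hg => hne ?_) (fun x => Z (e (.inl x)))
  · simpa only [sliceAt, joinBits_self, Pi.zero_apply] using this
  · exact congrFun hg (.inl i)

end

/-! ### The basis maps of simulated queries -/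

section
variable {s ul q msg coins b k W ran dom : ℕ} (e : Fin k ⊕ SimWires s ul q msg coins b ≃ Fin W)

/-- The scratch wires of a simulator. -/
def scratchWires : Fin s ↪ Fin W := (Function.Embedding.inl.trans Function.Embedding.inr).trans
  e.toEmbedding

/-- The output wires of a simulator. -/
def outWires (j : Fin b) : Fin W := e (.inr (.inr (.inr (.inr j))))

/-- The wires of a hash query of the forger, together with the simulator's input. -/
def hashWires {n : ℕ} (w : Fin msg ⊕ Fin n ↪ Fin k) : (Fin ul ⊕ Fin msg) ⊕ Fin n ↪ Fin W where
  toFun := Sum.elim (Sum.elim (fun i => e (.inr (.inr (.inl i)))) (fun i => e (.inl (w (.inl i)))))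
    (fun j => e (.inl (w (.inr j))))
  inj' := by rintro ((i | i) | i) ((j | j) | j) h <;> simp_all

/-- The wires for looking up the coins of the signing query number `t`. -/
def coinWires {n : ℕ} (w : Fin msg ⊕ Fin n ↪ Fin k) (t : Fin q) : Fin msg ⊕ Fin coins ↪ Fin W where
  toFun := Sum.elim (fun i => e (.inl (w (.inl i))))
    (fun j => e (.inr (.inr (.inr (.inl (t, .inr j))))))
  inj' := by rintro (i | i) (j | j) h <;> simp_all

/-- The wires for answering the signing query number `t` and recording its message. -/
def signWires {n : ℕ} (w : Fin msg ⊕ Fin n ↪ Fin k) (t : Fin q) :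
    (Fin ul ⊕ Fin msg ⊕ Fin coins) ⊕ (Fin n ⊕ Fin msg) ↪ Fin W where
  toFun := Sum.elim (Sum.elim (fun i => e (.inr (.inr (.inl i))))
      (Sum.elim (fun i => e (.inl (w (.inl i))))
        (fun j => e (.inr (.inr (.inr (.inl (t, .inr j))))))))
    (Sum.elim (fun j => e (.inl (w (.inr j)))) (fun j => e (.inr (.inr (.inr (.inl (t, .inl j)))))))
  inj' := by
    rintro ((i | i | i) | i | i) ((j | j | j) | j | j) h <;> simp_all

/-- The wires for computing the output of a simulator. -/
def finWires : (Fin ul ⊕ Fin k ⊕ (Fin q × Fin msg)) ⊕ Fin b ↪ Fin W where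
  toFun := Sum.elim (Sum.elim (fun i => e (.inr (.inr (.inl i)))) (Sum.elim (fun i => e (.inl i))
    (fun p => e (.inr (.inr (.inr (.inl (p.1, .inl p.2))))))))
    (fun j => e (.inr (.inr (.inr (.inr j)))))
  inj' := by
    rintro ((i | i | ⟨i, i'⟩) | i) ((j | j | ⟨j, j'⟩) | j) h <;> simp_all

section
variable {n : ℕ} (w : Fin msg ⊕ Fin n ↪ Fin k) (t : Fin q)

@[simp] theorem hashWires_inl_inl (i : Fin ul) :
    hashWires (ul := ul) e w (.inl (.inl i)) = e (.inr (.inr (.inl i))) := rfl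

@[simp] theorem hashWires_inl_inr (i : Fin msg) :
    hashWires (ul := ul) e w (.inl (.inr i)) = e (.inl (w (.inl i))) := rfl

@[simp] theorem hashWires_inr (i : Fin n) :
    hashWires (ul := ul) e w (.inr i) = e (.inl (w (.inr i))) := rfl

@[simp] theorem coinWires_inl (i : Fin msg) :
    coinWires e w t (.inl i) = e (.inl (w (.inl i))) := rfl

@[simp] theorem coinWires_inr (i : Fin coins) :
    coinWires e w t (.inr i) = e (.inr (.inr (.inr (.inl (t, .inr i))))) := rfl

@[simp] theorem signWires_inl_inl (i : Fin ul) :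
    signWires e w t (.inl (.inl i)) = e (.inr (.inr (.inl i))) := rfl

@[simp] theorem signWires_inl_inr_inl (i : Fin msg) :
    signWires e w t (.inl (.inr (.inl i))) = e (.inl (w (.inl i))) := rfl

@[simp] theorem signWires_inl_inr_inr (i : Fin coins) :
    signWires e w t (.inl (.inr (.inr i))) = e (.inr (.inr (.inr (.inl (t, .inr i))))) := rfl

@[simp] theorem signWires_inr_inl (i : Fin n) :
    signWires e w t (.inr (.inl i)) = e (.inl (w (.inr i))) := rfl

@[simp] theorem signWires_inr_inr (i : Fin msg) :
    signWires e w t (.inr (.inr i)) = e (.inr (.inr (.inr (.inl (t, .inl i))))) := rfl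

@[simp] theorem finWires_inl_inl (i : Fin ul) :
    finWires e (.inl (.inl i)) = e (.inr (.inr (.inl i))) := rfl

@[simp] theorem finWires_inl_inr_inl (i : Fin k) :
    finWires e (.inl (.inr (.inl i))) = e (.inl i) := rfl

@[simp] theorem finWires_inl_inr_inr (p : Fin q × Fin msg) :
    finWires e (.inl (.inr (.inr p))) = e (.inr (.inr (.inr (.inl (p.1, .inl p.2))))) := rfl

@[simp] theorem finWires_inr (i : Fin b) :
    finWires e (.inr i) = e (.inr (.inr (.inr (.inr i)))) := rfl

end

/-- On the first `k` wires, computing the hash is the query of the forger. -/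
theorem xorFn_hashWires {n : ℕ} (w : Fin msg ⊕ Fin n ↪ Fin k) (f : Bits ul → Bits msg → Bits n)
    (z : Bits k) (a : SimWires s ul q msg coins b → Bool) :
    xorFn (fun x => f (fun i => x (.inl i)) (fun i => x (.inr i))) (hashWires e w)
      (joinBits e z a) = joinBits e (xorQuery (f fun i => a (.inr (.inl i))) w z) a := by
  rw [joinBits_eq_iff]
  constructor
  · intro i
    rw [xorQuery_eq_xorFn]
    by_cases h : ∃ j, w (.inr j) = i
    · obtain ⟨j, rfl⟩ := h
      rw [xorFn_inr]
      refine (xorFn_inr _ (hashWires e w) _ j).trans ?_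
      simp
    · push Not at h
      rw [xorFn_of_ne _ _ _ h, xorFn_of_ne _ _ _ fun j => ?_, joinBits_inl]
      simpa using h j
  · intro i
    rw [xorFn_of_ne _ _ _ fun j => ?_, joinBits_inr]
    simp

/-- The signature is computed from the recorded coins, the message is copied, and the coins are added
to the record. A state is composed with the inverse of each basis map, so the map that is applied
last acts first on basis states; here the coins are those found after both steps. -/
theorem xorFn_signWires {n : ℕ} (w : Fin msg ⊕ Fin n ↪ Fin k) (t : Fin q)
    (coin : Bits msg → Bits coins) (f : Bits ul → Bits msg → Bits coins → Bits n)
    (z : Bits k) (a : SimWires s ul q msg coins b → Bool) :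
    xorFn coin (coinWires e w t)
      (xorFn (fun x => Sum.elim (f (fun i => x (.inl i)) (fun i => x (.inr (.inl i)))
        (fun i => x (.inr (.inr i)))) (fun i => x (.inr (.inl i)))) (signWires e w t)
      (joinBits e z a)) =
    joinBits e (xorQuery (fun m => f (fun i => a (.inr (.inl i))) m
        (fun j => a (.inr (.inr (.inl (t, .inr j)))))) w z)
      (toggleRecord coin t (fun i => z (w (.inl i))) a) := by
  set F : (Fin ul ⊕ Fin msg ⊕ Fin coins → Bool) → Fin n ⊕ Fin msg → Bool :=
    fun x => Sum.elim (f (fun i => x (.inl i)) (fun i => x (.inr (.inl i)))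
        (fun i => x (.inr (.inr i)))) (fun i => x (.inr (.inl i)))
  set Z := xorFn F (signWires e w t) (joinBits e z a) with hZ
  have hm : ∀ i, Z (e (.inl (w (.inl i)))) = z (w (.inl i)) := by
    intro i
    rw [hZ, xorFn_of_ne _ _ _ fun j => ?_, joinBits_inl]
    rcases j with j | j <;> simp
  rw [joinBits_eq_iff]
  constructor
  · intro i
    rw [xorFn_of_ne _ _ _ fun j => by simp, xorQuery_eq_xorFn]
    by_cases h : ∃ j, w (.inr j) = i
    · obtain ⟨j, rfl⟩ := h
      rw [xorFn_inr]
      refine (xorFn_inr _ (signWires e w t) _ (.inl j)).trans ?_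
      simp [F]
    · push Not at h
      rw [xorFn_of_ne _ _ _ h, hZ, xorFn_of_ne _ _ _ fun j => ?_, joinBits_inl]
      rcases j with j | j
      · simpa using h j
      · simp
  · rintro (i | i | ⟨i, i' | i'⟩ | i)
    · rw [xorFn_of_ne _ _ _ fun j => by simp, hZ, xorFn_of_ne _ _ _ fun j => ?_,
        joinBits_inr]
      · rfl
      · rcases j with j | j <;> simp
    · rw [xorFn_of_ne _ _ _ fun j => by simp, hZ, xorFn_of_ne _ _ _ fun j => ?_,
        joinBits_inr]
      · rfl
      · rcases j with j | j <;> simp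
    · rw [xorFn_of_ne _ _ _ fun j => by simp]
      by_cases hi : i = t
      · subst hi
        refine (xorFn_inr _ (signWires e w i) _ (.inr i')).trans ?_
        simp [F, toggleRecord]
      · rw [hZ, xorFn_of_ne _ _ _ fun j => ?_, joinBits_inr]
        · simp [toggleRecord, Fin.val_ne_of_ne hi]
        · rcases j with j | j <;> simp [Ne.symm hi]
    · have h1 : Z (e (.inr (.inr (.inr (.inl (i, .inr i')))))) =
          a (.inr (.inr (.inl (i, .inr i')))) := by
        rw [hZ, xorFn_of_ne _ _ _ fun j => ?_, joinBits_inr]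
        rcases j with j | j <;> simp
      by_cases hi : i = t
      · subst hi
        refine (xorFn_inr _ (coinWires e w i) _ i').trans ?_
        change Bool.xor (Z (e (.inr (.inr (.inr (.inl (i, .inr i')))))))
          (coin (fun j => Z (e (.inl (w (.inl j))))) i') = _
        simp [h1, hm, toggleRecord]
      · rw [xorFn_of_ne _ _ _ fun j => ?_, h1]
        · simp [toggleRecord, Fin.val_ne_of_ne hi]
        · simp [Ne.symm hi]
    · rw [xorFn_of_ne _ _ _ fun j => by simp, hZ, xorFn_of_ne _ _ _ fun j => ?_,
        joinBits_inr]
      · rfl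
      · rcases j with j | j <;> simp

variable {e}

theorem IsRecorded.gate {u : Bits ul} {coin : Bits msg → Bits coins} {t : ℕ} {Ψ : QState W}
    (h : IsRecorded e u coin t Ψ) (g : QGate k) :
    IsRecorded e u coin t ((g.map (leftWires e)).apply Ψ) := by
  intro a ha
  rw [sliceAt_map_apply, h a ha, QGate.apply_zero]

theorem sliceAt_hash {n : ℕ} (w : Fin msg ⊕ Fin n ↪ Fin k) (f : Bits ul → Bits msg → Bits n)
    (Ψ : QState W) (a : SimWires s ul q msg coins b → Bool) :
    sliceAt e (fun Z => Ψ (xorFn (fun x => f (fun i => x (.inl i)) (fun i => x (.inr i)))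
      (hashWires e w) Z)) a = queryApply (f fun i => a (.inr (.inl i))) w (sliceAt e Ψ a) := by
  funext z
  simp only [sliceAt, queryApply, xorFn_hashWires]

/-- The effect of answering a signing query and recording its message and its coins. -/
theorem IsRecorded.sign {u : Bits ul} {coin : Bits msg → Bits coins} {t : Fin q} {Ψ : QState W}
    (h : IsRecorded e u coin t.1 Ψ) {n : ℕ} (w : Fin msg ⊕ Fin n ↪ Fin k)
    (f : Bits ul → Bits msg → Bits coins → Bits n) {Ψ' : QState W}
    (hΨ' : Ψ' = fun Z => Ψ (xorFn coin (coinWires e w t)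
      (xorFn (fun x => Sum.elim (f (fun i => x (.inl i)) (fun i => x (.inr (.inl i)))
        (fun i => x (.inr (.inr i)))) (fun i => x (.inr (.inl i)))) (signWires e w t) Z))) :
    IsRecorded e u coin (t.1 + 1) Ψ' ∧ ∀ (g : Fin t.1 → Bits msg) (m : Bits msg),
      sliceAt e Ψ' (simRecord u coin (Fin.snoc g m : Fin (t.1 + 1) → Bits msg)) =
        queryApply (fun m => f u m (coin m)) w
          (projectQuery w m (sliceAt e Ψ (simRecord u coin g))) := by
  have hslice : ∀ a z, sliceAt e Ψ' a z = sliceAt e Ψ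
      (toggleRecord coin t (fun i => z (w (.inl i))) a)
      (xorQuery (fun m => f (fun i => a (.inr (.inl i))) m
        (fun j => a (.inr (.inr (.inl (t, .inr j)))))) w z) := by
    intro a z
    rw [hΨ']
    simp only [sliceAt, xorFn_signWires]
  constructor
  · intro a ha
    funext z
    rw [hslice, h _ fun g hg => ha (Fin.snoc g fun i => z (w (.inl i))) ?_]
    · rfl
    · rw [← toggleRecord_simRecord, ← hg, toggleRecord_involutive]
  · intro g m
    funext z
    rw [hslice, ← toggleRecord_simRecord]
    simp only [queryApply, projectQuery, xorQuery_inl]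
    split_ifs with hm
    · rw [hm, toggleRecord_involutive]
      congr 1
      refine xorQuery_congr w z ?_
      rw [hm]
      congr 1
      funext j
      simp [toggleRecord, simRecord]
    · rw [h _ fun g' hg' => hm (eq_of_toggleRecord_eq t.2 hg')]
      rfl

end

/-! ### The simulation -/

/-- With the oracles `O'`, a state on `W` wires can be replaced by its image under the basis map
`|m, y⟩ ↦ |m, y ⊕ coin m⟩` using at most `B` steps and `s` scratch qubits, for all admissible pairs
of `O'` and `coin`. The register of `m` may or may not be measured. -/
def CoinAccess (𝒪' : OracleSpec) (msg coins s B : ℕ)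
    (Adm : 𝒪'.Impl → (Bits msg → Bits coins) → Prop) : Prop :=
  ∀ (W : ℕ) (sc : Fin s ↪ Fin W) (cw : Fin msg ⊕ Fin coins ↪ Fin W), (∀ i x, sc i ≠ cw x) →
    ∃ L : List (QOp 𝒪' W), L.length ≤ B ∧
      ∀ O' coin, Adm O' coin → ∀ (E : Bits W → Prop) rest tr (Ψ : QState W),
        (∀ z, Ψ z ≠ 0 → ∀ i, z (sc i) = false) →
        runProb O' (fun _ Z => E Z) (L ++ rest) tr Ψ =
            runProb O' (fun _ Z => E Z) rest tr (fun Z => Ψ (xorFn coin cw Z)) ∨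
          ∃ trf : Bits msg → 𝒪'.Transcript, runProb O' (fun _ Z => E Z) (L ++ rest) tr Ψ =
            ∑ m, runProb O' (fun _ Z => E Z) rest (trf m)
              (fun Z => if (fun i => Z (cw (.inl i))) = m then Ψ (xorFn coin cw Z) else 0)

/-- Coins from an oracle with classical access. -/
theorem coinAccess_single (msg coins s : ℕ) :
    CoinAccess (OracleSpec.single msg coins true) msg coins s 1 (fun O' coin => O' = fun _ => coin) := by
  intro W sc cw _
  refine ⟨[.query () cw], le_rfl, ?_⟩
  rintro _ coin rfl E rest tr Ψ _
  right
  refine ⟨fun m => ⟨(), m⟩ :: tr, ?_⟩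
  change ∑ m : Bits msg, runProb _ _ rest _ (queryApply coin cw (projectQuery cw m Ψ)) = _
  refine Finset.sum_congr rfl fun m _ => ?_
  congr 1
  funext Z
  simp only [queryApply, projectQuery, xorQuery_inl]
  rw [xorQuery_eq_xorFn]

/-- Coins from a fixed function with a small circuit. -/
theorem coinAccess_none {msg coins s : ℕ} {c : Bits msg → Bits coins} (hc : Comp s c) :
    CoinAccess OracleSpec.none msg coins s (82 * s + coins) (fun _ coin => coin = c) := by
  intro W sc cw h
  obtain ⟨G, hG, hG'⟩ := hc.exists_gates cw sc h
  refine ⟨G.map QOp.gate, by simpa using hG, ?_⟩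
  rintro O' _ rfl E rest tr Ψ hΨ
  left
  rw [runProb_gates_append, hG' _ hΨ]

section
variable {s ul q msg coins b k W ran dom : ℕ} {e : Fin k ⊕ SimWires s ul q msg coins b ≃ Fin W}

/-- Restricting a state to a value of some of the first `k` wires. -/
theorem IsRecorded.restrict {u : Bits ul} {coin : Bits msg → Bits coins} {t : ℕ} {Ψ : QState W}
    (h : IsRecorded e u coin t Ψ) (p : Bits W → Prop) [DecidablePred p] :
    IsRecorded e u coin t (fun Z => if p Z then Ψ Z else 0) := by
  intro a ha
  funext z
  have := congrFun (h a ha) z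
  simp only [sliceAt, Pi.zero_apply] at this ⊢
  rw [this, ite_self]

/-- After the last step of the forger, the output is computed from the measured qubits and the record.
States with different records do not interfere, so the probability is a sum over records. -/
theorem runProb_output {𝒪' : OracleSpec} {O' : 𝒪'.Impl} {tr' : 𝒪'.Transcript}
    {u : Bits ul} {coin : Bits msg → Bits coins} {Ψ : QState W} (h : IsRecorded e u coin q Ψ)
    (fin : Bits ul → Bits k → (Fin q × Fin msg → Bool) → Bits b) (Eout : Bits b → Prop)
    {E : (forgerSpec msg ran dom).Transcript → Bits k → Prop} (O : (forgerSpec msg ran dom).Impl)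
    (hE : ∀ (g : Fin q → Bits msg) z,
      Eout (fin u z fun p => g p.1 p.2) ↔ E (signTranscript msg ran dom g) z) :
    runProb O' (fun _ Z => Eout fun j => Z (outWires e j)) [] tr'
      (fun Z => Ψ (xorFn (fun x => fin (fun i => x (.inl i)) (fun i => x (.inr (.inl i)))
        (fun p => x (.inr (.inr p)))) (finWires e) Z)) =
    ∑ g : Fin q → Bits msg, runProb O E [] (signTranscript msg ran dom g)
      (sliceAt e Ψ (simRecord u coin g)) := by
  classical
  set F : (Fin ul ⊕ Fin k ⊕ (Fin q × Fin msg) → Bool) → Fin b → Bool :=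
    fun x => fin (fun i => x (.inl i)) (fun i => x (.inr (.inl i))) (fun p => x (.inr (.inr p)))
  simp only [runProb]
  rw [← Equiv.sum_comp (xorFn_involutive F (finWires e)).toPerm, sum_joinBits e, Finset.sum_comm]
  simp only [Function.Involutive.coe_toPerm, xorFn_involutive F (finWires e) _]
  symm
  refine Finset.sum_of_injOn (simRecord u coin) (simRecord_injective u coin).injOn
    (fun _ _ => by simp) ?_ ?_
  · intro a _ ha
    have := h a fun g hg => ha ⟨g, by simp, hg.symm⟩
    refine Finset.sum_eq_zero fun z _ => ?_
    have hz : Ψ (joinBits e z a) = 0 := congrFun this z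
    simp [hz]
  · intro g _
    refine Finset.sum_congr rfl fun z _ => ?_
    have : (fun j => xorFn F (finWires e) (joinBits e z (simRecord u coin g)) (outWires e j)) =
        fin u z fun p => g p.1 p.2 := by
      funext j
      refine (xorFn_inr F (finWires e) _ j).trans ?_
      simp [F, simRecord]
    rw [this]
    simp only [hE, sliceAt]

/-- The steps of a forger are simulated one by one: the amplitudes of the branch with the signing
queries `g` are found in the component with the record of `g`. -/
theorem exists_simulation {𝒪' : OracleSpec} {B : ℕ}
    {Adm : 𝒪'.Impl → (Bits msg → Bits coins) → Prop}
    (hC : CoinAccess 𝒪' msg coins s B Adm)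
    {hash : Bits ul → Bits msg → Bits ran} {inv : Bits ul → Bits msg → Bits coins → Bits dom}
    {fin : Bits ul → Bits k → (Fin q × Fin msg → Bool) → Bits b}
    (hhash : Comp s fun x : Fin ul ⊕ Fin msg → Bool =>
      hash (fun i => x (.inl i)) (fun i => x (.inr i)))
    (hinv : Comp s fun x : Fin ul ⊕ Fin msg ⊕ Fin coins → Bool =>
      inv (fun i => x (.inl i)) (fun i => x (.inr (.inl i))) (fun i => x (.inr (.inr i))))
    (hfin : Comp s fun x : Fin ul ⊕ Fin k ⊕ (Fin q × Fin msg) → Bool =>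
      fin (fun i => x (.inl i)) (fun i => x (.inr (.inl i))) (fun p => x (.inr (.inr p))))
    (e : Fin k ⊕ SimWires s ul q msg coins b ≃ Fin W)
    (ops : List (QOp (forgerSpec msg ran dom) k)) {t : ℕ} (ht : t + signCount ops = q) :
    ∃ L : List (QOp 𝒪' W), L.length ≤ (ops.length + 1) * (B + 82 * s + ran + dom + msg + b + 1) ∧
      ∀ O' coin, Adm O' coin → ∀ u tr' (Ψ : QState W), IsRecorded e u coin t Ψ →
      ∀ (E : (forgerSpec msg ran dom).Transcript → Bits k → Prop) (Eout : Bits b → Prop),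
      (∀ (g : Fin q → Bits msg) z,
        Eout (fin u z fun p => g p.1 p.2) ↔ E (signTranscript msg ran dom g) z) →
      runProb O' (fun _ Z => Eout fun j => Z (outWires e j)) L tr' Ψ =
        ∑ g : Fin t → Bits msg, runProb (forgerImpl (hash u) fun m => inv u m (coin m)) E ops
          (signTranscript msg ran dom g) (sliceAt e Ψ (simRecord u coin g)) := by
  induction ops generalizing t with
  | nil =>
    obtain rfl : t = q := by simpa [signCount] using ht
    obtain ⟨G, hG, hG'⟩ := hfin.exists_gates (finWires e) (scratchWires e) (by
      rintro i ((j | j | j) | j) <;> simp [scratchWires])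
    refine ⟨G.map QOp.gate ++ [], by simp at hG ⊢; omega, ?_⟩
    intro O' coin _ u tr' Ψ hΨ E Eout hE
    rw [runProb_gates_append, hG' Ψ fun Z hZ i => hΨ.scratch hZ i]
    exact runProb_output hΨ fin Eout _ hE
  | cons op ops ih =>
    rcases op with g | ⟨_ | _, w⟩
    · obtain ⟨L, hL, hL'⟩ := ih ht
      refine ⟨.gate (g.map (leftWires e)) :: L, ?_, ?_⟩
      · simp only [List.length_cons]
        rw [Nat.succ_mul]; omega
      · intro O' coin hO u tr' Ψ hΨ E Eout hE
        refine (hL' O' coin hO u tr' _ (hΨ.gate g) E Eout hE).trans ?_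
        refine Finset.sum_congr rfl fun g' _ => ?_
        rw [sliceAt_map_apply]
        rfl
    · change Fin msg ⊕ Fin ran ↪ Fin k at w
      obtain ⟨L, hL, hL'⟩ := ih ht
      obtain ⟨G, hG, hG'⟩ := hhash.exists_gates (hashWires e w) (scratchWires e) (by
        rintro i ((j | j) | j) <;> simp [scratchWires])
      refine ⟨G.map QOp.gate ++ L, ?_, ?_⟩
      · simp only [List.length_cons, List.length_append, List.length_map]
        simp only [Fintype.card_fin] at hG
        rw [Nat.succ_mul]; omega
      · intro O' coin hO u tr' Ψ hΨ E Eout hE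
        rw [runProb_gates_append, hG' Ψ fun Z hZ i => hΨ.scratch hZ i]
        refine (hL' O' coin hO u tr' _ ?_ E Eout hE).trans ?_
        · intro a ha
          rw [sliceAt_hash, hΨ a ha]
          rfl
        · refine Finset.sum_congr rfl fun g' _ => ?_
          rw [sliceAt_hash]
          rfl
    · change Fin msg ⊕ Fin dom ↪ Fin k at w
      have ht' : t + 1 + signCount ops = q := by simp only [signCount] at ht; omega
      obtain ⟨L, hL, hL'⟩ := ih ht'
      set i : Fin q := ⟨t, by omega⟩
      obtain ⟨Lc, hLc, hLc'⟩ := hC W (scratchWires e) (coinWires e w i) (by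
        rintro i (j | j) <;> simp [scratchWires])
      obtain ⟨G, hG, hG'⟩ := (hinv.elim (Comp.wires fun j => Sum.inr (Sum.inl j))).exists_gates
        (signWires e w i) (scratchWires e) (by
          rintro i ((j | j | j) | j | j) <;> simp [scratchWires])
      refine ⟨Lc ++ (G.map QOp.gate ++ L), ?_, ?_⟩
      · simp only [List.length_cons, List.length_append, List.length_map]
        simp only [Fintype.card_fin, Fintype.card_sum] at hG
        rw [Nat.succ_mul]; omega
      · intro O' coin hO u tr' Ψ hΨ E Eout hE
        -- one branch: the coins are looked up, then the signature is computed
        have key : ∀ (Φ : QState W) tr'', IsRecorded e u coin t Φ →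
            runProb O' (fun _ Z => Eout fun j => Z (outWires e j)) (G.map QOp.gate ++ L) tr''
              (fun Z => Φ (xorFn coin (coinWires e w i) Z)) =
            ∑ g : Fin t → Bits msg, ∑ m : Bits msg,
              runProb (forgerImpl (hash u) fun m => inv u m (coin m)) E ops
                (⟨ForgerOracle.sign, m⟩ :: signTranscript msg ran dom g)
                (queryApply (fun m => inv u m (coin m)) w
                  (projectQuery w m (sliceAt e Φ (simRecord u coin g)))) := by
          intro Φ tr'' hΦ
          rw [runProb_gates_append, hG' _ fun Z hZ j => ?_]
          · obtain ⟨h1, h2⟩ := IsRecorded.sign (t := i) hΦ w inv rfl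
            refine (hL' O' coin hO u tr'' _ h1 E Eout hE).trans ?_
            rw [← (Fin.snocEquiv fun _ => Bits msg).sum_comp, Fintype.sum_prod_type,
              Finset.sum_comm]
            refine Finset.sum_congr rfl fun g _ => Finset.sum_congr rfl fun m _ => ?_
            refine congrArg₂ (runProb _ E ops) ?_ (h2 g m)
            simp [Fin.snocEquiv, signTranscript, Fin.init_snoc, Fin.snoc_last]
          · have := hΦ.scratch hZ j
            rwa [xorFn_of_ne] at this
            intro x
            simp
        refine Eq.trans ?_ (Finset.sum_congr rfl fun g _ => rfl :
          ∑ g : Fin t → Bits msg, ∑ m : Bits msg,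
              runProb (forgerImpl (hash u) fun m => inv u m (coin m)) E ops
                (⟨ForgerOracle.sign, m⟩ :: signTranscript msg ran dom g)
                (queryApply (fun m => inv u m (coin m)) w
                  (projectQuery w m (sliceAt e Ψ (simRecord u coin g)))) = _)
        rcases hLc' O' coin hO (fun Z => Eout fun j => Z (outWires e j)) (G.map QOp.gate ++ L) tr' Ψ
          fun Z hZ i => hΨ.scratch hZ i with h | ⟨trf, h⟩
        · rw [h, key Ψ tr' hΨ]
        · rw [h]
          have key' : ∀ m : Bits msg,
              runProb O' (fun _ Z => Eout fun j => Z (outWires e j)) (G.map QOp.gate ++ L) (trf m)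
                (fun Z => if (fun j => Z (coinWires e w i (.inl j))) = m then
                  Ψ (xorFn coin (coinWires e w i) Z) else 0) =
              ∑ g : Fin t → Bits msg,
                runProb (forgerImpl (hash u) fun m => inv u m (coin m)) E ops
                  (⟨ForgerOracle.sign, m⟩ :: signTranscript msg ran dom g)
                  (queryApply (fun m => inv u m (coin m)) w
                    (projectQuery w m (sliceAt e Ψ (simRecord u coin g)))) := by
            intro m
            -- measuring the message twice has the same effect as measuring it once
            have h3 := key (fun Z => if (fun j => Z (coinWires e w i (.inl j))) = m then Ψ Z else 0)
              (trf m) (hΨ.restrict _)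
            simp only [xorFn_inl] at h3
            rw [h3]
            refine Finset.sum_congr rfl fun g _ => ?_
            have hs : sliceAt e (fun Z => if (fun j => Z (coinWires e w i (.inl j))) = m
                then Ψ Z else 0) (simRecord u coin g) =
                projectQuery w m (sliceAt e Ψ (simRecord u coin g)) := by
              funext z
              simp [sliceAt, projectQuery]
            rw [hs, Finset.sum_eq_single m]
            · congr 2
              funext z
              simp only [projectQuery]
              split_ifs <;> rfl
            · intro m' _ hm'
              have : projectQuery w m' (projectQuery w m (sliceAt e Ψ (simRecord u coin g))) = 0 := by
                funext z
                simp only [projectQuery]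
                split_ifs with h1 h2
                · exact absurd (h1.symm.trans h2) hm'
                · rfl
                · rfl
              rw [this]
              exact runProb_zero _ _ _ _
            · simp
          rw [Finset.sum_congr rfl fun m _ => key' m, Finset.sum_comm]

end

section
variable {s ul q msg coins b k W ran dom pkl o : ℕ}

/-- The wires for writing the forger's input. -/
def startWires (e : Fin k ⊕ SimWires s ul q msg coins b ≃ Fin W) (p : Fin pkl ↪ Fin k) :
    Fin ul ⊕ Fin pkl ↪ Fin W where
  toFun := Sum.elim (fun i => e (.inr (.inr (.inl i)))) (fun i => e (.inl (p i)))
  inj' := by rintro (i | i) (j | j) h <;> simp_all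

@[simp] theorem startWires_inl (e : Fin k ⊕ SimWires s ul q msg coins b ≃ Fin W)
    (p : Fin pkl ↪ Fin k) (i : Fin ul) : startWires e p (.inl i) = e (.inr (.inr (.inl i))) := rfl

@[simp] theorem startWires_inr (e : Fin k ⊕ SimWires s ul q msg coins b ≃ Fin W)
    (p : Fin pkl ↪ Fin k) (i : Fin pkl) :
    startWires (ul := ul) e p (.inr i) = e (.inl (p i)) := rfl

/-- The wires of the simulator's input. -/
def inputWires (e : Fin k ⊕ SimWires s ul q msg coins b ≃ Fin W) : Fin ul ↪ Fin W where
  toFun i := e (.inr (.inr (.inl i)))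
  inj' := by intro i j h; simpa using h

@[simp] theorem inputWires_apply (e : Fin k ⊕ SimWires s ul q msg coins b ≃ Fin W) (i : Fin ul) :
    inputWires e i = e (.inr (.inr (.inl i))) := rfl

/-- A forger, run with a hash oracle and a signer that are computed from an input `u` and from coins
for each message, is simulated by a circuit that has access to the coins only. -/
theorem exists_simulator {𝒪' : OracleSpec} {B : ℕ}
    {Adm : 𝒪'.Impl → (Bits msg → Bits coins) → Prop}
    (hC : CoinAccess 𝒪' msg coins s B Adm) (A : QCircuit (forgerSpec msg ran dom) pkl o)
    {hash : Bits ul → Bits msg → Bits ran} {inv : Bits ul → Bits msg → Bits coins → Bits dom}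
    {fin : Bits ul → Bits A.width → (Fin (signCount A.ops) × Fin msg → Bool) → Bits b}
    {start : Bits ul → Bits pkl}
    (hhash : Comp s fun x : Fin ul ⊕ Fin msg → Bool =>
      hash (fun i => x (.inl i)) (fun i => x (.inr i)))
    (hinv : Comp s fun x : Fin ul ⊕ Fin msg ⊕ Fin coins → Bool =>
      inv (fun i => x (.inl i)) (fun i => x (.inr (.inl i))) (fun i => x (.inr (.inr i))))
    (hfin : Comp s fun x : Fin ul ⊕ Fin A.width ⊕ (Fin (signCount A.ops) × Fin msg) → Bool =>
      fin (fun i => x (.inl i)) (fun i => x (.inr (.inl i))) (fun p => x (.inr (.inr p))))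
    (hstart : Comp s start) :
    ∃ C : QCircuit 𝒪' ul b,
      C.size ≤ (A.width + s + ul + A.ops.length * (msg + coins) + b) +
        (82 * s + pkl + (A.ops.length + 1) * (B + 82 * s + ran + dom + msg + b + 1)) ∧
      ∀ O' coin, Adm O' coin → ∀ u
        (E : (forgerSpec msg ran dom).Transcript → Bits A.width → Prop) (Eout : Bits b → Prop),
        (∀ (g : Fin (signCount A.ops) → Bits msg) z,
          Eout (fin u z fun p => g p.1 p.2) ↔ E (signTranscript msg ran dom g) z) →
        C.prob O' u (fun _ => Eout) = runProb (forgerImpl (hash u) fun m => inv u m (coin m)) E A.ops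
          [] (A.init (start u)) := by
  classical
  let e := Fintype.equivFin (Fin A.width ⊕ SimWires s ul (signCount A.ops) msg coins b)
  obtain ⟨G, hG, hG'⟩ := hstart.exists_gates (startWires e A.inp) (scratchWires e) (by
    rintro i (j | j) <;> simp [scratchWires])
  obtain ⟨L, hL, hL'⟩ := exists_simulation hC hhash hinv hfin e A.ops (t := 0) (by simp)
  refine ⟨⟨_, G.map QOp.gate ++ L, inputWires e, outWires e⟩, ?_, ?_⟩
  · refine Nat.add_le_add ?_ ?_
    · simp only [Fintype.card_sum, Fintype.card_prod, Fintype.card_fin]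
      have := Nat.mul_le_mul_right (msg + coins) (signCount_le_length A.ops)
      omega
    · simp only [List.length_append, List.length_map]
      simp only [Fintype.card_fin] at hG
      omega
  · intro O' coin hO u E Eout hE
    set Φ : QState _ := QCircuit.init ⟨_, G.map QOp.gate ++ L,
      inputWires e, outWires e⟩ u with hΦdef
    change runProb O' (fun _ Z => Eout fun j => Z (outWires e j)) (G.map QOp.gate ++ L) [] Φ = _
    have hΦ : ∀ Z, Φ Z = if Z = joinBits e (fun _ => false) (simRecord u coin Fin.elim0)
        then 1 else 0 := by
      intro Z
      simp only [hΦdef, QCircuit.init]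
      congr 2
      rw [joinBits_eq_iff]
      constructor
      · intro i
        simp
      · rintro (i | i | i | i) <;> simp [simRecord]
    have hsc : ∀ Z, Φ Z ≠ 0 → ∀ i, Z (scratchWires e i) = false := by
      intro Z hZ i
      rw [hΦ] at hZ
      split_ifs at hZ with h
      · rw [h]
        simp [scratchWires, simRecord]
      · exact absurd rfl hZ
    have hslice : ∀ a, sliceAt e (fun Z => Φ (xorFn start (startWires e A.inp) Z)) a =
        if a = simRecord u coin Fin.elim0 then A.init (start u) else 0 := by
      intro a
      funext z
      have hi : xorFn start (startWires e A.inp) (joinBits e (fun _ => false)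
          (simRecord u coin Fin.elim0)) = joinBits e
            (fun j => decide (∃ i, A.inp i = j ∧ start u i = true)) (simRecord u coin Fin.elim0) := by
        rw [joinBits_eq_iff]
        constructor
        · intro j
          by_cases h : ∃ i, A.inp i = j
          · obtain ⟨i, rfl⟩ := h
            refine (xorFn_inr start (startWires e A.inp) _ i).trans ?_
            simp [simRecord]
          · push Not at h
            rw [xorFn_of_ne _ _ _ fun i => ?_]
            · simp [h]
            · simpa using h i
        · intro j
          rw [xorFn_of_ne _ _ _ fun i => ?_, joinBits_inr]
          simp
      have hiff : xorFn start (startWires e A.inp) (joinBits e z a) =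
          joinBits e (fun _ => false) (simRecord u coin Fin.elim0) ↔
          z = (fun j => decide (∃ i, A.inp i = j ∧ start u i = true)) ∧
            a = simRecord u coin Fin.elim0 := by
        rw [(xorFn_involutive start (startWires e A.inp)).eq_iff, hi, joinBits_eq_iff]
        simp [funext_iff]
      simp only [sliceAt, hΦ, hiff]
      by_cases ha : a = simRecord u coin Fin.elim0
      · simp [ha, QCircuit.init]
      · simp [ha]
    rw [runProb_gates_append, hG' Φ hsc, hL' O' coin hO u [] _ ?_ E Eout hE]
    · rw [Fintype.sum_unique, hslice, if_pos]
      · rfl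
      · exact congrArg _ (Subsingleton.elim _ _)
    · intro a ha
      rw [hslice, if_neg (ha _)]

end

/-! ### The statistical steps for a fixed key pair -/

theorem lawOf_eq_prEq {M V : Type} {c : ℕ} [DecidableEq V] (X : M → Bits c → V) (m : M) (v : V) :
    lawOf X m v = prEq (X m) v := by
  unfold lawOf prEq
  congr 1
  funext r
  congr 1

theorem prEq_nonneg {c : ℕ} {α : Type} (X : Bits c → α) (a : α) : 0 ≤ prEq X a :=
  Finset.expect_nonneg fun _ _ => by split_ifs <;> norm_num

theorem exists_of_prEq_pos {c : ℕ} {α : Type} {X : Bits c → α} {a : α} (h : 0 < prEq X a) :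
    ∃ r, X r = a := by
  by_contra! hne
  simp [prEq, hne] at h

theorem sum_prEq {c : ℕ} {α : Type} [Fintype α] (X : Bits c → α) : ∑ a, prEq X a = 1 := by
  classical
  simp only [prEq]
  rw [← Finset.expect_sum_comm]
  refine (Finset.expect_congr rfl fun r _ => ?_).trans (Fintype.expect_const (1 : ℝ))
  rw [Finset.sum_eq_single (X r) (fun a _ ha => if_neg ha.symm) (by simp), if_pos rfl]

theorem prEq_le_prEq_comp {c : ℕ} {α β : Type} (X : Bits c → α) (g : α → β) (a : α) :
    prEq X a ≤ prEq (fun r => g (X r)) (g a) := by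
  refine Finset.expect_le_expect fun r _ => ?_
  by_cases h : X r = a
  · simp [h]
  · simp only [h, if_false]
    split_ifs <;> norm_num

/-- Also true when `y` has probability zero, where `condPr` is a division by zero. -/
theorem prEq_mul_condPr {c : ℕ} {α β : Type} (X : Bits c → α) (g : α → β) (y : β) (x : α) :
    prEq (fun r => g (X r)) y * condPr X g y x = prEq (fun r => (g (X r), X r)) (y, x) := by
  classical
  have h1 : prEq (fun r => (g (X r), X r)) (y, x) = if g x = y then prEq X x else 0 := by
    by_cases h : g x = y
    · subst h
      simp only [prEq, if_true]
      refine Finset.expect_congr rfl fun r _ => ?_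
      by_cases hr : X r = x <;> simp [hr]
    · rw [if_neg h]
      refine (Finset.expect_congr rfl fun r _ => ?_).trans (Finset.expect_const_zero _)
      rw [if_neg]
      rintro hr
      obtain ⟨h2, rfl⟩ := Prod.mk.inj hr
      exact h h2
  rw [h1, condPr]
  by_cases h0 : prEq (fun r => g (X r)) y = 0
  · rw [h0, zero_mul]
    split_ifs with h
    · subst h
      exact le_antisymm (prEq_nonneg _ _) (h0 ▸ prEq_le_prEq_comp X g x)
    · rfl
  · rw [mul_div_cancel₀ _ h0]

theorem abs_sub_le_of_eq {a b c d ε : ℝ} (h₁ : a = c) (h₂ : b = d) (h : |c - d| ≤ ε) :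
    |a - b| ≤ ε := by
  rwa [h₁, h₂]

theorem expect_arrow_prod {M A B : Type} [Fintype M] [DecidableEq M] [Fintype A] [Fintype B]
    (Φ : (M → A × B) → ℝ) :
    (𝔼 a : M → A, 𝔼 b : M → B, Φ fun m => (a m, b m)) = 𝔼 p, Φ p := by
  rw [← Fintype.expect_equiv (Equiv.arrowProdEquivProdArrow M (fun _ => A) fun _ => B).symm _ Φ
    fun _ => rfl, ← Finset.univ_product_univ, Finset.expect_product]
  rfl

section
variable {msg ran dom k sc ic : ℕ}

/-- Uniform hash values may be replaced by images of samples. -/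
theorem abs_expect_uniform_sub_le {R : Finset (Bits ran)} {g : Bits sc → Bits ran}
    (hg : ∀ c, g c ∈ R) {ε : ℝ} (hε : ∑ y ∈ R, |prEq g y - 1 / (R.card : ℝ)| ≤ ε)
    (s : Bits msg → Bits ran → Bits dom) (μ : Bits k → Bits msg)
    (E : Bits ran → (forgerSpec msg ran dom).Transcript → Bits k → Prop)
    (ops : List (QOp (forgerSpec msg ran dom) k)) {ψ : QState k} (hψ : normSq ψ = 1) :
    |(𝔼 H : Bits msg → R, runProb (forgerImpl (fun m => (H m).1) fun m => s m (H m).1)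
        (fun tr z => E (H (μ z)).1 tr z) ops [] ψ) -
      𝔼 c : Bits msg → Bits sc, runProb (forgerImpl (fun m => g (c m)) fun m => s m (g (c m)))
        (fun tr z => E (g (c (μ z))) tr z) ops [] ψ| ≤ 18 * (ops.length + 1) * Real.sqrt ε := by
  classical
  have : Nonempty R := ⟨⟨_, hg fun _ => false⟩⟩
  have h1 := expect_eq_piE_lawOf (fun (_ : Bits msg) (y : R) => y.1) (fun v =>
    runProb (valueImpl (fun _ y => y) s v) (fun tr z => E (v (μ z)) tr z) ops [] ψ)
  have h2 := expect_eq_piE_lawOf (fun (_ : Bits msg) (c : Bits sc) => g c) (fun v =>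
    runProb (valueImpl (fun _ y => y) s v) (fun tr z => E (v (μ z)) tr z) ops [] ψ)
  refine abs_sub_le_of_eq h1 h2 ?_
  refine abs_piE_sub_le (isLaw_lawOf _) (isLaw_lawOf _) (fun m => ?_) μ E ops hψ
  refine le_trans (le_of_eq ?_) hε
  rw [← Finset.sum_subset (Finset.subset_univ R)]
  · refine Finset.sum_congr rfl fun y hy => ?_
    rw [lawOf_eq_prEq, abs_sub_comm]
    congr 2
    rw [lawOf, Fintype.expect_eq_sum_div_card, Finset.sum_eq_single ⟨y, hy⟩]
    · simp
    · intro b _ hb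
      rw [if_neg]
      rintro rfl
      exact hb rfl
    · simp
  · intro y _ hy
    have h3 : lawOf (fun (_ : Bits msg) (y : R) => y.1) m y = 0 := by
      refine (Finset.expect_congr rfl fun r _ => ?_).trans (Finset.expect_const_zero _)
      rw [if_neg]
      rintro rfl
      exact hy r.2
    have h4 : lawOf (fun (_ : Bits msg) (c : Bits sc) => g c) m y = 0 := by
      refine (Finset.expect_congr rfl fun r _ => ?_).trans (Finset.expect_const_zero _)
      rw [if_neg]
      rintro rfl
      exact hy (hg r)
    rw [h3, h4, sub_zero, abs_zero]

variable {R : Finset (Bits ran)} {sample : Bits sc → Bits dom} {f : Bits dom → Bits ran}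

/-- Preimages computed with the trapdoor may be replaced by the samples themselves. -/
theorem abs_expect_preimage_sub_le {finv : Bits ran → Bits ic → Bits dom}
    (hR : ∀ c, f (sample c) ∈ R) {ε : ℝ}
    (hε : ∀ y ∈ R, 0 < prEq (fun c => f (sample c)) y →
      ∑ x, |prEq (finv y) x - condPr sample f y x| ≤ ε)
    (μ : Bits k → Bits msg) (E : Bits ran → (forgerSpec msg ran dom).Transcript → Bits k → Prop)
    (ops : List (QOp (forgerSpec msg ran dom) k)) {ψ : QState k} (hψ : normSq ψ = 1) :
    |(𝔼 O : Bits msg → Bits ic, 𝔼 c : Bits msg → Bits sc,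
        runProb (forgerImpl (fun m => f (sample (c m))) fun m => finv (f (sample (c m))) (O m))
          (fun tr z => E (f (sample (c (μ z)))) tr z) ops [] ψ) -
      𝔼 c : Bits msg → Bits sc,
        runProb (forgerImpl (fun m => f (sample (c m))) fun m => sample (c m))
          (fun tr z => E (f (sample (c (μ z)))) tr z) ops [] ψ| ≤
      18 * (ops.length + 1) * Real.sqrt ε := by
  classical
  set Θ : (Bits msg → Bits ran × Bits dom) → ℝ := fun v =>
    runProb (valueImpl (fun _ y => y.1) (fun _ y => y.2) v) (fun tr z => E (v (μ z)).1 tr z)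
      ops [] ψ
  have h1 : (𝔼 O : Bits msg → Bits ic, 𝔼 c : Bits msg → Bits sc,
      Θ fun m => (f (sample (c m)), finv (f (sample (c m))) (O m))) =
      piE (lawOf fun _ (p : Bits ic × Bits sc) => (f (sample p.2), finv (f (sample p.2)) p.1)) Θ :=
    (expect_arrow_prod fun p => Θ fun m =>
      (f (sample (p m).2), finv (f (sample (p m).2)) (p m).1)).trans
      (expect_eq_piE_lawOf (fun _ (p : Bits ic × Bits sc) => (f (sample p.2), finv (f (sample p.2)) p.1)) Θ)
  have h2 : (𝔼 c : Bits msg → Bits sc, Θ fun m => (f (sample (c m)), sample (c m))) =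
      piE (lawOf fun _ c => (f (sample c), sample c)) Θ :=
    expect_eq_piE_lawOf (fun _ c => (f (sample c), sample c)) Θ
  refine abs_sub_le_of_eq h1 h2 ?_
  refine abs_piE_sub_le (h := fun _ (y : Bits ran × Bits dom) => y.1) (s := fun _ y => y.2)
    (isLaw_lawOf _) (isLaw_lawOf _) (fun m => ?_) μ
    (fun (y : Bits ran × Bits dom) => E y.1) ops hψ
  have h3 : ∀ y x, lawOf (fun (_ : Bits msg) (p : Bits ic × Bits sc) =>
      (f (sample p.2), finv (f (sample p.2)) p.1)) m (y, x) =
      prEq (fun c => f (sample c)) y * prEq (finv y) x := by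
    intro y x
    rw [lawOf, ← Finset.univ_product_univ, Finset.expect_product, prEq, prEq, Finset.expect_mul,
      Finset.expect_comm]
    refine Finset.expect_congr rfl fun c _ => ?_
    rw [Finset.mul_expect]
    refine Finset.expect_congr rfl fun o _ => ?_
    by_cases hy : f (sample c) = y
    · subst hy
      by_cases hx : finv (f (sample c)) o = x <;> simp [hx]
    · simp [hy]
  have h4 : ∀ y x, lawOf (fun (_ : Bits msg) (c : Bits sc) => (f (sample c), sample c)) m (y, x) =
      prEq (fun c => f (sample c)) y * condPr sample f y x := by
    intro y x
    rw [lawOf_eq_prEq, prEq_mul_condPr]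
  rw [Fintype.sum_prod_type]
  simp only [h3, h4]
  calc ∑ y, ∑ x, |prEq (fun c => f (sample c)) y * prEq (finv y) x -
          prEq (fun c => f (sample c)) y * condPr sample f y x|
      = ∑ y, prEq (fun c => f (sample c)) y * ∑ x, |prEq (finv y) x - condPr sample f y x| := by
        refine Finset.sum_congr rfl fun y _ => ?_
        rw [Finset.mul_sum]
        refine Finset.sum_congr rfl fun x _ => ?_
        rw [← mul_sub, abs_mul, abs_of_nonneg (prEq_nonneg _ _)]
    _ ≤ ∑ y, prEq (fun c => f (sample c)) y * ε := by
        refine Finset.sum_le_sum fun y _ => ?_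
        rcases (prEq_nonneg (fun c => f (sample c)) y).eq_or_lt with h | h
        · rw [← h, zero_mul, zero_mul]
        · obtain ⟨c, rfl⟩ := exists_of_prEq_pos h
          exact mul_le_mul_of_nonneg_left (hε _ (hR c) h) h.le
    _ = ε := by rw [← Finset.sum_mul, sum_prEq, one_mul]

/-- When signatures are samples, an unqueried signature is hard to guess. -/
theorem expect_guess_le (hR : ∀ c, f (sample c) ∈ R) {ε : ℝ}
    (hε : ∀ y ∈ R, 0 < prEq (fun c => f (sample c)) y → ∀ x, condPr sample f y x ≤ ε)
    (μ : Bits k → Bits msg) (sg : Bits k → Bits dom)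
    (ops : List (QOp (forgerSpec msg ran dom) k)) {ψ : QState k} (hψ : normSq ψ = 1) :
    (𝔼 c : Bits msg → Bits sc,
      runProb (forgerImpl (fun m => f (sample (c m))) fun m => sample (c m))
        (fun (tr : (forgerSpec msg ran dom).Transcript) z =>
          (⟨ForgerOracle.sign, μ z⟩ : Σ _ : ForgerOracle, Bits msg) ∉ tr ∧
          sg z = sample (c (μ z))) ops [] ψ) ≤ ε := by
  classical
  have h2 := expect_eq_piE_lawOf (fun (_ : Bits msg) (c : Bits sc) =>
      (f (sample c), sample c)) (fun v =>
    runProb (valueImpl (fun _ y => y.1) (fun _ y => y.2) v)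
      (fun (tr : (forgerSpec msg ran dom).Transcript) z =>
        (⟨ForgerOracle.sign, μ z⟩ : Σ _ : ForgerOracle, Bits msg) ∉ tr ∧ sg z = (v (μ z)).2)
      ops [] ψ)
  refine h2.le.trans (piE_guess_le (isLaw_lawOf _) (fun m y x => ?_) μ sg ops hψ)
  simp only [lawOf_eq_prEq]
  have h5 : ∑ x', prEq (fun c => (f (sample c), sample c)) (y, x') =
      prEq (fun c => f (sample c)) y := by
    simp only [prEq]
    rw [← Finset.expect_sum_comm]
    refine Finset.expect_congr rfl fun c _ => ?_
    by_cases hy : f (sample c) = y <;> simp [hy]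
  rw [h5, ← prEq_mul_condPr, mul_comm]
  rcases (prEq_nonneg (fun c => f (sample c)) y).eq_or_lt with h | h
  · rw [← h, mul_zero, mul_zero]
  · obtain ⟨c, rfl⟩ := exists_of_prEq_pos h
    exact mul_le_mul_of_nonneg_right (hε _ (hR c) h x) h.le

end

section
variable {msg ran dom pkl sc ic m : ℕ}

/-- The message of the forgery, read from the measured qubits. -/
def forgedMsg (A : QCircuit (forgerSpec msg ran dom) pkl (msg + dom)) (z : Bits A.width) :
    Bits msg := fun i => z (A.out (Fin.castAdd dom i))

/-- The signature of the forgery, read from the measured qubits. -/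
def forgedSig (A : QCircuit (forgerSpec msg ran dom) pkl (msg + dom)) (z : Bits A.width) :
    Bits dom := fun i => z (A.out (Fin.natAdd msg i))

variable (A : QCircuit (forgerSpec msg ran dom) pkl (msg + dom)) (D : Finset (Bits dom))
  (pk : Bits pkl) (f : Bits dom → Bits ran) (sample : Bits sc → Bits dom)
  (finv : Bits ran → Bits ic → Bits dom)

/-- The measured forgery is a signature of a message that was not signed, whose hash value is
`y`. -/
def IsForgery (y : Bits ran) (tr : (forgerSpec msg ran dom).Transcript) (z : Bits A.width) : Prop :=
  (⟨ForgerOracle.sign, forgedMsg A z⟩ : Σ _ : ForgerOracle, Bits msg) ∉ tr ∧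
    forgedSig A z ∈ D ∧ f (forgedSig A z) = y

/-- The success probability of a forger when messages are hashed to images of samples with coins
`c`, and are signed with the trapdoor and coins `ρ`. -/
noncomputable def trapdoorWin (c : Bits msg → Bits sc) (ρ : Bits msg → Bits ic) : ℝ :=
  runProb (forgerImpl (fun m => f (sample (c m))) fun m => finv (f (sample (c m))) (ρ m))
    (fun tr z => IsForgery A D f (f (sample (c (forgedMsg A z)))) tr z) A.ops [] (A.init pk)

/-- The success probability of a forger when messages are hashed to images of samples with coins
`c`, and the samples are the signatures. -/
noncomputable def sampleWin (c : Bits msg → Bits sc) : ℝ :=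
  runProb (forgerImpl (fun m => f (sample (c m))) fun m => sample (c m))
    (fun tr z => IsForgery A D f (f (sample (c (forgedMsg A z)))) tr z) A.ops [] (A.init pk)

/-- The probability that the forged signature collides with the sample for its message. -/
noncomputable def collisionWin (c : Bits msg → Bits sc) : ℝ :=
  runProb (forgerImpl (fun m => f (sample (c m))) fun m => sample (c m))
    (fun _ z => forgedSig A z ∈ D ∧ sample (c (forgedMsg A z)) ∈ D ∧
      forgedSig A z ≠ sample (c (forgedMsg A z)) ∧
      f (forgedSig A z) = f (sample (c (forgedMsg A z)))) A.ops [] (A.init pk)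

variable {A D f sample finv}

theorem expect_trapdoorWin_polyHash (hm : m ≠ 0) (ha : msg ≤ m) (hb : sc ≤ m)
    (ρ : Bits msg → Bits ic) :
    (𝔼 κ : Fin (2 * A.ops.length + 1) → GaloisField 2 m,
      trapdoorWin A D pk f sample finv (polyHash hm hb κ) ρ) =
    𝔼 c, trapdoorWin A D pk f sample finv c ρ :=
  expect_runProb_polyHash hm ha hb (h := fun _ c => f (sample c))
    (s := fun m c => finv (f (sample c)) (ρ m)) (forgedMsg A)
    (fun c => IsForgery A D f (f (sample c))) A.ops (A.init pk)

theorem expect_collisionWin_polyHash (hm : m ≠ 0) (ha : msg ≤ m) (hb : sc ≤ m) :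
    (𝔼 κ : Fin (2 * A.ops.length + 1) → GaloisField 2 m,
      collisionWin A D pk f sample (polyHash hm hb κ)) =
    𝔼 c, collisionWin A D pk f sample c :=
  expect_runProb_polyHash hm ha hb (h := fun _ c => f (sample c))
    (s := fun _ c => sample c) (forgedMsg A)
    (fun c _ z => forgedSig A z ∈ D ∧ sample c ∈ D ∧ forgedSig A z ≠ sample c ∧
      f (forgedSig A z) = f (sample c)) A.ops (A.init pk)

variable {R : Finset (Bits ran)} (hR : ∀ c, f (sample c) ∈ R)
include hR

/-- The forgery game is close to the one in which messages are hashed to images of samples. -/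
theorem expect_game_le {ε : ℝ}
    (hε : ∑ y ∈ R, |prEq (fun c => f (sample c)) y - 1 / (R.card : ℝ)| ≤ ε)
    (ρ : Bits msg → Bits ic) :
    (𝔼 H : Bits msg → R, runProb (forgerImpl (fun m => (H m).1) fun m => finv (H m).1 (ρ m))
      (fun tr z => IsForgery A D f (H (forgedMsg A z)).1 tr z) A.ops [] (A.init pk)) ≤
    (𝔼 c, trapdoorWin A D pk f sample finv c ρ) + 18 * (A.ops.length + 1) * Real.sqrt ε := by
  have h := abs_expect_uniform_sub_le hR hε (fun m y => finv y (ρ m)) (forgedMsg A)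
    (fun y => IsForgery A D f y) A.ops (A.normSq_init pk)
  exact sub_le_iff_le_add'.1 (le_of_abs_le h)

/-- With random coins for the trapdoor, signatures may be replaced by the samples. -/
theorem expect_trapdoorWin_le {ε : ℝ}
    (hε : ∀ y ∈ R, 0 < prEq (fun c => f (sample c)) y →
      ∑ x, |prEq (finv y) x - condPr sample f y x| ≤ ε) :
    (𝔼 ρ, 𝔼 c, trapdoorWin A D pk f sample finv c ρ) ≤
      (𝔼 c, sampleWin A D pk f sample c) + 18 * (A.ops.length + 1) * Real.sqrt ε := by
  have h := abs_expect_preimage_sub_le hR hε (forgedMsg A)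
    (fun y => IsForgery A D f y) A.ops (A.normSq_init pk)
  exact sub_le_iff_le_add'.1 (le_of_abs_le h)

/-- A forgery that differs from the sample is a collision, and the sample of an unsigned message
is hard to guess. -/
theorem expect_sampleWin_le (hD : ∀ c, sample c ∈ D) {ε : ℝ}
    (hε : ∀ y ∈ R, 0 < prEq (fun c => f (sample c)) y → ∀ x, condPr sample f y x ≤ ε) :
    (𝔼 c, sampleWin A D pk f sample c) ≤ (𝔼 c, collisionWin A D pk f sample c) + ε := by
  have h := expect_guess_le (msg := msg) hR hε (forgedMsg A) (forgedSig A) A.ops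
    (A.normSq_init pk)
  refine le_trans ?_ (add_le_add_right h _)
  rw [← Finset.expect_add_distrib]
  refine Finset.expect_le_expect fun c _ => runProb_or_le _ (fun tr z => ?_) _ _ _
  rintro ⟨h1, h2, h3⟩
  by_cases hs : forgedSig A z = sample (c (forgedMsg A z))
  · exact .inr ⟨h1, hs⟩
  · exact .inl ⟨h2, hD _, hs, h3⟩

end

/-! ### The distinguisher and the collision finder -/

theorem Comp.app₂ {α β γ δ : Type} {s t u : ℕ} {F : (β → Bool) → (γ → Bool) → δ → Bool}
    {G : (α → Bool) → β → Bool} {H : (α → Bool) → γ → Bool}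
    (hF : Comp s fun x : β ⊕ γ → Bool => F (fun i => x (.inl i)) (fun i => x (.inr i)))
    (hG : Comp t G) (hH : Comp u H) : Comp (t + u + s) (fun x => F (G x) (H x)) :=
  hF.comp (hG.elim hH)

section
variable {msg ran dom pkl sc ic skl m d T : ℕ}

/-- The size of the circuit in `comp_polyHash`. -/
def hashSize (d m : ℕ) : ℕ := d * (m * (m * m * 16) + m * 6)

/-- Hash values and samples for a polynomial hash of the message. -/
theorem comp_sample_polyHash {α : Type} {t u : ℕ} {sample : Bits pkl → Bits sc → Bits dom}
    (hsample : Comp T fun x : Fin pkl ⊕ Fin sc → Bool =>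
      sample (fun i => x (.inl i)) (fun i => x (.inr i)))
    (hm : m ≠ 0) (hb : sc ≤ m) (κ : Fin d → GaloisField 2 m)
    {pk : (α → Bool) → Bits pkl} {M : (α → Bool) → Bits msg} (hpk : Comp t pk) (hM : Comp u M) :
    Comp (t + (u + hashSize d m) + T) fun x => sample (pk x) (polyHash hm hb κ (M x)) :=
  Comp.app₂ hsample hpk ((comp_polyHash hm hb κ).comp hM)

/-- The size of a simulator in `exists_simulator`, in terms of a common bound `T` for all lengths and a
bound `S` for its classical circuits. -/
theorem simulator_size_le {width ul ops b B pkl' S : ℕ} (hwidth : width ≤ T) (hul : ul ≤ T)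
    (hops : ops ≤ T) (hmsg : msg ≤ T) (hcoins : ic ≤ T) (hb : b ≤ 2 * T) (hpkl : pkl' ≤ T)
    (hran : ran ≤ T) (hdom : dom ≤ T) (hS : T + 1 ≤ S) (hB : B ≤ 82 * S + T) :
    (width + S + ul + ops * (msg + ic) + b) +
      (82 * S + pkl' + (ops + 1) * (B + 82 * S + ran + dom + msg + b + 1)) ≤
      300 * (T + 1) * S := by
  have h1 : ops * (msg + ic) ≤ T * (2 * T) := Nat.mul_le_mul hops (by omega)
  have h2 : (ops + 1) * (B + 82 * S + ran + dom + msg + b + 1) ≤ (T + 1) * (170 * S) :=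
    Nat.mul_le_mul (by omega) (by omega)
  have h3 : T * T ≤ T * S := Nat.mul_le_mul_left _ (by omega)
  nlinarith

/-- The distinguisher runs the forger with a hard-wired key pair and hash key `κ`, asks its oracle for
the coins of signatures, and checks whether the forgery is valid and its message is not in the
record. -/
theorem exists_distinguisher (A : QCircuit (forgerSpec msg ran dom) pkl (msg + dom))
    {D : Finset (Bits dom)} {f : Bits pkl → Bits dom → Bits ran}
    {sample : Bits pkl → Bits sc → Bits dom} {finv : Bits skl → Bits ran → Bits ic → Bits dom}
    (hf : Comp T fun x : Fin pkl ⊕ Fin dom → Bool => f (fun i => x (.inl i)) (fun i => x (.inr i)))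
    (hsample : Comp T fun x : Fin pkl ⊕ Fin sc → Bool =>
      sample (fun i => x (.inl i)) (fun i => x (.inr i)))
    (hfinv : Comp T fun x : (Fin skl ⊕ Fin ran) ⊕ Fin ic → Bool =>
      finv (fun i => x (.inl (.inl i))) (fun i => x (.inl (.inr i))) (fun i => x (.inr i)))
    (hD : Comp T fun (x : Bits dom) (_ : Unit) => decide (x ∈ D))
    (hmsg : msg ≤ T) (hran : ran ≤ T) (hdom : dom ≤ T) (hpkl : pkl ≤ T) (hic : ic ≤ T)
    (hA : A.size ≤ T) (hT0 : 0 < T) (pk : Bits pkl) (sk : Bits skl) (hm : m ≠ 0) (hb : sc ≤ m)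
    (κ : Fin d → GaloisField 2 m) :
    ∃ C : QCircuit (OracleSpec.single msg ic true) 0 1,
      C.size ≤ 300 * (T + 1) * (hashSize d m + 40 * (T + 1) * (T + 1)) ∧
      ∀ ρ : Bits msg → Bits ic, C.prob (fun _ => ρ) Fin.elim0 (fun _ y => y 0 = true) =
        trapdoorWin A D pk (f pk) (sample pk) (finv sk) (polyHash hm hb κ) ρ := by
  set S := hashSize d m + 40 * (T + 1) * (T + 1) with hS
  have hT : 40 * (T + 1) * (T + 1) = 40 * (T * T) + 80 * T + 40 := by ring
  have hwidth : A.width ≤ T := (Nat.le_add_right _ _).trans hA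
  have hops : A.ops.length ≤ T := (Nat.le_add_left _ _).trans hA
  have hashC : ∀ {α : Type} {u : ℕ} {M : (α → Bool) → Bits msg}, Comp u M →
      Comp (u + hashSize d m + 2 * T + 2) fun x => f pk (sample pk (polyHash hm hb κ (M x))) :=
    fun hM => (hf.app₂ (F := f) (Comp.const pk)
      (comp_sample_polyHash hsample hm hb κ (Comp.const pk) hM)).mono (by omega)
  have invC : Comp (hashSize d m + 3 * T + 3) fun x : Fin 0 ⊕ Fin msg ⊕ Fin ic → Bool =>
      finv sk (f pk (sample pk (polyHash hm hb κ fun i => x (.inr (.inl i)))))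
        (fun i => x (.inr (.inr i))) :=
    (hfinv.app₂ (F := fun y ρ => finv (fun i => y (.inl i)) (fun i => y (.inr i)) ρ)
      ((Comp.const sk).elim (hashC (Comp.wires fun i => Sum.inr (Sum.inl i))))
      (Comp.wires fun i => Sum.inr (Sum.inr i))).mono (by omega)
  have freshC : Comp _ fun (x : Fin 0 ⊕ Fin A.width ⊕ (Fin (signCount A.ops) × Fin msg) → Bool)
      (_ : Unit) => decide (∀ i, (!decide ((fun j => x (.inr (.inr (i, j)))) =
        forgedMsg A fun j => x (.inr (.inl j)))) = true) :=
    (Comp.forall fun i => ((Comp.wires fun j => Sum.inr (Sum.inr (i, j))).eq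
      (Comp.wires fun j => Sum.inr (Sum.inl (A.out (Fin.castAdd dom j))))).not).congr
      fun _ _ => decide_eq_decide.2 Iff.rfl
  have memC : Comp T fun (x : Fin 0 ⊕ Fin A.width ⊕ (Fin (signCount A.ops) × Fin msg) → Bool)
      (_ : Unit) => decide ((forgedSig A fun j => x (.inr (.inl j))) ∈ D) :=
    (hD.comp (Comp.wires fun j => Sum.inr (Sum.inl (A.out (Fin.natAdd msg j))))).mono (by omega)
  have eqC : Comp (hashSize d m + 19 * T + 10) fun
      (x : Fin 0 ⊕ Fin A.width ⊕ (Fin (signCount A.ops) × Fin msg) → Bool) (_ : Unit) =>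
      decide (f pk (forgedSig A fun j => x (.inr (.inl j))) =
        f pk (sample pk (polyHash hm hb κ (forgedMsg A fun j => x (.inr (.inl j)))))) :=
    ((hf.app₂ (F := f) (Comp.const pk)
      (Comp.wires fun j => Sum.inr (Sum.inl (A.out (Fin.natAdd msg j))))).eq
      (hashC (Comp.wires fun j => Sum.inr (Sum.inl (A.out (Fin.castAdd dom j)))))).mono (by
        rw [Fintype.card_fin]; omega)
  have finC : Comp S fun (x : Fin 0 ⊕ Fin A.width ⊕ (Fin (signCount A.ops) × Fin msg) → Bool)
      (_ : Fin 1) => (decide (∀ i, (!decide ((fun j => x (.inr (.inr (i, j)))) =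
        forgedMsg A fun j => x (.inr (.inl j)))) = true) &&
      (decide ((forgedSig A fun j => x (.inr (.inl j))) ∈ D) &&
        decide (f pk (forgedSig A fun j => x (.inr (.inl j))) =
          f pk (sample pk (polyHash hm hb κ (forgedMsg A fun j => x (.inr (.inl j)))))))) := by
    refine ((freshC.and (memC.and eqC)).reindex fun _ => ()).mono ?_
    have h1 : signCount A.ops * (16 * msg + 12) ≤ T * (16 * T + 12) :=
      Nat.mul_le_mul ((signCount_le_length _).trans hops) (by omega)
    have h2 : T * (16 * T + 12) = 16 * (T * T) + 12 * T := by ring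
    simp only [Finset.sum_const, Finset.card_univ, Fintype.card_fin, smul_eq_mul]
    have h3 : 0 + 0 + (16 * msg + 1) + 6 + 5 = 16 * msg + 12 := by omega
    rw [h3]
    omega
  obtain ⟨C, hC, hC'⟩ := exists_simulator (coinAccess_single msg ic S) A (ul := 0)
    (hash := fun _ m => f pk (sample pk (polyHash hm hb κ m)))
    (inv := fun _ m ρ => finv sk (f pk (sample pk (polyHash hm hb κ m))) ρ)
    (fin := fun _ z g _ => (decide (∀ i, (!decide ((fun j => g (i, j)) = forgedMsg A z)) = true) &&
      (decide (forgedSig A z ∈ D) && decide (f pk (forgedSig A z) =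
          f pk (sample pk (polyHash hm hb κ (forgedMsg A z)))))))
    (start := fun _ => pk)
    ((hashC (Comp.wires Sum.inr)).mono (by omega)) (invC.mono (by omega)) finC
    ((Comp.const pk).mono (by omega))
  refine ⟨C, hC.trans (simulator_size_le hwidth (Nat.zero_le _) hops hmsg hic ?_ hpkl hran hdom
    ?_ ?_), ?_⟩
  · omega
  · omega
  · omega
  · intro ρ
    refine hC' _ ρ rfl Fin.elim0 (fun tr z => IsForgery A D (f pk)
      (f pk (sample pk (polyHash hm hb κ (forgedMsg A z)))) tr z) (fun y => y 0 = true) ?_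
    intro g z
    simp [IsForgery, mem_signTranscript]

/-- The collision finder runs the forger on its public key, signs with samples whose coins are computed
by the hash function with key `κ`, and outputs the forged signature and the sample for the forged
message. -/
theorem exists_collisionFinder (A : QCircuit (forgerSpec msg ran dom) pkl (msg + dom))
    {D : Finset (Bits dom)} {f : Bits pkl → Bits dom → Bits ran}
    {sample : Bits pkl → Bits sc → Bits dom}
    (hf : Comp T fun x : Fin pkl ⊕ Fin dom → Bool => f (fun i => x (.inl i)) (fun i => x (.inr i)))
    (hsample : Comp T fun x : Fin pkl ⊕ Fin sc → Bool =>
      sample (fun i => x (.inl i)) (fun i => x (.inr i)))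
    (hmsg : msg ≤ T) (hran : ran ≤ T) (hdom : dom ≤ T) (hpkl : pkl ≤ T) (hsc : sc ≤ T)
    (hA : A.size ≤ T) (hm : m ≠ 0) (hb : sc ≤ m) (κ : Fin d → GaloisField 2 m) :
    ∃ C : QCircuit OracleSpec.none pkl (dom + dom),
      C.size ≤ 300 * (T + 1) * (hashSize d m + 40 * (T + 1) * (T + 1)) ∧
      ∀ pk, C.prob OracleSpec.noneImpl pk (fun _ z =>
          (fun i => z (Fin.castAdd _ i)) ∈ D ∧ (fun i => z (Fin.natAdd _ i)) ∈ D ∧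
          (fun i => z (Fin.castAdd _ i)) ≠ (fun i => z (Fin.natAdd dom i)) ∧
          f pk (fun i => z (Fin.castAdd _ i)) = f pk (fun i => z (Fin.natAdd _ i))) =
        collisionWin A D pk (f pk) (sample pk) (polyHash hm hb κ) := by
  set S := hashSize d m + 40 * (T + 1) * (T + 1) with hS
  have hT : 40 * (T + 1) * (T + 1) = 40 * (T * T) + 80 * T + 40 := by ring
  have hwidth : A.width ≤ T := (Nat.le_add_right _ _).trans hA
  have hops : A.ops.length ≤ T := (Nat.le_add_left _ _).trans hA
  have hashC : Comp (hashSize d m + 2 * T) fun x : Fin pkl ⊕ Fin msg → Bool =>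
      f (fun i => x (.inl i)) (sample (fun i => x (.inl i))
        (polyHash hm hb κ fun i => x (.inr i))) :=
    (hf.app₂ (F := f) (Comp.wires Sum.inl) (comp_sample_polyHash hsample hm hb κ
      (Comp.wires Sum.inl) (Comp.wires Sum.inr))).mono (by omega)
  have finC : Comp S fun (x : Fin pkl ⊕ Fin A.width ⊕ (Fin (signCount A.ops) × Fin msg) → Bool) =>
      Fin.append (forgedSig A fun j => x (.inr (.inl j))) (sample (fun i => x (.inl i))
        (polyHash hm hb κ (forgedMsg A fun j => x (.inr (.inl j))))) := by
    refine ((((Comp.wires fun j => Sum.inr (Sum.inl (A.out (Fin.natAdd msg j)))).elim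
      (comp_sample_polyHash hsample hm hb κ (Comp.wires Sum.inl) (Comp.wires fun j =>
        Sum.inr (Sum.inl (A.out (Fin.castAdd dom j)))))).reindex finSumFinEquiv.symm).mono
        (by omega)).congr fun x i => ?_
    refine Fin.addCases (fun i => ?_) (fun i => ?_) i
    · rw [Fin.append_left, finSumFinEquiv_symm_apply_castAdd]
      rfl
    · rw [Fin.append_right, finSumFinEquiv_symm_apply_natAdd]
      rfl
  obtain ⟨C, hC, hC'⟩ := exists_simulator
    (coinAccess_none (((comp_polyHash hm hb κ (a := msg)).mono (Nat.le_add_right _ _) : Comp S _))) A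
    (hash := fun u m => f u (sample u (polyHash hm hb κ m)))
    (inv := fun u _ ρ => sample u ρ)
    (fin := fun u z _ => Fin.append (forgedSig A z)
      (sample u (polyHash hm hb κ (forgedMsg A z))))
    (start := fun u => u)
    (hashC.mono (by omega))
    ((hsample.app₂ (F := sample) (Comp.wires Sum.inl)
      (Comp.wires fun i => Sum.inr (Sum.inr i))).mono (by omega)) finC
    ((Comp.wires id).mono (by omega))
  refine ⟨C, hC.trans (simulator_size_le hwidth hpkl hops hmsg hsc (by omega) hpkl hran hdom
    (by omega) (by omega)), fun pk => ?_⟩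
  refine hC' _ _ rfl pk (fun _ z => forgedSig A z ∈ D ∧
      sample pk (polyHash hm hb κ (forgedMsg A z)) ∈ D ∧
      forgedSig A z ≠ sample pk (polyHash hm hb κ (forgedMsg A z)) ∧
      f pk (forgedSig A z) = f pk (sample pk (polyHash hm hb κ (forgedMsg A z)))) _ ?_
  intro g z
  simp only [Fin.append_left, Fin.append_right]

end

/-! ### The success probability for a fixed key pair -/

/-- The success probability against the real scheme for a fixed key pair is bounded by the
advantage `δ` against the pseudorandom function, by that of finding a collision, and by the
statistical parameters. -/
theorem expect_game_le_collision {msg ran dom pkl sc ic m kl : ℕ}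
    {A : QCircuit (forgerSpec msg ran dom) pkl (msg + dom)} {D : Finset (Bits dom)} (pk : Bits pkl)
    {f : Bits dom → Bits ran} {sample : Bits sc → Bits dom} {finv : Bits ran → Bits ic → Bits dom}
    {R : Finset (Bits ran)} (hR : ∀ c, f (sample c) ∈ R) (hD : ∀ c, sample c ∈ D) {ε₁ ε₂ ε₃ δ : ℝ}
    (h₁ : ∑ y ∈ R, |prEq (fun c => f (sample c)) y - 1 / (R.card : ℝ)| ≤ ε₁)
    (h₂ : ∀ y ∈ R, 0 < prEq (fun c => f (sample c)) y →
      ∑ x, |prEq (finv y) x - condPr sample f y x| ≤ ε₂)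
    (h₃ : ∀ y ∈ R, 0 < prEq (fun c => f (sample c)) y → ∀ x, condPr sample f y x ≤ ε₃)
    (hm : m ≠ 0) (ha : msg ≤ m) (hb : sc ≤ m) (F : Bits kl → Bits msg → Bits ic)
    (hF : ∀ κ : Fin (2 * A.ops.length + 1) → GaloisField 2 m,
      |(𝔼 k, trapdoorWin A D pk f sample finv (polyHash hm hb κ) (F k)) -
        𝔼 ρ, trapdoorWin A D pk f sample finv (polyHash hm hb κ) ρ| ≤ δ) :
    (𝔼 k, 𝔼 H : Bits msg → R,
      runProb (forgerImpl (fun m => (H m).1) fun m => finv (H m).1 (F k m))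
        (fun tr z => IsForgery A D f (H (forgedMsg A z)).1 tr z) A.ops [] (A.init pk)) ≤
    (𝔼 κ : Fin (2 * A.ops.length + 1) → GaloisField 2 m,
      collisionWin A D pk f sample (polyHash hm hb κ)) +
      (δ + ε₃ + (A.ops.length + 1) * (18 * (Real.sqrt ε₁ + Real.sqrt ε₂))) := by
  have hconst : ∀ {ι : Type} [Fintype ι] [Nonempty ι] (u : ι → ℝ) (e : ℝ),
      (𝔼 i, (u i + e)) = (𝔼 i, u i) + e := by
    intro ι _ _ u e
    rw [Finset.expect_add_distrib, Fintype.expect_const]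
  calc _ ≤ 𝔼 k, ((𝔼 c, trapdoorWin A D pk f sample finv c (F k)) +
          18 * (A.ops.length + 1) * Real.sqrt ε₁) :=
        Finset.expect_le_expect fun k _ => expect_game_le pk hR h₁ (F k)
    _ = (𝔼 κ : Fin (2 * A.ops.length + 1) → GaloisField 2 m, 𝔼 k,
          trapdoorWin A D pk f sample finv (polyHash hm hb κ) (F k)) +
          18 * (A.ops.length + 1) * Real.sqrt ε₁ := by
        simp only [hconst, ← expect_trapdoorWin_polyHash pk hm ha hb]
        rw [Finset.expect_comm]
    _ ≤ (𝔼 κ : Fin (2 * A.ops.length + 1) → GaloisField 2 m, ((𝔼 ρ,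
          trapdoorWin A D pk f sample finv (polyHash hm hb κ) ρ) + δ)) +
          18 * (A.ops.length + 1) * Real.sqrt ε₁ :=
        add_le_add_left (Finset.expect_le_expect fun κ _ =>
          sub_le_iff_le_add'.1 (le_of_abs_le (hF κ))) _
    _ = (𝔼 ρ, 𝔼 c, trapdoorWin A D pk f sample finv c ρ) + δ +
          18 * (A.ops.length + 1) * Real.sqrt ε₁ := by
        rw [hconst, Finset.expect_comm]
        simp only [expect_trapdoorWin_polyHash pk hm ha hb]
    _ ≤ (𝔼 c, collisionWin A D pk f sample c) +
        (δ + ε₃ + (A.ops.length + 1) * (18 * (Real.sqrt ε₁ + Real.sqrt ε₂))) := by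
        have h4 := expect_trapdoorWin_le (A := A) (D := D) pk hR h₂
        have h5 := expect_sampleWin_le (A := A) pk hR hD h₃
        linarith
    _ = _ := by rw [expect_collisionWin_polyHash pk hm ha hb]

/-! ### Polynomial bounds and negligible functions -/

/-- `f` is bounded by a polynomial. -/
def PolyBounded (f : ℕ → ℕ) : Prop := ∃ p : Polynomial ℕ, ∀ n, f n ≤ p.eval n

theorem PolyBounded.const (c : ℕ) : PolyBounded fun _ => c := ⟨Polynomial.C c, by simp⟩

theorem PolyBounded.add {f g : ℕ → ℕ} : PolyBounded f → PolyBounded g →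
    PolyBounded fun n => f n + g n := by
  rintro ⟨p, hp⟩ ⟨q, hq⟩
  exact ⟨p + q, fun n => by simpa using Nat.add_le_add (hp n) (hq n)⟩

theorem PolyBounded.mul {f g : ℕ → ℕ} : PolyBounded f → PolyBounded g →
    PolyBounded fun n => f n * g n := by
  rintro ⟨p, hp⟩ ⟨q, hq⟩
  exact ⟨p * q, fun n => by simpa using Nat.mul_le_mul (hp n) (hq n)⟩

theorem PolyBounded.of_le {f g : ℕ → ℕ} (hg : PolyBounded g) (h : ∀ n, f n ≤ g n) :
    PolyBounded f := by
  obtain ⟨p, hp⟩ := hg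
  exact ⟨p, fun n => (h n).trans (hp n)⟩

theorem Efficient.exists_comp {a b : ℕ → ℕ} {f : ∀ n, Bits (a n) → Bits (b n)} (h : Efficient f) :
    ∃ s, PolyBounded s ∧ ∀ n, a n ≤ s n ∧ b n ≤ s n ∧ Comp (s n) (f n) := by
  obtain ⟨p, hp⟩ := h
  refine ⟨fun n => p.eval n, ⟨p, fun _ => le_rfl⟩, fun n => ?_⟩
  beta_reduce
  obtain ⟨C, hC, hC'⟩ := hp n
  unfold BoolCircuit.size at hC
  exact ⟨by omega, by omega, (C.comp_eval.mono (by omega)).congr fun x j => by rw [hC']⟩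

theorem Efficient₂.exists_comp {a b c : ℕ → ℕ} {f : ∀ n, Bits (a n) → Bits (b n) → Bits (c n)}
    (h : Efficient₂ f) :
    ∃ s, PolyBounded s ∧ ∀ n, a n ≤ s n ∧ b n ≤ s n ∧ c n ≤ s n ∧
      Comp (s n) fun x : Fin (a n) ⊕ Fin (b n) → Bool =>
        f n (fun i => x (.inl i)) (fun i => x (.inr i)) := by
  obtain ⟨s, hs, hs'⟩ := Efficient.exists_comp h
  refine ⟨s, hs, fun n => ?_⟩
  obtain ⟨h1, h2, h3⟩ := hs' n
  refine ⟨by omega, by omega, h2, ((h3.comp (Comp.wires finSumFinEquiv.symm)).mono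
    (by omega)).congr fun x j => ?_⟩
  simp only [finSumFinEquiv_symm_apply_castAdd, finSumFinEquiv_symm_apply_natAdd]

theorem Efficient₃.exists_comp {a b c d : ℕ → ℕ}
    {f : ∀ n, Bits (a n) → Bits (b n) → Bits (c n) → Bits (d n)} (h : Efficient₃ f) :
    ∃ s, PolyBounded s ∧ ∀ n, c n ≤ s n ∧
      Comp (s n) fun x : (Fin (a n) ⊕ Fin (b n)) ⊕ Fin (c n) → Bool =>
        f n (fun i => x (.inl (.inl i))) (fun i => x (.inl (.inr i))) (fun i => x (.inr i)) := by
  obtain ⟨s, hs, hs'⟩ := Efficient₂.exists_comp h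
  refine ⟨s, hs, fun n => ?_⟩
  obtain ⟨h1, h2, h3, h4⟩ := hs' n
  refine ⟨h2, ((h4.comp ((Comp.wires fun i => Sum.inl (finSumFinEquiv.symm i)).elim
    (Comp.wires Sum.inr))).mono (by omega)).congr fun x j => ?_⟩
  simp only [Sum.elim_inl, Sum.elim_inr, finSumFinEquiv_symm_apply_castAdd,
    finSumFinEquiv_symm_apply_natAdd]

/-- Negative values are harmless, since their square root is zero. -/
theorem Negligible.sqrt {ε : ℕ → ℝ} (h : Negligible ε) : Negligible fun n => Real.sqrt (ε n) := by
  have habs := (Asymptotics.superpolynomialDecay_iff_superpolynomialDecay_abs _ _ _).1 h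
  intro k
  have h2 := (habs (2 * k)).sqrt
  rw [Real.sqrt_zero] at h2
  refine squeeze_zero (fun n => by positivity) (fun n => ?_) h2
  simp only [Nat.abs_cast]
  rw [Real.sqrt_mul (by positivity), pow_mul', Real.sqrt_sq (by positivity)]
  exact mul_le_mul_of_nonneg_left (Real.sqrt_le_sqrt (le_abs_self _)) (by positivity)

theorem Negligible.polyBounded_mul {ε : ℕ → ℝ} (h : Negligible ε) {f : ℕ → ℕ}
    (hf : PolyBounded f) : Negligible fun n => (f n : ℝ) * ε n := by
  obtain ⟨p, hp⟩ := hf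
  refine (h.polynomial_mul (p.map (Nat.castRingHom ℝ))).trans_abs_le fun n => ?_
  rw [abs_mul, abs_mul, Nat.abs_cast]
  refine mul_le_mul_of_nonneg_right ?_ (abs_nonneg _)
  refine le_trans ?_ (le_abs_self _)
  rw [Polynomial.eval_natCast_map]
  exact Nat.cast_le.2 (hp n)

theorem expect_bits_add {a b : ℕ} (Φ : Bits a → Bits b → ℝ) :
    (𝔼 r : Bits (a + b), Φ (fun i => r (Fin.castAdd b i)) fun i => r (Fin.natAdd a i)) =
      𝔼 x, 𝔼 y, Φ x y := by
  rw [← Fintype.expect_equiv (Fin.appendEquiv a b) (fun p => Φ p.1 p.2) _ fun p => ?_,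
    ← Finset.univ_product_univ, Finset.expect_product]
  simp [Fin.appendEquiv]

/-! ### Security of the signature scheme -/

theorem fdhPSF_isCorrect {𝓕 : PSFData} (hPSF : 𝓕.IsPSF) {msgLen : ℕ → ℕ}
    (P : KeyedFamily msgLen 𝓕.invCoins) : (fdhPSF 𝓕 P).IsCorrect :=
  fun n r H m => hPSF.finv_correct n (fun i => r (Fin.castAdd (P.keyLen n) i)) _ (H m).2 _

/-- A forger yields a distinguisher and a collision finder, whose advantages bound its own up to the
statistical parameters. -/
theorem fdhPSF_secure {𝓕 : PSFData} (hPSF : 𝓕.IsPSF) (hcol : 𝓕.colProblem.Hard) {msgLen : ℕ → ℕ}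
    {P : KeyedFamily msgLen 𝓕.invCoins} (hP : P.IsClassicalAccessPRF) : (fdhPSF 𝓕 P).Secure := by
  intro A hA
  change ∀ n, QCircuit (forgerSpec (msgLen n) (𝓕.ranLen n) (𝓕.domLen n)) (𝓕.pkLen n)
    (msgLen n + 𝓕.domLen n) at A
  obtain ⟨pA, hA⟩ := hA
  obtain ⟨s₁, hs₁, hf⟩ := Efficient₂.exists_comp hPSF.f_efficient
  obtain ⟨s₂, hs₂, hsample⟩ := Efficient₂.exists_comp hPSF.sample_efficient
  obtain ⟨s₃, hs₃, hfinv⟩ := Efficient₃.exists_comp hPSF.finv_efficient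
  obtain ⟨s₄, hs₄, hD⟩ := Efficient.exists_comp hPSF.D_efficient
  obtain ⟨s₅, hs₅, hmsg⟩ := Efficient₂.exists_comp hP.1
  obtain ⟨ε₁, hε₁, h₁⟩ := hPSF.sample_uniform
  obtain ⟨ε₂, hε₂, h₂⟩ := hPSF.finv_dist
  obtain ⟨ε₃, hε₃, h₃⟩ := hPSF.min_entropy
  -- a common polynomial bound for all lengths and circuit sizes
  obtain ⟨T, hTdef⟩ : ∃ T : ℕ → ℕ, T = fun n =>
    s₁ n + s₂ n + s₃ n + s₄ n + s₅ n + pA.eval n + 1 := ⟨_, rfl⟩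
  have hT : PolyBounded T := by
    rw [hTdef]
    exact (((((hs₁.add hs₂).add hs₃).add hs₄).add hs₅).add ⟨pA, fun _ => le_rfl⟩).add (.const 1)
  have hle : ∀ n, s₁ n ≤ T n ∧ s₂ n ≤ T n ∧ s₃ n ≤ T n ∧ s₄ n ≤ T n ∧ s₅ n ≤ T n ∧
      pA.eval n ≤ T n ∧ 0 < T n := by
    intro n
    rw [hTdef]
    refine ⟨?_, ?_, ?_, ?_, ?_, ?_, ?_⟩ <;> beta_reduce <;> omega
  have hAT : ∀ n, (A n).size ≤ T n := fun n => (hA n).trans (hle n).2.2.2.2.2.1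
  have hops : ∀ n, (A n).ops.length ≤ T n := fun n => (Nat.le_add_left _ _).trans (hAT n)
  -- the degree of the field used for hashing
  let m : ℕ → ℕ := fun n => msgLen n + 𝓕.sampleCoins n + 1
  have hm : ∀ n, m n ≠ 0 := fun n => Nat.succ_ne_zero _
  have ha : ∀ n, msgLen n ≤ m n := fun n => by simp only [m]; omega
  have hb : ∀ n, 𝓕.sampleCoins n ≤ m n := fun n => by simp only [m]; omega
  have hmT : ∀ n, m n ≤ 2 * T n + 1 := fun n => by
    have := (hmsg n).2.1
    have := (hsample n).2.1
    have := hle n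
    simp only [m]
    omega
  have hbound : PolyBounded fun n => 300 * (T n + 1) *
      (hashSize (2 * (A n).ops.length + 1) (m n) + 40 * (T n + 1) * (T n + 1)) := by
    have hT1 := hT.add (.const 1)
    have hm' : PolyBounded m := (((PolyBounded.const 2).mul hT).add (.const 1)).of_le hmT
    have hd : PolyBounded fun n => 2 * (A n).ops.length + 1 :=
      ((PolyBounded.const 2).mul (hT.of_le hops)).add (.const 1)
    exact ((PolyBounded.const 300).mul hT1).mul
      ((hd.mul ((hm'.mul ((hm'.mul hm').mul (.const 16))).add (hm'.mul (.const 6)))).add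
        (((PolyBounded.const 40).mul hT1).mul hT1))
  let Key : ℕ → Type := fun n => Fin (2 * (A n).ops.length + 1) → GaloisField 2 (m n)
  let tw : ∀ n, Bits (𝓕.genCoins n) → Key n → (Bits (msgLen n) → Bits (𝓕.invCoins n)) → ℝ :=
    fun n r κ => trapdoorWin (A n) (𝓕.D n) (𝓕.gen n r).2 (𝓕.f n (𝓕.gen n r).2)
      (𝓕.sample n (𝓕.gen n r).2) (𝓕.finv n (𝓕.gen n r).1) (polyHash (hm n) (hb n) κ)
  let cw : ∀ n, Bits (𝓕.genCoins n) → Key n → ℝ :=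
    fun n r κ => collisionWin (A n) (𝓕.D n) (𝓕.gen n r).2 (𝓕.f n (𝓕.gen n r).2)
      (𝓕.sample n (𝓕.gen n r).2) (polyHash (hm n) (hb n) κ)
  -- the best distinguisher with a hard-wired key pair and hash key
  have hdist : ∀ n, ∃ C : QCircuit (OracleSpec.single (msgLen n) (𝓕.invCoins n) true) 0 1,
      C.size ≤ 300 * (T n + 1) *
        (hashSize (2 * (A n).ops.length + 1) (m n) + 40 * (T n + 1) * (T n + 1)) ∧
      ∀ r κ, |(𝔼 k, tw n r κ (P.eval n k)) - 𝔼 ρ, tw n r κ ρ| ≤ P.advantage true n C := by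
    intro n
    obtain ⟨⟨r₀, κ₀⟩, hmax⟩ := Finite.exists_max fun p : Bits (𝓕.genCoins n) × Key n =>
      |(𝔼 k, tw n p.1 p.2 (P.eval n k)) - 𝔼 ρ, tw n p.1 p.2 ρ|
    obtain ⟨l1, l2, l3, l4, l5, l6, l7⟩ := hle n
    obtain ⟨C, hC, hC'⟩ := exists_distinguisher (A n) ((hf n).2.2.2.mono l1)
      ((hsample n).2.2.2.mono l2) ((hfinv n).2.mono l3)
      (((hD n).2.2.reindex fun _ => 0).mono l4) ((hmsg n).2.1.trans l5) ((hf n).2.2.1.trans l1)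
      ((hf n).2.1.trans l1) ((hf n).1.trans l1) ((hfinv n).1.trans l3) (hAT n) l7
      (𝓕.gen n r₀).2 (𝓕.gen n r₀).1 (hm n) (hb n) κ₀
    refine ⟨C, hC, fun r κ => (hmax (r, κ)).trans (le_of_eq ?_)⟩
    simp only [KeyedFamily.advantage, hC']
    rfl
  -- the collision finder with the best hash key
  have hfind : ∀ n, ∃ C : QCircuit OracleSpec.none (𝓕.pkLen n) (𝓕.domLen n + 𝓕.domLen n),
      C.size ≤ 300 * (T n + 1) *
        (hashSize (2 * (A n).ops.length + 1) (m n) + 40 * (T n + 1) * (T n + 1)) ∧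
      ∀ κ, (𝔼 r, cw n r κ) ≤ 𝓕.colProblem.advantage n C := by
    intro n
    obtain ⟨κ₀, hmax⟩ := Finite.exists_max fun κ : Key n => 𝔼 r, cw n r κ
    obtain ⟨l1, l2, l3, l4, l5, l6, l7⟩ := hle n
    obtain ⟨C, hC, hC'⟩ := exists_collisionFinder (A n) (D := 𝓕.D n) ((hf n).2.2.2.mono l1)
      ((hsample n).2.2.2.mono l2) ((hmsg n).2.1.trans l5) ((hf n).2.2.1.trans l1)
      ((hf n).2.1.trans l1) ((hf n).1.trans l1) ((hsample n).2.1.trans l2) (hAT n)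
      (hm n) (hb n) κ₀
    refine ⟨C, hC, fun κ => (hmax κ).trans ?_⟩
    refine le_trans (le_of_eq ?_) (le_abs_self _)
    refine Eq.trans ?_ (sub_zero _).symm
    exact Finset.expect_congr rfl fun r _ => (hC' _).symm
  choose Dc hDc hDc' using hdist
  choose Bc hBc hBc' using hfind
  have hneg : Negligible fun n => 𝓕.colProblem.advantage n (Bc n) +
      (P.advantage true n (Dc n) + ε₃ n +
        ((T n + 1 : ℕ) : ℝ) * (18 * (Real.sqrt (ε₁ n) + Real.sqrt (ε₂ n)))) :=
    (hcol Bc (hbound.of_le hBc)).add (((hP.2 Dc (hbound.of_le hDc)).add hε₃).add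
      (Negligible.polyBounded_mul ((hε₁.sqrt.add hε₂.sqrt).const_mul 18) (hT.add (.const 1))))
  refine hneg.trans_abs_le fun n => ?_
  have hwin : (fdhPSF 𝓕 P).sigForge.winProb n (A n) =
      𝔼 r, 𝔼 k, 𝔼 H : Bits (msgLen n) → 𝓕.R n,
        runProb (forgerImpl (fun m => (H m).1) fun m =>
            𝓕.finv n (𝓕.gen n r).1 (H m).1 (P.eval n k m))
          (fun tr z => IsForgery (A n) (𝓕.D n) (𝓕.f n (𝓕.gen n r).2)
            (H (forgedMsg (A n) z)).1 tr z) (A n).ops [] ((A n).init (𝓕.gen n r).2) :=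
    expect_bits_add fun r k => 𝔼 H : Bits (msgLen n) → 𝓕.R n,
        runProb (forgerImpl (fun m => (H m).1) fun m =>
            𝓕.finv n (𝓕.gen n r).1 (H m).1 (P.eval n k m))
          (fun tr z => IsForgery (A n) (𝓕.D n) (𝓕.f n (𝓕.gen n r).2)
            (H (forgedMsg (A n) z)).1 tr z) (A n).ops [] ((A n).init (𝓕.gen n r).2)
  have hnonneg : 0 ≤ (fdhPSF 𝓕 P).sigForge.winProb n (A n) := by
    rw [hwin]
    exact Finset.expect_nonneg fun _ _ => Finset.expect_nonneg fun _ _ =>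
      Finset.expect_nonneg fun _ _ => runProb_nonneg _ _ _ _ _
  have hadv : (fdhPSF 𝓕 P).sigForge.advantage n (A n) =
      (fdhPSF 𝓕 P).sigForge.winProb n (A n) :=
    (congrArg abs (sub_zero _)).trans (abs_of_nonneg hnonneg)
  refine le_trans ?_ (le_abs_self _)
  change |(fdhPSF 𝓕 P).sigForge.advantage n (A n)| ≤ _
  rw [hadv, abs_of_nonneg hnonneg, hwin]
  calc _ ≤ 𝔼 r, ((𝔼 κ, cw n r κ) + (P.advantage true n (Dc n) + ε₃ n +
        ((A n).ops.length + 1) * (18 * (Real.sqrt (ε₁ n) + Real.sqrt (ε₂ n))))) :=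
        Finset.expect_le_expect fun r _ => expect_game_le_collision (A := A n) _
          (fun c => hPSF.f_mem n r _ (hPSF.sample_mem n r c)) (hPSF.sample_mem n r) (h₁ n r)
          (h₂ n r) (h₃ n r) (hm n) (ha n) (hb n) (P.eval n) (hDc' n r)
    _ = (𝔼 κ, 𝔼 r, cw n r κ) + (P.advantage true n (Dc n) + ε₃ n +
        ((A n).ops.length + 1) * (18 * (Real.sqrt (ε₁ n) + Real.sqrt (ε₂ n)))) := by
        rw [Finset.expect_add_distrib, Fintype.expect_const, Finset.expect_comm]
    _ ≤ _ := by
        refine add_le_add ?_ (add_le_add_right (mul_le_mul_of_nonneg_right ?_ (by positivity)) _)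
        · exact (Finset.expect_le_expect fun κ _ => hBc' n κ).trans_eq (Fintype.expect_const _)
        · exact_mod_cast Nat.succ_le_succ (hops n)
theorem mainTheorem6 (hPRF : QuantumAccessiblePRFsExist)
    (𝓕 : PSFData) (hPSF : 𝓕.IsPSF) (hsec : 𝓕.SecureAgainstQuantum)
    (msgLen : ℕ → ℕ) (P : KeyedFamily msgLen 𝓕.invCoins) (hP : P.IsClassicalAccessPRF) :
    (fdhPSF 𝓕 P).IsCorrect ∧ (fdhPSF 𝓕 P).Secure :=
  ⟨fdhPSF_isCorrect hPSF P, fdhPSF_secure hPSF hsec.2 hP⟩
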